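/- **Notation.** Let $n,k,N\ge 1$ and $q=(q_1,\dots,q_N)$ be positive integers. $\mathcal A_Q(\mathbb R^m)$ is the space of unordered $Q$-tuples $T=\sum_{i=1}^Q[\![T_i]\!]$, $T_i\in\mathbb R^m$, with metric $\mathcal G(S,T)=\min_{\sigma}\big(\sum_i|S_i-T_{\sigma(i)}|^2\big)^{1/2}$ ($\sigma$ ranging over permutations), and $|T|=\mathcal G(T,Q[\![0]\!])$. For $c\in\mathbb R^m$ write $T-c=\sum_i[\![T_i-c]\!]$; $T_a=Q^{-1}\sum_iT_i$ and $T_s=T-T_a$ are the average and symmetric part. A function $u$ with values in $\mathcal A_Q(\mathbb R^m)$ is differentiable at $x$ with $Du(x)=\sum_i[\![A_i]\!]$ if $\mathcal G\big(u(x+h),\sum_i[\![u_i(x)+A_ih]\!]\big)=o(|h|)$; $u\in C^1$ if it is differentiable everywhere with $Du$ continuous, and $u\in C^{1,\alpha}(U)$ ($U$ open) if in addition $Du$ is locally $\alpha$-Hölder in $U$. $C^{0,\alpha}(\overline S)$ consists of the functions on $S$ that have an $\alpha$-Hölder extension to $\overline S$, and $C^{1,\alpha}(\overline S)$ of the $C^1$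 functions on $S$ such that they and their derivatives lie in $C^{0,\alpha}(\overline S)$. For $u=(u^1,\dots,u^N)$ put $|u|^2=\sum_i|u^i|^2$, $\mathcal G(u,w)^2=\sum_i\mathcal G(u^i,w^i)^2$. For $u\in C^1(U;\mathcal A_Q(\mathbb R^k))$ with $U\subset\mathbb R^n$ open, the branch set $\mathcal B_u$ is the set of $x\in U$ about which there is no ball $B_\rho(x)\subset U$ on which $u=\sum_i[\![u_i]\!]$ with single-valued $C^1$ functions $u_i$; $u$ is harmonic if about each $x\in U\setminus\mathcal B_u$ it has such a decomposition with harmonic $u_i$. A harmonic $u$ is *good* if $u\in C^{1,1/Q}(U)$, $\dim_{\mathcal H}\mathcal B_u\le n-2$, and for all $x\in\mathcal B_u$, $0<\sigma\le\rho<\mathrm{dist}(x,\partial U)$, $$\sigma^{-n}\int_{B_\sigma(x)}|u_s|^2\le(\sigma/\rho)^{2(1+1/Q)}\rho^{-n}\int_{B_\rho(x)}|u_s|^2 .$$ Let $H=\{x\in\mathbb R^n:x^1>0\}$, $\Omega=B_1(0)\cap H$, $R_z(x)=|x-z|$. For $z\in\partial H\cap B_1(0)$ $v^i_a(z)$ and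 $Dv^i_a(z)$ denote the boundary value and derivative at $z$ of $v^i_a$, determined by $v_a^i(x)=v^i_a(z)+Dv^i_a(z)(x-z)+o(|x-z|)$ as $x\to z$, $x\in\Omega$ (conditions involving them are imposed where they exist), and $\ell_{v^i,z}(x)=v_a^i(z)+Dv_a^i(z)(x-z)$. A set $\mathfrak B$ of functions $v=(v^1,\dots,v^N)$, $v^i:\Omega\to\mathcal A_{q_i}(\mathbb R^k)$, is a (proper, half-plane) *blow-up class with constant* $C_1\in(0,\infty)$ if for all $v\in\mathfrak B$: 1. $v^i\in L^2(\Omega)\cap W^{1,2}_{\mathrm{loc}}(\Omega)$ for each $i$. 2. Each $v^i$ is a good $q_i$-valued harmonic function on $\Omega$. 3. There is a smooth $\kappa:B_1(0)\cap\partial H\to(\mathbb R^k)^N$ such that for $z\in B_1(0)\cap\partial H$ and $0<\rho\le\frac38(1-|z|)$ $$\int_{B_{\rho/2}(z)\cap\Omega}\sum_i\frac{|v^i(x)-\kappa^i(z)|^2}{|x-z|^{n+3/2}}\,dx\le C_1\rho^{-n-3/2}\int_{B_\rho(z)\cap\Omega}\sum_i|v^i-\kappa^i(z)|^2,$$ and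 $\sup_{B_{5/16}(0)\cap\partial H}|\kappa|^2\le C_1\int_{B_{1/2}(0)\cap\Omega}|v|^2$. 4. For the same $z,\rho$, $$\int_{B_{\rho/2}(z)\cap\Omega}\sum_iR_z^{2-n}\Big|\frac{\partial}{\partial R_z}\Big(\frac{v^i-v_a^i(z)}{R_z}\Big)\Big|^2\le C_1\rho^{-n-2}\int_{B_\rho(z)\cap\Omega}\sum_i|v^i-\ell_{v^i,z}|^2 .$$ 5. (I) For $z\in B_1(0)\cap\partial H$ and $0<\sigma\le\frac38(1-|z|)$, if $v\not\equiv0$ on $B_\sigma(z)\cap\Omega$ then $\|v(z+\sigma\,\cdot)\|_{L^2(\Omega)}^{-1}v(z+\sigma\,\cdot)\in\mathfrak B$. (II) With $\ell_v=(\ell_{v^i,0})_i$, if $v-\ell_v\not\equiv0$ on $\Omega$, then $\|v-\ell_v\|_{L^2(\Omega)}^{-1}(v-\ell_v)\in\mathfrak B$. 6. Every sequence in $\mathfrak B$ has a subsequence converging to an element of $\mathfrak B$ strongly in $L^2_{\mathrm{loc}}(B_1(0)\cap\overline H)$ and weakly in $W^{1,2}_{\mathrm{loc}}(\Omega)$.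 7. There are $\alpha_1,\epsilon\in(0,1)$ depending only on $\mathfrak B$ such that if $v^i_a(0)=0$ and $Dv^i_a(0)=0$ for all $i$, $\|v\|_{L^2(\Omega)}=1$, and $\int_\Omega\mathcal G(v,v_*)^2<\epsilon$ for some $v_*$ of the form $v_*^i(x)=\sum_{j=1}^{q_i}[\![b^i_jx^1]\!]$, $b^i_j\in\mathbb R^k$, $\sum_jb^i_j=0$ for each $i$, with $q_{i_*}>1$ and $v_*^{i_*}\not\equiv0$ for some $i_*$, then $v|_{B_{1/2}(0)\cap H}\in C^{1,\alpha_1}(\overline{B_{1/2}(0)\cap H})$. Here $W^{1,2}_{\mathrm{loc}}(\Omega;\mathcal A_Q)$ consists of the $u\in L^2_{\mathrm{loc}}$ for which there is $\varphi\in L^2_{\mathrm{loc}}(\Omega)$ such that each $x\mapsto\mathcal G(u(x),T)$ is weakly differentiable with gradient bounded by $\varphi$ a.e. ("$\varphi$ bounds $|Du|$"), and weak convergence in $W^{1,2}_{\mathrm{loc}}$ means, on each compact subset, convergence in $L^2$ together with uniformly bounded energies $\int|Du|^2$. **Lemma (initial $C^{0,\alpha}$ boundary regularity).** For all $n,k\ge1$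 and $C_1\in(0,\infty)$ there are $\alpha=\alpha(C_1,n,k)\in(0,1)$ and $C=C(C_1,n,k)\in(0,\infty)$ such that for all $N$ and $q$, every blow-up class $\mathfrak B$ with constant $C_1$, and every $v\in\mathfrak B$, we have $v|_{B_{1/8}(0)\cap H}\in C^{0,\alpha}(\overline{B_{1/8}(0)\cap H})$ with $$\|v\|_{0,\alpha;B_{1/8}(0)\cap H}\le C\Big(\int_{B_{1/2}(0)\cap H}|v|^2\Big)^{1/2},$$ where $\|v\|_{0,\alpha}$ is the supremum of $|v|$ plus the $\alpha$-Hölder seminorm with respect to $\mathcal G$, both for the extension of $v$ to the closure. -/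

import Mathlib

open MeasureTheory Set Filter Topology Metric
open scoped ENNReal ContDiff

noncomputable section

namespace MultiValued

/-! ### Unordered tuples -/

/-- The unordered `Q`-tuple `∑ i, ⟦f i⟧`. The space `𝒜_Q(V)` is Mathlib's `Sym V Q`. -/
def tuple {V : Type*} {Q : ℕ} (f : Fin Q → V) : Sym V Q :=
  ⟨Finset.univ.val.map f, by simp⟩

/-- The metric `𝒢` on unordered tuples: the least value of `(∑ i, |f i - g i| ^ 2) ^ (1/2)` over
all enumerations `f` of `S` and `g` of `T`. -/
def qdist {V : Type*} [NormedAddCommGroup V] {Q : ℕ} (S T : Sym V Q) : ℝ :=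
  sInf {r : ℝ | ∃ f g : Fin Q → V,
    tuple f = S ∧ tuple g = T ∧ r = Real.sqrt (∑ i, ‖f i - g i‖ ^ 2)}

/-- `|T| = 𝒢(T, Q⟦0⟧)`. -/
def qnorm {V : Type*} [NormedAddCommGroup V] {Q : ℕ} (T : Sym V Q) : ℝ :=
  qdist T (tuple fun _ => 0)

/-- The average `Q⁻¹ ∑ i, T_i`. -/
def mean {V : Type*} [NormedAddCommGroup V] [NormedSpace ℝ V] {Q : ℕ} (T : Sym V Q) : V :=
  (Q : ℝ)⁻¹ • (T : Multiset V).sum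

/-- `T - c = ∑ i, ⟦T_i - c⟧`. -/
def shift {V : Type*} [NormedAddCommGroup V] {Q : ℕ} (T : Sym V Q) (c : V) : Sym V Q :=
  T.map fun t => t - c

/-- The symmetric part `T - mean T`. -/
def symPart {V : Type*} [NormedAddCommGroup V] [NormedSpace ℝ V] {Q : ℕ} (T : Sym V Q) :
    Sym V Q :=
  shift T (mean T)

/-! ### Regularity of multi-valued functions

Functions on an open set `U` are represented by functions on the whole space; only their values
on `U` matter. -/

/-- `u(x) = ∑ i, ⟦f i⟧` and `h ↦ ∑ i, ⟦f i + A i h⟧` approximates `h ↦ u (x + h)` to first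
order. -/
def HasJetAt {E V : Type*} [NormedAddCommGroup E] [NormedSpace ℝ E] [NormedAddCommGroup V]
    [NormedSpace ℝ V] {Q : ℕ} (u : E → Sym V Q) (x : E) (f : Fin Q → V)
    (A : Fin Q → E →L[ℝ] V) : Prop :=
  tuple f = u x ∧
    Tendsto (fun h : E => qdist (u (x + h)) (tuple fun i => f i + A i h) / ‖h‖) (𝓝[≠] 0) (𝓝 0)

def QDifferentiableAt {E V : Type*} [NormedAddCommGroup E] [NormedSpace ℝ E]
    [NormedAddCommGroup V] [NormedSpace ℝ V] {Q : ℕ} (u : E → Sym V Q) (x : E) : Prop :=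
  ∃ f A, HasJetAt u x f A

open Classical in
/-- The derivative `Du(x) = ∑ i, ⟦A i⟧` (and `Q⟦0⟧` if `u` is not differentiable at `x`). -/
def qderiv {E V : Type*} [NormedAddCommGroup E] [NormedSpace ℝ E] [NormedAddCommGroup V]
    [NormedSpace ℝ V] {Q : ℕ} (u : E → Sym V Q) (x : E) : Sym (E →L[ℝ] V) Q :=
  if h : ∃ f A, HasJetAt u x f A then tuple h.choose_spec.choose else tuple fun _ => 0

/-- `u` is `α`-Hölder continuous on `S`. -/
def HolderOn {E V : Type*} [NormedAddCommGroup E] [NormedAddCommGroup V] {Q : ℕ} (α : ℝ)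
    (u : E → Sym V Q) (S : Set E) : Prop :=
  ∃ M : ℝ, ∀ x ∈ S, ∀ y ∈ S, qdist (u x) (u y) ≤ M * dist x y ^ α

/-- `u|_S ∈ C^{0,α}(closure S)`: `u|_S` has an `α`-Hölder extension to the closure. -/
def HolderOnClosure {E V : Type*} [NormedAddCommGroup E] [NormedAddCommGroup V] {Q : ℕ} (α : ℝ)
    (u : E → Sym V Q) (S : Set E) : Prop :=
  ∃ w : E → Sym V Q, EqOn w u S ∧ HolderOn α w (closure S)

/-- `u ∈ C^1(U)`. -/
def MemC1 {E V : Type*} [NormedAddCommGroup E] [NormedSpace ℝ E] [NormedAddCommGroup V]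
    [NormedSpace ℝ V] {Q : ℕ} (u : E → Sym V Q) (U : Set E) : Prop :=
  (∀ x ∈ U, QDifferentiableAt u x) ∧
    ∀ x ∈ U, Tendsto (fun y => qdist (qderiv u y) (qderiv u x)) (𝓝 x) (𝓝 0)

/-- `u ∈ C^{1,α}(U)` for open `U`, in the interior sense: every point of `U` has a neighbourhood
on which `Du` is `α`-Hölder. -/
def MemC1Holder {E V : Type*} [NormedAddCommGroup E] [NormedSpace ℝ E] [NormedAddCommGroup V]
    [NormedSpace ℝ V] {Q : ℕ} (α : ℝ) (u : E → Sym V Q) (U : Set E) : Prop :=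
  MemC1 u U ∧ ∀ x ∈ U, ∃ r > 0, ball x r ⊆ U ∧ HolderOn α (qderiv u) (ball x r)

/-- `u|_S ∈ C^{1,α}(closure S)` for a bounded convex open set `S`. -/
def MemC1HolderClosure {E V : Type*} [NormedAddCommGroup E] [NormedSpace ℝ E]
    [NormedAddCommGroup V] [NormedSpace ℝ V] {Q : ℕ} (α : ℝ) (u : E → Sym V Q) (S : Set E) :
    Prop :=
  MemC1 u S ∧ HolderOnClosure α u S ∧ HolderOnClosure α (qderiv u) S

/-- The branch set of `u` in `U`. -/
def branchSet {E V : Type*} [NormedAddCommGroup E] [NormedSpace ℝ E] [NormedAddCommGroup V]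
    [NormedSpace ℝ V] {Q : ℕ} (u : E → Sym V Q) (U : Set E) : Set E :=
  {x | x ∈ U ∧ ¬ ∃ ρ > 0, ball x ρ ⊆ U ∧ ∃ f : Fin Q → E → V,
    (∀ i, ContDiffOn ℝ 1 (f i) (ball x ρ)) ∧ ∀ y ∈ ball x ρ, u y = tuple fun i => f i y}

abbrev Euc (n : ℕ) : Type := EuclideanSpace ℝ (Fin n)

/-- `u` is a `Q`-valued harmonic function on `U`. -/
def IsHarmonic {n k Q : ℕ} (u : Euc n → Sym (Euc k) Q) (U : Set (Euc n)) : Prop :=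
  MemC1 u U ∧ ∀ x ∈ U \ branchSet u U, ∃ ρ > 0, ball x ρ ⊆ U ∧ ∃ f : Fin Q → Euc n → Euc k,
    (∀ i, InnerProductSpace.HarmonicOnNhd (f i) (ball x ρ)) ∧
      ∀ y ∈ ball x ρ, u y = tuple fun i => f i y

/-- `u` is a good `Q`-valued harmonic function on the open set `U`. The empty set counts as having
dimension `≤ n - 2` for every `n`, and `closedBall x ρ ⊆ U` says that `ρ < dist(x, ∂U)`. -/
structure IsGoodHarmonic {n k Q : ℕ} (u : Euc n → Sym (Euc k) Q) (U : Set (Euc n)) : Prop where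
  harmonic : IsHarmonic u U
  regular : MemC1Holder (1 / (Q : ℝ)) u U
  dim_branch : branchSet u U = ∅ ∨ dimH (branchSet u U) + 2 ≤ (n : ℝ≥0∞)
  decay : ∀ x ∈ branchSet u U, ∀ σ ρ : ℝ, 0 < σ → σ ≤ ρ → closedBall x ρ ⊆ U →
    ENNReal.ofReal (σ⁻¹ ^ n) * ∫⁻ y in ball x σ, ENNReal.ofReal (qnorm (symPart (u y)) ^ 2) ≤
      ENNReal.ofReal ((σ / ρ) ^ (2 * (1 + 1 / (Q : ℝ)))) *
        (ENNReal.ofReal (ρ⁻¹ ^ n) *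
          ∫⁻ y in ball x ρ, ENNReal.ofReal (qnorm (symPart (u y)) ^ 2))

/-! ### Lebesgue and Sobolev spaces of multi-valued functions -/

/-- `u ∈ L²(U; 𝒜_Q)`. -/
def MemL2 {n k Q : ℕ} (u : Euc n → Sym (Euc k) Q) (U : Set (Euc n)) : Prop :=
  (∀ T, AEMeasurable (fun x => qdist (u x) T) (volume.restrict U)) ∧
    ∫⁻ x in U, ENNReal.ofReal (qnorm (u x) ^ 2) < ⊤

/-- `g` is the weak gradient of the real-valued function `f` on the open set `U`. -/
def HasWeakGradient {n : ℕ} (f : Euc n → ℝ) (g : Euc n → Euc n) (U : Set (Euc n)) : Prop :=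
  LocallyIntegrableOn f U ∧ LocallyIntegrableOn g U ∧
    ∀ φ : Euc n → ℝ, ContDiff ℝ ∞ φ → HasCompactSupport φ → tsupport φ ⊆ U → ∀ e : Euc n,
      ∫ x in U, f x * fderiv ℝ φ x e = - ∫ x in U, inner ℝ (g x) e * φ x

/-- `φ` bounds `|Du|` in the weak sense: every function `x ↦ 𝒢(u(x), T)` is weakly differentiable
on `U` with gradient of norm at most `φ` almost everywhere. -/
def IsGradientBound {n k Q : ℕ} (u : Euc n → Sym (Euc k) Q) (U : Set (Euc n))
    (φ : Euc n → ℝ) : Prop :=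
  AEMeasurable φ (volume.restrict U) ∧ ∀ T, ∃ g,
    HasWeakGradient (fun x => qdist (u x) T) g U ∧ ∀ᵐ x ∂(volume.restrict U), ‖g x‖ ≤ φ x

/-- `u ∈ W^{1,2}_loc(U; 𝒜_Q)`. -/
def MemW12loc {n k Q : ℕ} (u : Euc n → Sym (Euc k) Q) (U : Set (Euc n)) : Prop :=
  (∀ K ⊆ U, IsCompact K → MemL2 u K) ∧
    ∃ φ, IsGradientBound u U φ ∧
      ∀ K ⊆ U, IsCompact K → ∫⁻ x in K, ENNReal.ofReal (φ x ^ 2) < ⊤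

/-- `u_m → u` weakly in `W^{1,2}_loc(U; 𝒜_Q)`: on each compact subset of `U`, convergence in `L²`
together with a uniform bound on the Dirichlet energies. -/
def WeaklyConvergesW12loc {n k Q : ℕ} (u : ℕ → Euc n → Sym (Euc k) Q)
    (u₀ : Euc n → Sym (Euc k) Q) (U : Set (Euc n)) : Prop :=
  ∀ K ⊆ U, IsCompact K →
    Tendsto (fun m => ∫⁻ x in K, ENNReal.ofReal (qdist (u m x) (u₀ x) ^ 2)) atTop (𝓝 0) ∧
    ∃ M : ℝ, ∀ m, ∃ φ, IsGradientBound (u m) U φ ∧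
      ∫⁻ x in K, ENNReal.ofReal (φ x ^ 2) ≤ ENNReal.ofReal M

/-! ### Functions on the half-ball -/

/-- The half-space `H = {x¹ > 0}`; the codimension enters only as the dimension of the target. -/
def halfSpace (n : ℕ) [NeZero n] : Set (Euc n) := {x | 0 < x 0}

/-- `∂H = {x¹ = 0}`. -/
def bdry (n : ℕ) [NeZero n] : Set (Euc n) := {x | x 0 = 0}

/-- `Ω = B_1(0) ∩ H`. -/
def halfBall (n : ℕ) [NeZero n] : Set (Euc n) := ball 0 1 ∩ halfSpace n

/-- Functions `v = (v¹, …, v^N)`, where `vⁱ` is `q_i`-valued. -/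
abbrev MultiMap (n k : ℕ) {N : ℕ} (q : Fin N → ℕ) : Type :=
  (i : Fin N) → Euc n → Sym (Euc k) (q i)

/-- `∫_S |v|²`, where `|v|² = ∑ i, |vⁱ|²`. -/
def sqInt {n k N : ℕ} {q : Fin N → ℕ} (v : MultiMap n k q) (S : Set (Euc n)) : ℝ≥0∞ :=
  ∫⁻ x in S, ENNReal.ofReal (∑ i, qnorm (v i x) ^ 2)

/-- `∫_S 𝒢(v, w)²`, where `𝒢(v, w)² = ∑ i, 𝒢(vⁱ, wⁱ)²`. -/
def sqDistInt {n k N : ℕ} {q : Fin N → ℕ} (v w : MultiMap n k q) (S : Set (Euc n)) : ℝ≥0∞ :=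
  ∫⁻ x in S, ENNReal.ofReal (∑ i, qdist (v i x) (w i x) ^ 2)

/-- `‖v‖_{L²(Ω)}⁻¹ v`. -/
def normalize {n k N : ℕ} [NeZero n] {q : Fin N → ℕ} (v : MultiMap n k q) : MultiMap n k q :=
  fun i x => (v i x).map fun t => ((sqInt v (halfBall n)) ^ (1 / 2 : ℝ)).toReal⁻¹ • t

/-- The `C^{0,α}` norm on `S`: supremum norm plus Hölder seminorm. -/
def holderNorm {n k N : ℕ} {q : Fin N → ℕ} (α : ℝ) (v : MultiMap n k q) (S : Set (Euc n)) :
    ℝ≥0∞ :=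
  (⨆ x ∈ S, ENNReal.ofReal (Real.sqrt (∑ i, qnorm (v i x) ^ 2))) +
    ⨆ x ∈ S, ⨆ y ∈ S, ENNReal.ofReal (Real.sqrt (∑ i, qdist (v i x) (v i y) ^ 2)) /
      ENNReal.ofReal (dist x y ^ α)

/-- `f`, defined on `Ω`, has value `a` and derivative `A` at the (boundary) point `z`. -/
def HasBoundaryJet {n k : ℕ} [NeZero n] (f : Euc n → Euc k) (z : Euc n) (a : Euc k)
    (A : Euc n →L[ℝ] Euc k) : Prop :=
  (fun x => f x - (a + A (x - z))) =o[𝓝[halfBall n] z] fun x => x - z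

/-- `|∂w/∂R_z|²` at `x`, where `R_z = |x - z|`. -/
def radialDerivSq {n k Q : ℕ} (w : Euc n → Sym (Euc k) Q) (z x : Euc n) : ℝ :=
  qnorm ((qderiv w x).map fun A => A (‖x - z‖⁻¹ • (x - z))) ^ 2

/-- A proper half-plane blow-up class with constant `C₁`. A function on `Ω` is represented by any
of its extensions, so `𝔅` is a set of representatives and closure statements are up to equality
on `Ω`. The value `a i` and derivative `A i` of the average of `vⁱ` at boundary points enter
through `HasBoundaryJet`, which determines them. -/
structure IsBlowUpClass {n k N : ℕ} [NeZero n] {q : Fin N → ℕ} (C₁ : ℝ)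
    (𝔅 : Set (MultiMap n k q)) : Prop where
  integrability : ∀ v ∈ 𝔅, ∀ i, MemL2 (v i) (halfBall n) ∧ MemW12loc (v i) (halfBall n)
  interior : ∀ v ∈ 𝔅, ∀ i, IsGoodHarmonic (v i) (halfBall n)
  boundary : ∀ v ∈ 𝔅, ∃ κ : Euc n → Fin N → Euc k,
    ContDiffOn ℝ ∞ κ (ball 0 1 ∩ bdry n) ∧
    (∀ z ∈ ball 0 1 ∩ bdry n, ∀ ρ : ℝ, 0 < ρ → ρ ≤ 3 / 8 * (1 - ‖z‖) →
      ∫⁻ x in ball z (ρ / 2) ∩ halfBall n, ENNReal.ofReal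
          (∑ i, qnorm (shift (v i x) (κ z i)) ^ 2 / ‖x - z‖ ^ ((n : ℝ) + 3 / 2)) ≤
        ENNReal.ofReal (C₁ * ρ ^ (-(n : ℝ) - 3 / 2)) *
          ∫⁻ x in ball z ρ ∩ halfBall n, ENNReal.ofReal
            (∑ i, qnorm (shift (v i x) (κ z i)) ^ 2)) ∧
    (∀ z ∈ ball 0 (5 / 16) ∩ bdry n, ENNReal.ofReal (∑ i, ‖κ z i‖ ^ 2) ≤
      ENNReal.ofReal C₁ * sqInt v (ball 0 (1 / 2) ∩ halfBall n))
  hardtSimon : ∀ v ∈ 𝔅, ∀ z ∈ ball 0 1 ∩ bdry n, ∀ ρ : ℝ, 0 < ρ → ρ ≤ 3 / 8 * (1 - ‖z‖) →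
    ∀ (a : Fin N → Euc k) (A : Fin N → Euc n →L[ℝ] Euc k),
    (∀ i, HasBoundaryJet (fun x => mean (v i x)) z (a i) (A i)) →
      ∫⁻ x in ball z (ρ / 2) ∩ halfBall n, ENNReal.ofReal
          (∑ i, ‖x - z‖ ^ (2 - (n : ℝ)) *
            radialDerivSq (fun y => (v i y).map fun t => ‖y - z‖⁻¹ • (t - a i)) z x) ≤
        ENNReal.ofReal (C₁ * ρ ^ (-(n : ℝ) - 2)) *
          ∫⁻ x in ball z ρ ∩ halfBall n, ENNReal.ofReal
            (∑ i, qnorm (shift (v i x) (a i + A i (x - z))) ^ 2)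
  rescale : ∀ v ∈ 𝔅, ∀ z ∈ ball 0 1 ∩ bdry n, ∀ σ : ℝ, 0 < σ → σ ≤ 3 / 8 * (1 - ‖z‖) →
    (∃ i, ∃ x ∈ ball z σ ∩ halfBall n, v i x ≠ tuple fun _ => 0) →
    ∃ w ∈ 𝔅, ∀ i, EqOn (w i) (normalize (fun i x => v i (z + σ • x)) i) (halfBall n)
  subtract : ∀ v ∈ 𝔅, ∀ (a : Fin N → Euc k) (A : Fin N → Euc n →L[ℝ] Euc k),
    (∀ i, HasBoundaryJet (fun x => mean (v i x)) 0 (a i) (A i)) →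
    (∃ i, ∃ x ∈ halfBall n, shift (v i x) (a i + A i x) ≠ tuple fun _ => 0) →
    ∃ w ∈ 𝔅, ∀ i,
      EqOn (w i) (normalize (fun i x => shift (v i x) (a i + A i x)) i) (halfBall n)
  compact : ∀ v : ℕ → MultiMap n k q, (∀ m, v m ∈ 𝔅) →
    ∃ φ : ℕ → ℕ, StrictMono φ ∧ ∃ w ∈ 𝔅,
      (∀ K ⊆ ball 0 1 ∩ closure (halfSpace n), IsCompact K →
        Tendsto (fun m => sqDistInt (v (φ m)) w (K ∩ halfBall n)) atTop (𝓝 0)) ∧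
      ∀ i, WeaklyConvergesW12loc (fun m => v (φ m) i) (w i) (halfBall n)
  epsRegularity : ∃ α₁ ε : ℝ, 0 < α₁ ∧ α₁ < 1 ∧ 0 < ε ∧ ε < 1 ∧ ∀ v ∈ 𝔅,
    (∀ i, HasBoundaryJet (fun x => mean (v i x)) 0 0 0) →
    sqInt v (halfBall n) = 1 →
    ∀ b : (i : Fin N) → Fin (q i) → Euc k,
    (∀ i, ∑ j, b i j = 0) →
    (∃ i, 1 < q i ∧ ∃ j, b i j ≠ 0) →
    sqDistInt v (fun i x => tuple fun j => x 0 • b i j) (halfBall n) < ENNReal.ofReal ε →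
    ∀ i, MemC1HolderClosure α₁ (v i) (ball 0 (1 / 2) ∩ halfSpace n)

end MultiValued

end

open MultiValued

namespace MultiValued

/-! ### The metric on unordered tuples -/

section Tuples

variable {V : Type*} {Q : ℕ}

/-! Write M for the integral of |v|² over the half-ball of radius 1/2. The aim is a bound 𝒢(v(x),
v(y))² ≤ K |x - y| M on the closed half-ball of radius 1/8, where v takes the values κ on ∂H; so the
exponent is 1/2. It comes from decay of v towards κ at the boundary combined with interior estimates
at the scale of the distance to ∂H. Every constant has to be independent of N and q.

Boundary (`exists_boundary_decay`, `exists_boundary_modulus`). The weighted integral inequality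
forces the integral of |v - κ(z)|² over a half-ball of radius σ about z to be at most K σ^(n+1) M.
Comparing two such inequalities on an interior ball lying in both half-balls bounds ∑ q_i |κ_i(z) -
κ_i(z')|² by K |z - z'| M. The size of κ itself, with the weights q_i, is bounded by comparing κ(z)
with 0 on a small ball and absorbing.

Interior (`exists_goodHarmonic_estimate`). By Pythagoras |u - c|² = |u_s|² + Q |u_a - c|², so the
average and the symmetric part can be treated separately. The average is C^1 and harmonic off the
branch set; a set of dimension at most n - 2 is negligible for (n-1)-dimensional measure, hence
removable for C^1 functions (`weaklyHarmonic_of_removable`), and the mean value property applies.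
Off the branch set |u_s|² is locally a sum of squares of harmonic functions, so both it and half its
Laplacian, which is |Du_s|², are subharmonic and are bounded by the integral of |u_s|² over a
branch-free ball. Such a ball may have a tiny radius r, but the decay assumed at branch points makes
that integral of order r^(n+2), which is exactly what the estimate divides by
(`exists_symSq_estimate`). Hence |Du_s| is bounded off the branch set and |u_s| grows at most
linearly away from it, and u_s is Lipschitz (`exists_symPart_lipschitz`): a segment either avoids
the branch set, and the slopes are bounded along it, or meets it, and both endpoint values are
small.

Combination (`exists_extension`). Two points much closer together than their distance to ∂H are
compared by the interior estimate, all others through the boundary values at their projections to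
∂H. -/

theorem exists_tuple_eq (T : Sym V Q) : ∃ f : Fin Q → V, tuple f = T := by
  obtain ⟨l, hl⟩ := T
  induction l using Quotient.inductionOn with
  | h l =>
    have hlen : l.length = Q := by simpa using hl
    subst hlen
    refine ⟨fun i => l.get i, Subtype.ext ?_⟩
    simp only [tuple, Fin.univ_val_map]
    exact congrArg _ (List.ofFn_get l)

theorem tuple_comp_perm (f : Fin Q → V) (σ : Equiv.Perm (Fin Q)) :
    tuple (f ∘ σ) = tuple f := by
  refine Subtype.ext ?_
  simp only [tuple]
  rw [← Multiset.map_map, Multiset.map_univ_val_equiv]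

/-- Equal multisets take each value equally often, so the fibres of the two enumerations are in
bijection; gluing these bijections gives the permutation. -/
theorem exists_perm_of_tuple_eq {f g : Fin Q → V} (h : tuple f = tuple g) :
    ∃ σ : Equiv.Perm (Fin Q), f = g ∘ σ := by
  classical
  have h' : Finset.univ.val.map f = Finset.univ.val.map g := congrArg Subtype.val h
  have key : ∀ c : V, Nonempty ({a // f a = c} ≃ {b // g b = c}) := by
    intro c
    rw [← Fintype.card_eq]
    have := congrArg (Multiset.count c) h'
    rw [Multiset.count_map, Multiset.count_map] at this
    rw [Fintype.card_subtype, Fintype.card_subtype]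
    simp only [Finset.card_def, Finset.filter_val]
    simpa only [eq_comm] using this
  refine ⟨Equiv.ofFiberEquiv fun c => (key c).some, ?_⟩
  ext i
  exact (Equiv.ofFiberEquiv_map _ i).symm

theorem map_tuple {W : Type*} (φ : V → W) (f : Fin Q → V) :
    (tuple f).map φ = tuple fun i => φ (f i) := by
  refine Subtype.ext ?_
  simp only [tuple, Sym.map, Multiset.map_map]
  rfl

variable [NormedAddCommGroup V]

theorem shift_tuple (f : Fin Q → V) (c : V) :
    shift (tuple f) c = tuple fun i => f i - c := map_tuple _ f

/-- The distance between two enumerations. -/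
noncomputable def enumDist (f g : Fin Q → V) : ℝ := Real.sqrt (∑ i, ‖f i - g i‖ ^ 2)

theorem enumDist_sq (f g : Fin Q → V) : enumDist f g ^ 2 = ∑ i, ‖f i - g i‖ ^ 2 :=
  Real.sq_sqrt (Finset.sum_nonneg fun _ _ => by positivity)

theorem enumDist_comp_perm (f g : Fin Q → V) (σ : Equiv.Perm (Fin Q)) :
    enumDist (f ∘ σ) (g ∘ σ) = enumDist f g := by
  unfold enumDist
  congr 1
  exact Equiv.sum_comp σ fun i => ‖f i - g i‖ ^ 2

theorem enumDist_comm (f g : Fin Q → V) : enumDist f g = enumDist g f := by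
  simp only [enumDist, norm_sub_rev]

theorem enumDist_triangle (f g h : Fin Q → V) :
    enumDist f h ≤ enumDist f g + enumDist g h := by
  have key : ∀ a b : Fin Q → V, enumDist a b =
      ‖(WithLp.toLp 2 (fun i => a i - b i) : PiLp 2 fun _ : Fin Q => V)‖ := fun a b => by
    rw [PiLp.norm_eq_of_L2]; rfl
  rw [key, key, key]
  refine le_trans (le_of_eq ?_) (norm_add_le _ _)
  congr 1
  ext i
  simp

/-- Enumerations of a fixed tuple differ by permutations, so only finitely many distances occur.
Hence the infimum in `qdist` is attained. -/
theorem finite_qdist_set (S T : Sym V Q) : {r : ℝ | ∃ f g : Fin Q → V,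
    tuple f = S ∧ tuple g = T ∧ r = Real.sqrt (∑ i, ‖f i - g i‖ ^ 2)}.Finite := by
  obtain ⟨f, rfl⟩ := exists_tuple_eq S
  obtain ⟨g, rfl⟩ := exists_tuple_eq T
  refine (Set.finite_range fun p : Equiv.Perm (Fin Q) × Equiv.Perm (Fin Q) =>
    enumDist (f ∘ p.1) (g ∘ p.2)).subset ?_
  rintro r ⟨f', g', hf, hg, rfl⟩
  obtain ⟨σ, rfl⟩ := exists_perm_of_tuple_eq hf
  obtain ⟨τ, rfl⟩ := exists_perm_of_tuple_eq hg
  exact ⟨(σ, τ), rfl⟩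

theorem exists_enum (S T : Sym V Q) :
    ∃ f g : Fin Q → V, tuple f = S ∧ tuple g = T ∧ qdist S T = enumDist f g := by
  have hne : {r : ℝ | ∃ f g : Fin Q → V,
      tuple f = S ∧ tuple g = T ∧ r = Real.sqrt (∑ i, ‖f i - g i‖ ^ 2)}.Nonempty := by
    obtain ⟨f, hf⟩ := exists_tuple_eq S
    obtain ⟨g, hg⟩ := exists_tuple_eq T
    exact ⟨_, f, g, hf, hg, rfl⟩
  exact hne.csInf_mem (finite_qdist_set S T)

/-- Permuting both enumerations simultaneously leaves the distance unchanged, so one of them may be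
prescribed. This is what lets optimal matchings be composed in the triangle inequality. -/
theorem exists_enum_right (f : Fin Q → V) (T : Sym V Q) :
    ∃ g : Fin Q → V, tuple g = T ∧ qdist (tuple f) T = enumDist f g := by
  obtain ⟨f', g, hf, hg, h⟩ := exists_enum (tuple f) T
  obtain ⟨σ, rfl⟩ := exists_perm_of_tuple_eq hf.symm
  exact ⟨g ∘ σ, by rw [tuple_comp_perm, hg], by rw [h, enumDist_comp_perm]⟩

theorem qdist_tuple_le (f g : Fin Q → V) : qdist (tuple f) (tuple g) ≤ enumDist f g :=
  csInf_le (finite_qdist_set _ _).bddBelow ⟨f, g, rfl, rfl, rfl⟩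

theorem qdist_nonneg (S T : Sym V Q) : 0 ≤ qdist S T := by
  obtain ⟨f, g, -, -, h⟩ := exists_enum S T
  rw [h]; exact Real.sqrt_nonneg _

theorem qdist_comm (S T : Sym V Q) : qdist S T = qdist T S := by
  have key : ∀ S T : Sym V Q, qdist S T ≤ qdist T S := fun S T => by
    obtain ⟨f, g, rfl, rfl, h⟩ := exists_enum T S
    rw [h, enumDist_comm]; exact qdist_tuple_le g f
  exact le_antisymm (key S T) (key T S)

@[simp] theorem qdist_self (S : Sym V Q) : qdist S S = 0 := by
  obtain ⟨f, rfl⟩ := exists_tuple_eq S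
  refine le_antisymm ((qdist_tuple_le f f).trans ?_) (qdist_nonneg _ _)
  simp [enumDist]

theorem qdist_triangle (S T R : Sym V Q) : qdist S R ≤ qdist S T + qdist T R := by
  obtain ⟨f, g, rfl, rfl, h⟩ := exists_enum S T
  obtain ⟨k, rfl, h'⟩ := exists_enum_right g R
  rw [h, h']
  exact (qdist_tuple_le f k).trans (enumDist_triangle f g k)

/-- A constant tuple has a single enumeration, so there is nothing to minimise. -/
theorem qdist_tuple_const (f : Fin Q → V) (c : V) :
    qdist (tuple f) (tuple fun _ => c) = enumDist f fun _ => c := by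
  obtain ⟨g, hg, h⟩ := exists_enum_right f (tuple fun _ => c)
  obtain ⟨σ, rfl⟩ := exists_perm_of_tuple_eq hg
  exact h

theorem qnorm_tuple_sq (f : Fin Q → V) : qnorm (tuple f) ^ 2 = ∑ i, ‖f i‖ ^ 2 := by
  rw [qnorm, qdist_tuple_const, enumDist_sq]; simp

theorem qnorm_shift_eq (T : Sym V Q) (c : V) : qnorm (shift T c) = qdist T (tuple fun _ => c) := by
  obtain ⟨f, rfl⟩ := exists_tuple_eq T
  rw [shift_tuple, qnorm, qdist_tuple_const, qdist_tuple_const]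
  simp [enumDist]

theorem qdist_le_shift_add_shift (S T : Sym V Q) (c : V) :
    qdist S T ≤ qnorm (shift S c) + qnorm (shift T c) := by
  rw [qnorm_shift_eq, qnorm_shift_eq, qdist_comm T]
  exact qdist_triangle _ _ _

theorem abs_qnorm_sub_le (S T : Sym V Q) : |qnorm S - qnorm T| ≤ qdist S T := by
  rw [abs_le]
  have h1 := qdist_triangle S T (tuple fun _ => (0 : V))
  have h2 := qdist_triangle T S (tuple fun _ => (0 : V))
  rw [qdist_comm T S] at h2
  simp only [qnorm]
  constructor <;> linarith

theorem qdist_const_sq (c d : V) :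
    qdist (tuple fun _ : Fin Q => c) (tuple fun _ => d) ^ 2 = Q * ‖c - d‖ ^ 2 := by
  rw [qdist_tuple_const, enumDist_sq]; simp

theorem shift_zero (T : Sym V Q) : shift T 0 = T := by
  obtain ⟨f, rfl⟩ := exists_tuple_eq T
  rw [shift_tuple]; simp

end Tuples

/-! ### Average and symmetric part of a tuple -/

section Mean

variable {V : Type*} [NormedAddCommGroup V] [NormedSpace ℝ V] {Q : ℕ}

theorem mean_tuple (f : Fin Q → V) : mean (tuple f) = (Q : ℝ)⁻¹ • ∑ i, f i := rfl

/-- Cauchy–Schwarz for the differences in an optimal matching. -/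
theorem mean_dist_sq_le (hQ : 0 < Q) (S T : Sym V Q) :
    Q * ‖mean S - mean T‖ ^ 2 ≤ qdist S T ^ 2 := by
  obtain ⟨f, g, rfl, rfl, h⟩ := exists_enum S T
  rw [h, enumDist_sq, mean_tuple, mean_tuple, ← smul_sub, ← Finset.sum_sub_distrib, norm_smul]
  have hQ' : (0 : ℝ) < Q := by exact_mod_cast hQ
  have h1 : ‖∑ i, (f i - g i)‖ ^ 2 ≤ Q * ∑ i, ‖f i - g i‖ ^ 2 := by
    calc ‖∑ i, (f i - g i)‖ ^ 2 ≤ (∑ i, ‖f i - g i‖) ^ 2 := by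
          gcongr; exact norm_sum_le _ _
      _ ≤ _ := by simpa using sq_sum_le_card_mul_sum_sq (s := Finset.univ) (f := fun i => ‖f i - g i‖)
  rw [mul_pow, norm_inv, Real.norm_of_nonneg hQ'.le, ← mul_assoc]
  calc (Q : ℝ) * (Q : ℝ)⁻¹ ^ 2 * ‖∑ i, (f i - g i)‖ ^ 2
      ≤ (Q : ℝ) * (Q : ℝ)⁻¹ ^ 2 * (Q * ∑ i, ‖f i - g i‖ ^ 2) := by gcongr
    _ = ∑ i, ‖f i - g i‖ ^ 2 := by field_simp

theorem symPart_tuple (f : Fin Q → V) :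
    symPart (tuple f) = tuple fun i => f i - mean (tuple f) := shift_tuple f _

/-- An optimal matching of the symmetric parts is also a competitor for the tuples themselves; along
it each difference splits into a symmetric part and the difference of the averages. -/
theorem qdist_sq_le_symPart_add_mean (S T : Sym V Q) :
    qdist S T ^ 2 ≤ 2 * qdist (symPart S) (symPart T) ^ 2 + 2 * (Q * ‖mean S - mean T‖ ^ 2) := by
  obtain ⟨f, rfl⟩ := exists_tuple_eq S
  obtain ⟨g, rfl⟩ := exists_tuple_eq T
  obtain ⟨g', hg', h⟩ := exists_enum_right (fun i => f i - mean (tuple f)) (symPart (tuple g))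
  rw [symPart_tuple] at hg'
  obtain ⟨σ, rfl⟩ := exists_perm_of_tuple_eq hg'
  rw [symPart_tuple f, h, enumDist_sq]
  rw [← tuple_comp_perm g σ]
  have h1 := pow_le_pow_left₀ (qdist_nonneg _ _) (qdist_tuple_le f (g ∘ σ)) 2
  rw [enumDist_sq] at h1
  refine h1.trans ?_
  rw [tuple_comp_perm]
  generalize mean (tuple f) = a
  generalize mean (tuple g) = b
  have : (Q : ℝ) * ‖a - b‖ ^ 2 = ∑ i : Fin Q, ‖a - b‖ ^ 2 := by simp
  rw [this, Finset.mul_sum, Finset.mul_sum, ← Finset.sum_add_distrib]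
  refine Finset.sum_le_sum fun i _ => ?_
  simp only [Function.comp]
  have h2 : ‖f i - g (σ i)‖ ≤ ‖f i - a - (g (σ i) - b)‖ + ‖a - b‖ := by
    refine le_trans (le_of_eq ?_) (norm_add_le _ _)
    congr 1; abel
  nlinarith [norm_nonneg (f i - g (σ i)), sq_nonneg (‖f i - a - (g (σ i) - b)‖ - ‖a - b‖)]

/-- Pythagoras: the cross terms cancel because the deviations from the average sum to zero. Being an
identity, it separates the two parts without a loss depending on `Q`. -/
theorem qnorm_shift_sq {V : Type*} [NormedAddCommGroup V] [InnerProductSpace ℝ V] (hQ : 0 < Q)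
    (T : Sym V Q) (c : V) :
    qnorm (shift T c) ^ 2 = qnorm (symPart T) ^ 2 + Q * ‖mean T - c‖ ^ 2 := by
  obtain ⟨f, rfl⟩ := exists_tuple_eq T
  rw [symPart_tuple, shift_tuple, qnorm_tuple_sq, qnorm_tuple_sq]
  have hs : ∑ i, f i = (Q : ℝ) • mean (tuple f) := by
    rw [mean_tuple, smul_smul, mul_inv_cancel₀ (by positivity), one_smul]
  generalize mean (tuple f) = a at *
  have key : ∀ i, ‖f i - c‖ ^ 2 = ‖f i - a‖ ^ 2 + 2 * inner ℝ (f i - a) (a - c) + ‖a - c‖ ^ 2 := by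
    intro i
    rw [← norm_add_sq_real]; simp
  have h0 : ∑ i, inner ℝ (f i - a) (a - c) = 0 := by
    rw [← sum_inner, Finset.sum_sub_distrib, hs]
    simp [← Nat.cast_smul_eq_nsmul ℝ]
  simp_rw [key]
  rw [Finset.sum_add_distrib, Finset.sum_add_distrib, ← Finset.mul_sum, h0]
  simp

end Mean

end MultiValued

namespace MultiValued

/-! ### A radial bump function and its potential -/

section Bump

/-- The profile of the radial bump as a function of the squared norm. -/
noncomputable def profile (s : ℝ) : ℝ := Real.smoothTransition (1 - s)

/-- The primitive `s ↦ ∫_s^1 profile`. -/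
noncomputable def profilePrim (s : ℝ) : ℝ := ∫ t in s..1, profile t

theorem contDiff_profile : ContDiff ℝ ∞ profile :=
  Real.smoothTransition.contDiff.comp (contDiff_const.sub contDiff_id)

theorem profile_nonneg (s : ℝ) : 0 ≤ profile s := Real.smoothTransition.nonneg _

theorem profile_of_one_le {s : ℝ} (hs : 1 ≤ s) : profile s = 0 :=
  Real.smoothTransition.zero_of_nonpos (by linarith)

theorem hasDerivAt_profilePrim (s : ℝ) : HasDerivAt profilePrim (-profile s) s :=
  intervalIntegral.integral_hasDerivAt_left
    (contDiff_profile.continuous.intervalIntegrable _ _)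
    contDiff_profile.continuous.stronglyMeasurable.stronglyMeasurableAtFilter
    contDiff_profile.continuous.continuousAt

theorem contDiff_profilePrim : ContDiff ℝ ∞ profilePrim := by
  rw [contDiff_infty_iff_deriv]
  refine ⟨fun s => (hasDerivAt_profilePrim s).differentiableAt, ?_⟩
  rw [show deriv profilePrim = fun s => -profile s from
    funext fun s => (hasDerivAt_profilePrim s).deriv]
  exact contDiff_profile.neg

theorem profilePrim_of_one_le {s : ℝ} (hs : 1 ≤ s) : profilePrim s = 0 := by
  rw [profilePrim, intervalIntegral.integral_symm,
    intervalIntegral.integral_congr (g := fun _ => (0 : ℝ))]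
  · simp
  · intro t ht
    rw [uIcc_of_le hs] at ht
    exact profile_of_one_le ht.1

theorem profilePrim_nonneg (s : ℝ) : 0 ≤ profilePrim s := by
  rcases le_total s 1 with hs | hs
  · exact intervalIntegral.integral_nonneg hs fun t _ => profile_nonneg t
  · rw [profilePrim_of_one_le hs]

variable {n : ℕ}

/-- The integral of `y ↦ profile (|y|²)`. -/
noncomputable def bumpMass (n : ℕ) : ℝ := ∫ y : Euc n, profile (‖y‖ ^ 2)

theorem hasCompactSupport_of_norm {f : Euc n → ℝ} (hf : ∀ y, 1 ≤ ‖y‖ → f y = 0) :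
    HasCompactSupport f :=
  HasCompactSupport.intro (isCompact_closedBall (0 : Euc n) 1) fun y hy => hf y (by
    simp only [mem_closedBall, dist_zero_right, not_le] at hy; exact hy.le)

theorem bumpMass_pos (n : ℕ) : 0 < bumpMass n := by
  have hc : Continuous fun y : Euc n => profile (‖y‖ ^ 2) :=
    contDiff_profile.continuous.comp (by fun_prop)
  refine hc.integral_pos_of_hasCompactSupport_nonneg_nonzero (x := 0) ?_
    (fun y => profile_nonneg _) ?_
  · exact hasCompactSupport_of_norm fun y hy => profile_of_one_le (one_le_pow₀ hy)
  · simp [profile]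

/-- A smooth radial probability density supported in the closed unit ball. -/
noncomputable def bump (y : Euc n) : ℝ := profile (‖y‖ ^ 2) / bumpMass n

/-- A function with gradient `-bump y • y`. -/
noncomputable def potential (y : Euc n) : ℝ := profilePrim (‖y‖ ^ 2) / (2 * bumpMass n)

theorem contDiff_bump : ContDiff ℝ ∞ (bump (n := n)) :=
  (contDiff_profile.comp (contDiff_norm_sq ℝ)).div_const _

theorem contDiff_potential : ContDiff ℝ ∞ (potential (n := n)) :=
  (contDiff_profilePrim.comp (contDiff_norm_sq ℝ)).div_const _

theorem bump_nonneg (y : Euc n) : 0 ≤ bump y :=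
  div_nonneg (profile_nonneg _) (bumpMass_pos n).le

theorem potential_nonneg (y : Euc n) : 0 ≤ potential y :=
  div_nonneg (profilePrim_nonneg _) (by linarith [bumpMass_pos n])

theorem bump_of_one_le {y : Euc n} (hy : 1 ≤ ‖y‖) : bump y = 0 := by
  rw [bump, profile_of_one_le (one_le_pow₀ hy), zero_div]

theorem potential_of_one_le {y : Euc n} (hy : 1 ≤ ‖y‖) : potential y = 0 := by
  rw [potential, profilePrim_of_one_le (one_le_pow₀ hy), zero_div]

theorem hasCompactSupport_bump : HasCompactSupport (bump (n := n)) :=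
  hasCompactSupport_of_norm fun _ hy => bump_of_one_le hy

theorem integral_bump : ∫ y : Euc n, bump y = 1 := by
  simp only [bump]
  rw [integral_div]
  exact div_self (bumpMass_pos n).ne'

theorem bump_neg (y : Euc n) : bump (-y) = bump y := by simp [bump]

/-- This turns the radial derivative of a mean against `bump` into a pairing of gradients with an
admissible test function. -/
theorem fderiv_potential (y v : Euc n) :
    fderiv ℝ potential y v = -(bump y * inner ℝ y v) := by
  have h1 : HasFDerivAt (fun y : Euc n => ‖y‖ ^ 2) (2 • innerSL ℝ y) y :=
    (hasStrictFDerivAt_norm_sq y).hasFDerivAt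
  have h2 := ((hasDerivAt_profilePrim (‖y‖ ^ 2)).comp_hasFDerivAt y h1).mul_const
    (2 * bumpMass n)⁻¹
  have h3 : HasFDerivAt (potential (n := n)) _ y := h2
  rw [h3.fderiv]
  have := (bumpMass_pos n).ne'
  simp only [bump, _root_.smul_apply, innerSL_apply_apply, smul_eq_mul, nsmul_eq_mul,
    Nat.cast_ofNat]
  field_simp

end Bump

/-! ### Partial derivatives -/

section Partial

variable {n : ℕ}

/-- The `j`-th partial derivative. -/
noncomputable def partialDeriv (j : Fin n) (f : Euc n → ℝ) (x : Euc n) : ℝ :=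
  fderiv ℝ f x (EuclideanSpace.single j 1)

/-- The Laplacian as the sum of the second partial derivatives. -/
noncomputable def lap (f : Euc n → ℝ) (x : Euc n) : ℝ :=
  ∑ j, partialDeriv j (partialDeriv j f) x

/-- The inner product of two gradients. -/
noncomputable def gradInner (f g : Euc n → ℝ) (x : Euc n) : ℝ :=
  ∑ j, partialDeriv j f x * partialDeriv j g x

theorem euc_sum_single (y : Euc n) : y = ∑ j, y j • EuclideanSpace.single j (1 : ℝ) := by
  ext i
  simp [Finset.sum_apply, Pi.single_apply]

theorem fderiv_apply_eq_sum {F : Type*} [NormedAddCommGroup F] [NormedSpace ℝ F]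
    (A : Euc n →L[ℝ] F) (y : Euc n) :
    A y = ∑ j, y j • A (EuclideanSpace.single j (1 : ℝ)) := by
  conv_lhs => rw [euc_sum_single y]
  simp [map_sum]

theorem partialDeriv_potential (j : Fin n) (y : Euc n) :
    partialDeriv j potential y = -(bump y * y j) := by
  rw [partialDeriv, fderiv_potential]
  simp [EuclideanSpace.inner_single_right]

theorem partialDeriv_congr {j : Fin n} {f g : Euc n → ℝ} {x : Euc n} (h : f =ᶠ[𝓝 x] g) :
    partialDeriv j f x = partialDeriv j g x := by
  rw [partialDeriv, partialDeriv, h.fderiv_eq]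

theorem partialDeriv_eventuallyEq {j : Fin n} {f g : Euc n → ℝ} {x : Euc n} (h : f =ᶠ[𝓝 x] g) :
    partialDeriv j f =ᶠ[𝓝 x] partialDeriv j g := by
  filter_upwards [h.eventually_nhds] with y hy using partialDeriv_congr hy

theorem lap_congr {f g : Euc n → ℝ} {x : Euc n} (h : f =ᶠ[𝓝 x] g) : lap f x = lap g x :=
  Finset.sum_congr rfl fun _ _ => partialDeriv_congr (partialDeriv_eventuallyEq h)

theorem contDiffAt_partialDeriv {m : ℕ∞} {j : Fin n} {f : Euc n → ℝ} {x : Euc n}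
    (h : ContDiffAt ℝ (m + 1 : ℕ∞) f x) : ContDiffAt ℝ m (partialDeriv j f) x :=
  (h.fderiv_right (m := m) (by simp)).clm_apply contDiffAt_const

theorem contDiff_partialDeriv {m : ℕ∞} {j : Fin n} {f : Euc n → ℝ}
    (h : ContDiff ℝ (m + 1 : ℕ∞) f) : ContDiff ℝ m (partialDeriv j f) :=
  contDiff_iff_contDiffAt.2 fun _ => contDiffAt_partialDeriv h.contDiffAt

theorem tsupport_partialDeriv_subset (j : Fin n) (f : Euc n → ℝ) :
    tsupport (partialDeriv j f) ⊆ tsupport f := by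
  refine closure_minimal (fun x hx => ?_) (isClosed_tsupport f)
  by_contra h
  refine hx ?_
  rw [partialDeriv_congr (g := fun _ => 0) (notMem_tsupport_iff_eventuallyEq.1 h)]
  simp [partialDeriv]

theorem partialDeriv_comp_affine (j : Fin n) (f : Euc n → ℝ) (s : ℝ) (x z : Euc n) :
    partialDeriv j (fun z => f (s • (z - x))) z = s * partialDeriv j f (s • (z - x)) := by
  rcases eq_or_ne s 0 with rfl | hs
  · simp [partialDeriv]
  · simp only [partialDeriv]
    have h1 := fderiv_comp_sub (𝕜 := ℝ) (f := fun z => f (s • z)) (x := z) x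
    rw [h1, fderiv_comp_smul]
    simp

theorem partialDeriv_const_mul (j : Fin n) (s : ℝ) (f : Euc n → ℝ) (z : Euc n) :
    partialDeriv j (fun y => s * f y) z = s * partialDeriv j f z := by
  simp only [partialDeriv]
  rw [show (fun y => s * f y) = s • f from rfl, fderiv_const_smul_field]
  rfl

theorem lap_comp_affine (f : Euc n → ℝ) (s : ℝ) (x z : Euc n) :
    lap (fun z => f (s • (z - x))) z = s ^ 2 * lap f (s • (z - x)) := by
  simp only [lap, Finset.mul_sum]
  refine Finset.sum_congr rfl fun j _ => ?_
  rw [show partialDeriv j (fun z => f (s • (z - x))) =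
    fun z => (fun y => s * partialDeriv j f y) (s • (z - x)) from
    funext fun z => partialDeriv_comp_affine j f s x z]
  refine (partialDeriv_comp_affine j (fun y => s * partialDeriv j f y) s x z).trans ?_
  rw [partialDeriv_const_mul]; ring

end Partial

end MultiValued

namespace MultiValued

/-! ### Integration by parts -/

section Parts

variable {n : ℕ}

/-- The product extends by zero, so the values of `f` outside `U` are irrelevant; this permits
integration over the whole space below. -/
theorem continuous_mul_of_tsupport {φ f : Euc n → ℝ} {U : Set (Euc n)} (hU : IsOpen U)
    (hφ : Continuous φ) (hs : tsupport φ ⊆ U) (hf : ContinuousOn f U) :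
    Continuous fun y => φ y * f y :=
  (hφ.continuousOn.mul hf).continuous_of_tsupport_subset hU
    ((tsupport_mul_subset_left (f := φ) (g := f)).trans hs)

theorem integrable_mul_of_tsupport {φ f : Euc n → ℝ} {U : Set (Euc n)} (hU : IsOpen U)
    (hφ : Continuous φ) (hc : HasCompactSupport φ) (hs : tsupport φ ⊆ U)
    (hf : ContinuousOn f U) : Integrable fun y => φ y * f y :=
  (continuous_mul_of_tsupport hU hφ hs hf).integrable_of_hasCompactSupport hc.mul_right

theorem continuousOn_partialDeriv {j : Fin n} {f : Euc n → ℝ} {U : Set (Euc n)} (hU : IsOpen U)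
    (hf : ContDiffOn ℝ 1 f U) : ContinuousOn (partialDeriv j f) U := fun x hx =>
  (contDiffAt_partialDeriv (m := 0) (by simpa using hf.contDiffAt (hU.mem_nhds hx))
    ).continuousAt.continuousWithinAt

theorem contDiffOn_partialDeriv {m : ℕ∞} {j : Fin n} {f : Euc n → ℝ} {U : Set (Euc n)}
    (hU : IsOpen U) (hf : ContDiffOn ℝ (m + 1 : ℕ∞) f U) : ContDiffOn ℝ m (partialDeriv j f) U :=
  fun _ hx => (contDiffAt_partialDeriv (hf.contDiffAt (hU.mem_nhds hx))).contDiffWithinAt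

theorem integral_partialDeriv_mul {j : Fin n} {φ f : Euc n → ℝ} {U : Set (Euc n)} (hU : IsOpen U)
    (hφ : ContDiff ℝ 1 φ) (hc : HasCompactSupport φ) (hs : tsupport φ ⊆ U)
    (hf : ContDiffOn ℝ 1 f U) :
    ∫ y, partialDeriv j φ y * f y = -∫ y, φ y * partialDeriv j f y := by
  have h := integral_mul_fderiv_eq_neg_fderiv_mul_of_integrable (μ := (volume : Measure (Euc n)))
    (f := φ) (g := f) (v := EuclideanSpace.single j 1) (𝕜 := ℝ)
    (integrable_mul_of_tsupport hU (contDiff_partialDeriv (m := 0) (by simpa using hφ)).continuous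
      (hc.mono' ((subset_tsupport _).trans (tsupport_partialDeriv_subset j φ)))
      ((tsupport_partialDeriv_subset j φ).trans hs) hf.continuousOn)
    (integrable_mul_of_tsupport hU hφ.continuous hc hs (continuousOn_partialDeriv hU hf))
    (integrable_mul_of_tsupport hU hφ.continuous hc hs hf.continuousOn)
    (fun x _ => hφ.differentiable one_ne_zero x)
    (fun x hx => (hf.contDiffAt (hU.mem_nhds (hs hx))).differentiableAt one_ne_zero)
  simp only [partialDeriv]
  linarith

theorem integrable_partialDeriv_mul {j : Fin n} {φ f : Euc n → ℝ} {U : Set (Euc n)}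
    (hU : IsOpen U) (hφ : ContDiff ℝ 1 φ) (hc : HasCompactSupport φ) (hs : tsupport φ ⊆ U)
    (hf : ContinuousOn f U) : Integrable fun y => partialDeriv j φ y * f y :=
  integrable_mul_of_tsupport hU (contDiff_partialDeriv (m := 0) (by simpa using hφ)).continuous
    (hc.mono' ((subset_tsupport _).trans (tsupport_partialDeriv_subset j φ)))
    ((tsupport_partialDeriv_subset j φ).trans hs) hf

theorem integral_gradInner {φ f : Euc n → ℝ} {U : Set (Euc n)} (hU : IsOpen U)
    (hφ : ContDiff ℝ 1 φ) (hc : HasCompactSupport φ) (hs : tsupport φ ⊆ U)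
    (hf : ContDiffOn ℝ 2 f U) :
    ∫ y, gradInner φ f y = -∫ y, φ y * lap f y := by
  have h1 : ContDiffOn ℝ 1 f U := hf.of_le (by norm_num)
  have h2 : ∀ j, ContDiffOn ℝ 1 (partialDeriv j f) U := fun j =>
    contDiffOn_partialDeriv (m := 1) hU (by simpa [one_add_one_eq_two] using hf)
  simp only [gradInner, lap, Finset.mul_sum]
  rw [integral_finsetSum _ fun j _ => integrable_partialDeriv_mul hU hφ hc hs (h2 j).continuousOn,
    integral_finsetSum _ fun j _ => integrable_mul_of_tsupport hU hφ.continuous hc hs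
      (continuousOn_partialDeriv hU (h2 j)), ← Finset.sum_neg_distrib]
  exact Finset.sum_congr rfl fun j _ => integral_partialDeriv_mul hU hφ hc hs (h2 j)

theorem integral_lap_mul {φ f : Euc n → ℝ} {U : Set (Euc n)} (hU : IsOpen U)
    (hφ : ContDiff ℝ 2 φ) (hc : HasCompactSupport φ) (hs : tsupport φ ⊆ U)
    (hf : ContDiffOn ℝ 2 f U) :
    ∫ y, lap φ y * f y = ∫ y, φ y * lap f y := by
  have h1 : ContDiffOn ℝ 1 f U := hf.of_le (by norm_num)
  have h2 : ∀ j, ContDiff ℝ 1 (partialDeriv j φ) := fun j =>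
    contDiff_partialDeriv (m := 1) (by simpa [one_add_one_eq_two] using hφ)
  have hc' : ∀ j, HasCompactSupport (partialDeriv j φ) := fun j =>
    hc.mono' ((subset_tsupport _).trans (tsupport_partialDeriv_subset j φ))
  have hs' : ∀ j, tsupport (partialDeriv j φ) ⊆ U := fun j =>
    (tsupport_partialDeriv_subset j φ).trans hs
  rw [← neg_eq_iff_eq_neg.2 (integral_gradInner hU (hφ.of_le (by norm_num)) hc hs hf)]
  simp only [gradInner, lap, Finset.sum_mul]
  rw [integral_finsetSum _ fun j _ => integrable_partialDeriv_mul hU (h2 j) (hc' j) (hs' j)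
      h1.continuousOn,
    integral_finsetSum _ fun j _ => integrable_mul_of_tsupport hU (h2 j).continuous (hc' j) (hs' j)
      (continuousOn_partialDeriv hU h1), ← Finset.sum_neg_distrib]
  exact Finset.sum_congr rfl fun j _ => integral_partialDeriv_mul hU (h2 j) (hc' j) (hs' j) h1

/-- A function of class `C^m` on a ball agrees on a smaller ball with a global one. -/
theorem exists_contDiff_eqOn {m : ℕ∞} {w : Euc n → ℝ} {x : Euc n} {r ρ : ℝ} (hr : 0 < r)
    (hrρ : r < ρ) (hw : ContDiffOn ℝ m w (ball x ρ)) :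
    ∃ w' : Euc n → ℝ, ContDiff ℝ m w' ∧ EqOn w' w (closedBall x r) := by
  let b : ContDiffBump x := ⟨r, (r + ρ) / 2, hr, by linarith⟩
  have hsub : tsupport b ⊆ ball x ρ := by
    rw [b.tsupport_eq]; exact closedBall_subset_ball (by change (r + ρ) / 2 < ρ; linarith)
  refine ⟨fun y => b y * w y, ?_, fun y hy => ?_⟩
  · refine contDiff_iff_contDiffAt.2 fun y => ?_
    by_cases hy : y ∈ tsupport b
    · exact b.contDiffAt.mul (hw.contDiffAt (isOpen_ball.mem_nhds (hsub hy)))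
    · refine (contDiffAt_const (c := (0 : ℝ))).congr_of_eventuallyEq ?_
      filter_upwards [notMem_tsupport_iff_eventuallyEq.1 hy] with z hz
      simp [hz]
  · simp only
    rw [b.one_of_mem_closedBall hy, one_mul]

end Parts

/-! ### Means against the radial bump -/

section BumpMean

variable {n : ℕ}

/-- The mean of `w` about `x` at scale `r`. -/
noncomputable def bumpMean (w : Euc n → ℝ) (x : Euc n) (r : ℝ) : ℝ :=
  ∫ y, w (x + r • y) * bump y

theorem bumpMean_zero (w : Euc n → ℝ) (x : Euc n) : bumpMean w x 0 = w x := by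
  simp only [bumpMean, zero_smul, add_zero]
  rw [integral_const_mul, integral_bump, mul_one]

theorem hasDerivAt_bumpMean {w : Euc n → ℝ} (hw : ContDiff ℝ 1 w) (x : Euc n) (r : ℝ) :
    HasDerivAt (bumpMean w x) (∫ y, fderiv ℝ w (x + r • y) y * bump y) r := by
  have hcw := hw.continuous
  have hcf : Continuous (fderiv ℝ w) := hw.continuous_fderiv one_ne_zero
  have hcb := (contDiff_bump (n := n)).continuous
  -- For radii within 1 of `r` and |y| ≤ 1 all points x + s y lie in this compact set; a bound for
  -- the derivative there gives the dominating function.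
  have hcompact : IsCompact ((fun p : ℝ × Euc n => x + p.1 • p.2) ''
      (Icc (r - 1) (r + 1) ×ˢ closedBall 0 1)) :=
    (isCompact_Icc.prod (isCompact_closedBall _ _)).image (by fun_prop)
  obtain ⟨M, hM⟩ := hcompact.exists_bound_of_continuousOn hcf.continuousOn
  refine (hasDerivAt_integral_of_dominated_loc_of_deriv_le (s := Icc (r - 1) (r + 1))
    (F := fun s y => w (x + s • y) * bump y)
    (F' := fun s y => fderiv ℝ w (x + s • y) y * bump y)
    (bound := fun y => M * bump y) (Icc_mem_nhds (by linarith) (by linarith))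
    (Eventually.of_forall fun s => ?_) ?_ ?_ (Eventually.of_forall fun y s hs => ?_) ?_
    (Eventually.of_forall fun y s _ => ?_)).2
  · exact Continuous.aestronglyMeasurable (by fun_prop)
  · exact Continuous.integrable_of_hasCompactSupport (by fun_prop) hasCompactSupport_bump.mul_left
  · exact Continuous.aestronglyMeasurable (by fun_prop)
  · rcases le_or_gt 1 ‖y‖ with hy | hy
    · simp [bump_of_one_le hy]
    · have h1 := hM (x + s • y) ⟨(s, y), ⟨hs, by simpa using hy.le⟩, rfl⟩
      have h2 := (fderiv ℝ w (x + s • y)).le_opNorm y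
      rw [norm_mul, Real.norm_of_nonneg (bump_nonneg y)]
      refine mul_le_mul_of_nonneg_right (h2.trans ?_) (bump_nonneg y)
      nlinarith [norm_nonneg (fderiv ℝ w (x + s • y)), norm_nonneg y]
  · exact (Continuous.integrable_of_hasCompactSupport hcb hasCompactSupport_bump).const_mul M
  · have h1 : HasDerivAt (fun s : ℝ => x + s • y) y s := by
      simpa using ((hasDerivAt_id s).smul_const y).const_add x
    exact (((hw.differentiable one_ne_zero _).hasFDerivAt).comp_hasDerivAt s h1).mul_const _

theorem integral_comp_affine (G : Euc n → ℝ) (x : Euc n) {s : ℝ} (hs : 0 < s) :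
    ∫ y, G (x + s • y) = (s ^ n)⁻¹ * ∫ z, G z := by
  rw [Measure.integral_comp_smul volume (fun z => G (x + z)) s, integral_add_left_eq_self]
  simp [abs_of_pos hs]

/-- A `C^1` function which is weakly subharmonic on `ball x ρ` satisfies a mean value
inequality. -/
theorem le_bumpMean_of_contDiff {w : Euc n → ℝ} (hw : ContDiff ℝ 1 w) {x : Euc n} {ρ : ℝ}
    (hweak : ∀ φ : Euc n → ℝ, ContDiff ℝ ∞ φ → HasCompactSupport φ → tsupport φ ⊆ ball x ρ →
      (∀ y, 0 ≤ φ y) → ∫ y, gradInner φ w y ≤ 0) {r : ℝ} (hr : 0 ≤ r) (hrρ : r < ρ) :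
    w x ≤ bumpMean w x r := by
  -- At radius 0 the mean is `w x`, so it suffices that the mean does not decrease with the radius.
  have hmono : MonotoneOn (bumpMean w x) (Icc 0 r) := by
    refine monotoneOn_of_deriv_nonneg (convex_Icc _ _)
      (fun s _ => (hasDerivAt_bumpMean hw x s).continuousAt.continuousWithinAt)
      (fun s _ => (hasDerivAt_bumpMean hw x s).differentiableAt.differentiableWithinAt)
      fun s hs => ?_
    rw [interior_Icc] at hs
    have hs0 : 0 < s := hs.1
    rw [(hasDerivAt_bumpMean hw x s).deriv]
    have hφ0 : ∀ z ∉ closedBall x s, potential (s⁻¹ • (z - x)) = 0 := fun z hz => by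
      refine potential_of_one_le ?_
      rw [mem_closedBall, not_le, dist_eq_norm] at hz
      rw [norm_smul, norm_inv, Real.norm_of_nonneg hs0.le, ← div_eq_inv_mul, le_div_iff₀ hs0]
      linarith
    have hts : tsupport (fun z => potential (s⁻¹ • (z - x))) ⊆ closedBall x s :=
      closure_minimal (fun z hz => by_contra fun h => hz (hφ0 z h)) isClosed_closedBall
    -- The test function is the potential rescaled to radius s. Its gradient at x + s y is -s⁻¹
    -- bump(y) y, so the derivative of the mean at s is a negative multiple of the pairing bounded
    -- here.
    have h := hweak (fun z => potential (s⁻¹ • (z - x)))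
      (contDiff_potential.comp (by fun_prop))
      (HasCompactSupport.intro (isCompact_closedBall x s) hφ0)
      (hts.trans (closedBall_subset_ball (hs.2.trans hrρ))) (fun z => potential_nonneg _)
    have key : ∀ y, fderiv ℝ w (x + s • y) y * bump y =
        -s * gradInner (fun z => potential (s⁻¹ • (z - x))) w (x + s • y) := fun y => by
      simp only [gradInner, partialDeriv_comp_affine, add_sub_cancel_left, smul_smul,
        inv_mul_cancel₀ hs0.ne', one_smul, partialDeriv_potential]
      rw [fderiv_apply_eq_sum, Finset.sum_mul, Finset.mul_sum]
      refine Finset.sum_congr rfl fun j _ => ?_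
      simp only [partialDeriv, smul_eq_mul]
      field_simp
    simp_rw [key]
    rw [integral_const_mul, integral_comp_affine _ _ hs0]
    have : 0 < (s ^ n)⁻¹ := by positivity
    nlinarith [mul_nonneg hs0.le (mul_nonneg this.le (neg_nonneg.2 h))]
  have := hmono (left_mem_Icc.2 hr) (right_mem_Icc.2 hr) hr
  rwa [bumpMean_zero] at this

theorem bumpMean_congr {w w' : Euc n → ℝ} {x : Euc n} {r : ℝ} (hr : 0 ≤ r)
    (h : EqOn w w' (closedBall x r)) : bumpMean w x r = bumpMean w' x r := by
  refine integral_congr_ae (Eventually.of_forall fun y => ?_)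
  simp only
  rcases le_or_gt 1 ‖y‖ with hy | hy
  · simp [bump_of_one_le hy]
  · rw [h]
    rw [mem_closedBall, dist_eq_norm, add_sub_cancel_left, norm_smul, Real.norm_of_nonneg hr]
    nlinarith

theorem gradInner_eq_zero_of_notMem_tsupport {φ w : Euc n → ℝ} {y : Euc n}
    (hy : y ∉ tsupport φ) : gradInner φ w y = 0 := by
  refine Finset.sum_eq_zero fun j _ => ?_
  rw [image_eq_zero_of_notMem_tsupport fun h => hy (tsupport_partialDeriv_subset j φ h), zero_mul]

/-- Cutting `w` off outside an intermediate ball makes it globally C^1 and changes nothing that the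
mean or the test functions can see. -/
theorem le_bumpMean {w : Euc n → ℝ} {x : Euc n} {ρ : ℝ} (hw : ContDiffOn ℝ 1 w (ball x ρ))
    (hweak : ∀ φ : Euc n → ℝ, ContDiff ℝ ∞ φ → HasCompactSupport φ → tsupport φ ⊆ ball x ρ →
      (∀ y, 0 ≤ φ y) → ∫ y, gradInner φ w y ≤ 0) {r : ℝ} (hr : 0 ≤ r) (hrρ : r < ρ) :
    w x ≤ bumpMean w x r := by
  obtain ⟨r', hr', hr'ρ⟩ := exists_between hrρ
  have hr'0 : 0 < r' := hr.trans_lt hr'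
  obtain ⟨w', hw', heq⟩ := exists_contDiff_eqOn (m := 1) hr'0 hr'ρ (by simpa using hw)
  have h := le_bumpMean_of_contDiff (by simpa using hw') (x := x) (ρ := r')
    (fun φ h1 h2 h3 h4 => ?_) hr hr'
  · rwa [heq (mem_closedBall_self hr'0.le),
      bumpMean_congr hr (heq.mono (closedBall_subset_closedBall hr'.le))] at h
  · refine le_trans (le_of_eq ?_) (hweak φ h1 h2 (h3.trans (ball_subset_ball hr'ρ.le)) h4)
    refine integral_congr_ae (Eventually.of_forall fun y => ?_)
    by_cases hy : y ∈ tsupport φ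
    · have : w' =ᶠ[𝓝 y] w := by
        filter_upwards [isOpen_ball.mem_nhds (h3 hy)] with z hz using heq (ball_subset_closedBall hz)
      simp only [gradInner, partialDeriv_congr this]
    · rw [gradInner_eq_zero_of_notMem_tsupport hy, gradInner_eq_zero_of_notMem_tsupport hy]

theorem bumpMean_neg (w : Euc n → ℝ) (x : Euc n) (r : ℝ) :
    bumpMean (fun y => -w y) x r = -bumpMean w x r := by
  simp only [bumpMean, neg_mul, integral_neg]

theorem gradInner_neg_right (φ w : Euc n → ℝ) (y : Euc n) :
    gradInner φ (fun z => -w z) y = -gradInner φ w y := by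
  simp only [gradInner, ← Finset.sum_neg_distrib]
  refine Finset.sum_congr rfl fun j _ => ?_
  have : partialDeriv j (fun z => -w z) y = -partialDeriv j w y := by
    simp only [partialDeriv]
    rw [show (fun z => -w z) = -w from rfl, fderiv_neg]; rfl
  rw [this]; ring

/-- A `C^1` function which is weakly harmonic on `ball x ρ` has the mean value property. -/
theorem eq_bumpMean {w : Euc n → ℝ} {x : Euc n} {ρ : ℝ} (hw : ContDiffOn ℝ 1 w (ball x ρ))
    (hweak : ∀ φ : Euc n → ℝ, ContDiff ℝ ∞ φ → HasCompactSupport φ → tsupport φ ⊆ ball x ρ →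
      ∫ y, gradInner φ w y = 0) {r : ℝ} (hr : 0 ≤ r) (hrρ : r < ρ) :
    w x = bumpMean w x r := by
  refine le_antisymm (le_bumpMean hw (fun φ h1 h2 h3 _ => (hweak φ h1 h2 h3).le) hr hrρ) ?_
  have h := le_bumpMean (w := fun y => -w y) hw.neg (fun φ h1 h2 h3 _ => ?_) hr hrρ
  · rw [bumpMean_neg] at h; linarith
  · simp_rw [gradInner_neg_right]
    rw [integral_neg, hweak φ h1 h2 h3, neg_zero]

theorem le_bumpMean_of_lap_nonneg {w : Euc n → ℝ} {x : Euc n} {ρ : ℝ}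
    (hw : ContDiffOn ℝ 2 w (ball x ρ)) (hlap : ∀ y ∈ ball x ρ, 0 ≤ lap w y) {r : ℝ}
    (hr : 0 ≤ r) (hrρ : r < ρ) : w x ≤ bumpMean w x r := by
  refine le_bumpMean (hw.of_le (by norm_num)) (fun φ h1 h2 h3 h4 => ?_) hr hrρ
  rw [integral_gradInner isOpen_ball (h1.of_le (by exact_mod_cast le_top)) h2 h3 hw,
    neg_nonpos]
  refine integral_nonneg fun y => ?_
  by_cases hy : y ∈ tsupport φ
  · exact mul_nonneg (h4 y) (hlap y (h3 hy))
  · simp [image_eq_zero_of_notMem_tsupport hy]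

/-- In this form the centre enters only through the kernel, so differences of `w` become differences
of smooth kernels. -/
theorem bumpMean_eq (w : Euc n → ℝ) (x : Euc n) {r : ℝ} (hr : 0 < r) :
    bumpMean w x r = (r ^ n)⁻¹ * ∫ z, bump (r⁻¹ • (z - x)) * w z := by
  rw [← integral_comp_affine (fun z => bump (r⁻¹ • (z - x)) * w z) x hr]
  refine integral_congr_ae (Eventually.of_forall fun y => ?_)
  simp only [add_sub_cancel_left, smul_smul, inv_mul_cancel₀ hr.ne', one_smul]
  ring

end BumpMean

end MultiValued

namespace MultiValued

/-! ### Interior estimates from mean values -/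

section Estimates

variable {n : ℕ}

theorem partialDeriv_const (j : Fin n) (c : ℝ) : partialDeriv j (fun _ : Euc n => c) = 0 := by
  ext y
  simp [partialDeriv]

theorem lap_const (c : ℝ) (y : Euc n) : lap (fun _ => c) y = 0 := by
  refine Finset.sum_eq_zero fun j _ => ?_
  rw [partialDeriv_const]
  exact congrFun (partialDeriv_const j 0) y

/-- The sup bound serves pointwise estimates, the Lipschitz bound differences of values, and the
bound on the Laplacian the estimate of the energy density. -/
theorem exists_bump_bounds (n : ℕ) : ∃ C : ℝ, 0 < C ∧ (∀ y : Euc n, |bump y| ≤ C) ∧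
    (∀ y : Euc n, |lap bump y| ≤ C) ∧ ∀ y z : Euc n, |bump y - bump z| ≤ C * ‖y - z‖ := by
  obtain ⟨C₁, h₁⟩ := (contDiff_bump (n := n)).continuous.bounded_above_of_compact_support
    hasCompactSupport_bump
  have h2 : ∀ j, ContDiff ℝ ∞ (partialDeriv j (partialDeriv j (bump (n := n)))) := fun j =>
    contDiff_partialDeriv (m := ⊤) (contDiff_partialDeriv (m := ⊤) contDiff_bump)
  have hc : HasCompactSupport (lap (bump (n := n))) := by
    refine hasCompactSupport_bump.mono' fun y hy => ?_
    by_contra h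
    refine hy (Finset.sum_eq_zero fun j _ => ?_)
    exact image_eq_zero_of_notMem_tsupport fun h' =>
      h (tsupport_partialDeriv_subset j _ (tsupport_partialDeriv_subset j _ h'))
  have hl : Continuous (lap (bump (n := n))) :=
    continuous_finsetSum _ fun j _ => (h2 j).continuous
  obtain ⟨C₂, h₂⟩ := hl.bounded_above_of_compact_support hc
  obtain ⟨C₃, h₃⟩ := ContDiff.lipschitzWith_of_hasCompactSupport hasCompactSupport_bump
    (contDiff_bump (n := n)) (by simp)
  have hC₁ : 0 ≤ C₁ := (norm_nonneg _).trans (h₁ 0)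
  have hC₂ : 0 ≤ C₂ := (norm_nonneg _).trans (h₂ 0)
  refine ⟨C₁ + C₂ + C₃ + 1, by positivity, fun y => ?_, fun y => ?_, fun y z => ?_⟩
  · have := h₁ y
    rw [Real.norm_eq_abs] at this
    linarith [C₃.2]
  · have := h₂ y
    rw [Real.norm_eq_abs] at this
    linarith [C₃.2]
  · have := h₃.dist_le_mul y z
    rw [Real.dist_eq, dist_eq_norm] at this
    refine this.trans (mul_le_mul_of_nonneg_right ?_ (norm_nonneg _))
    linarith

theorem abs_integral_mul_le {K g : Euc n → ℝ} {S : Set (Euc n)} (hS : MeasurableSet S) {C I : ℝ}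
    (hC : 0 ≤ C) (hI0 : 0 ≤ I) (hK0 : ∀ z ∉ S, K z = 0) (hK : ∀ z, |K z| ≤ C)
    (hI : ∫⁻ z in S, ENNReal.ofReal |g z| ≤ ENNReal.ofReal I) : |∫ z, K z * g z| ≤ C * I := by
  rw [← ENNReal.ofReal_le_ofReal_iff (by positivity), ← Real.enorm_eq_ofReal_abs]
  calc ‖∫ z, K z * g z‖ₑ ≤ ∫⁻ z, ‖K z * g z‖ₑ := enorm_integral_le_lintegral_enorm _
    _ ≤ ∫⁻ z, S.indicator (fun z => ENNReal.ofReal C * ENNReal.ofReal |g z|) z := by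
        refine lintegral_mono fun z => ?_
        by_cases hz : z ∈ S
        · rw [indicator_of_mem hz, ← ENNReal.ofReal_mul hC, Real.enorm_eq_ofReal_abs, abs_mul]
          exact ENNReal.ofReal_le_ofReal (mul_le_mul_of_nonneg_right (hK z) (abs_nonneg _))
        · simp [hK0 z hz]
    _ = ENNReal.ofReal C * ∫⁻ z in S, ENNReal.ofReal |g z| := by
        rw [lintegral_indicator hS, lintegral_const_mul' _ _ ENNReal.ofReal_ne_top]
    _ ≤ ENNReal.ofReal (C * I) := by
        rw [ENNReal.ofReal_mul hC]; gcongr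

theorem lintegral_abs_sq_le {w : Euc n → ℝ} {S : Set (Euc n)}
    (hw : AEMeasurable w (volume.restrict S)) :
    (∫⁻ z in S, ENNReal.ofReal |w z|) ^ 2 ≤
      volume S * ∫⁻ z in S, ENNReal.ofReal (w z ^ 2) := by
  have h := ENNReal.lintegral_mul_le_Lp_mul_Lq (volume.restrict S) Real.HolderConjugate.two_two
    (f := fun z => ENNReal.ofReal |w z|) (g := fun _ => 1) hw.norm.ennreal_ofReal
    aemeasurable_const
  have h1 : ∀ z, (ENNReal.ofReal |w z|) ^ (2 : ℝ) = ENNReal.ofReal (w z ^ 2) := fun z => by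
    rw [ENNReal.rpow_ofNat, ← ENNReal.ofReal_pow (abs_nonneg _), sq_abs]
  simp only [Pi.mul_apply, mul_one, ENNReal.one_rpow, lintegral_one, h1,
    Measure.restrict_apply_univ] at h
  calc _ ≤ ((∫⁻ z in S, ENNReal.ofReal (w z ^ 2)) ^ (1 / (2 : ℝ)) *
        volume S ^ (1 / (2 : ℝ))) ^ 2 := by gcongr
    _ = _ := by
      rw [mul_pow, ← ENNReal.rpow_natCast, ← ENNReal.rpow_natCast, ← ENNReal.rpow_mul,
        ← ENNReal.rpow_mul]
      norm_num [mul_comm]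

/-- Cauchy–Schwarz on a ball, whose volume supplies the factor d^n. -/
theorem abs_integral_mul_sq_le {K w : Euc n → ℝ} {x : Euc n} {d C I : ℝ} (hd : 0 < d)
    (hC : 0 ≤ C) (hI0 : 0 ≤ I) (hK0 : ∀ z ∉ ball x d, K z = 0) (hK : ∀ z, |K z| ≤ C)
    (hw : AEMeasurable w (volume.restrict (ball x d)))
    (hI : ∫⁻ z in ball x d, ENNReal.ofReal (w z ^ 2) ≤ ENNReal.ofReal I) :
    (∫ z, K z * w z) ^ 2 ≤ C ^ 2 * (volume.real (ball (0 : Euc n) 1) * d ^ n * I) := by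
  set J := volume.real (ball (0 : Euc n) 1) * d ^ n * I with hJ
  have hJ0 : 0 ≤ J := by positivity
  have hvol : volume (ball x d) = ENNReal.ofReal (volume.real (ball (0 : Euc n) 1) * d ^ n) := by
    rw [Measure.addHaar_ball_of_pos _ _ hd, ENNReal.ofReal_mul measureReal_nonneg, mul_comm,
      ofReal_measureReal (measure_ball_lt_top.ne)]
    simp
  have h1 : ∫⁻ z in ball x d, ENNReal.ofReal |w z| ≤ ENNReal.ofReal (Real.sqrt J) := by
    have h2 := lintegral_abs_sq_le hw
    rw [← ENNReal.pow_le_pow_left_iff (n := 2) two_ne_zero, ← ENNReal.ofReal_pow (Real.sqrt_nonneg _),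
      Real.sq_sqrt hJ0]
    refine h2.trans ?_
    rw [hvol, hJ, ENNReal.ofReal_mul (p := _ * _) (by positivity)]
    exact mul_le_mul_right hI _
  have h3 := abs_integral_mul_le measurableSet_ball hC (Real.sqrt_nonneg _) hK0 hK h1
  calc (∫ z, K z * w z) ^ 2 = |∫ z, K z * w z| ^ 2 := (sq_abs _).symm
    _ ≤ (C * Real.sqrt J) ^ 2 := by gcongr
    _ = C ^ 2 * J := by rw [mul_pow, Real.sq_sqrt hJ0]

theorem tsupport_subset_closedBall {φ : Euc n → ℝ} {x : Euc n} {r : ℝ}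
    (h : ∀ z ∉ closedBall x r, φ z = 0) : tsupport φ ⊆ closedBall x r :=
  closure_minimal (fun z hz => by_contra fun h' => hz (h z h')) isClosed_closedBall

theorem bump_scaled_eq_zero {x z : Euc n} {r : ℝ} (hr : 0 < r) (hz : z ∉ ball x r) :
    1 ≤ ‖r⁻¹ • (z - x)‖ := by
  rw [mem_ball, not_lt, dist_eq_norm] at hz
  rwa [norm_smul, norm_inv, Real.norm_of_nonneg hr.le, ← div_eq_inv_mul, le_div_iff₀ hr, one_mul]

/-- Interior estimates for weakly harmonic functions. -/
theorem exists_weaklyHarmonic_estimate (n : ℕ) : ∃ C : ℝ, 0 < C ∧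
    ∀ (w : Euc n → ℝ) (x : Euc n) (d I : ℝ), 0 < d → 0 ≤ I → ContDiffOn ℝ 1 w (ball x d) →
      (∀ φ : Euc n → ℝ, ContDiff ℝ ∞ φ → HasCompactSupport φ → tsupport φ ⊆ ball x d →
        ∫ y, gradInner φ w y = 0) →
      ∫⁻ z in ball x d, ENNReal.ofReal (w z ^ 2) ≤ ENNReal.ofReal I →
      w x ^ 2 ≤ C * I / d ^ n ∧
      ∀ y ∈ ball x (d / 2), (w x - w y) ^ 2 ≤ C * ‖x - y‖ ^ 2 * I / d ^ (n + 2) := by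
  obtain ⟨C₀, hC₀, hb, -, hL⟩ := exists_bump_bounds n
  set c := volume.real (ball (0 : Euc n) 1)
  have hc : 0 ≤ c := measureReal_nonneg
  refine ⟨C₀ ^ 2 * (c + 1) * (4 ^ (n + 1)) ^ 2, by positivity, fun w x d I hd hI0 hw hweak hI => ?_⟩
  have hr : 0 < d / 4 := by positivity
  have hmeas : AEMeasurable w (volume.restrict (ball x d)) :=
    hw.continuousOn.aemeasurable measurableSet_ball
  -- With radius d/4 the kernels centred in the ball of radius d/2 are all supported inside the ball
  -- of radius d.
  have hmv : ∀ y ∈ ball x (d / 2), w y = ((d / 4) ^ n)⁻¹ *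
      ∫ z, bump ((d / 4)⁻¹ • (z - y)) * w z := fun y hy => by
    have hsub : ball y (d / 2) ⊆ ball x d := by
      refine ball_subset_ball' ?_
      rw [mem_ball] at hy; linarith
    rw [← bumpMean_eq _ _ hr]
    exact eq_bumpMean (ρ := d / 2) (hw.mono hsub)
      (fun φ h1 h2 h3 => hweak φ h1 h2 (h3.trans hsub)) hr.le (by linarith)
  have hz0 : ∀ y ∈ ball x (d / 2), ∀ z ∉ ball x d, bump ((d / 4)⁻¹ • (z - y)) = 0 :=
    fun y hy z hz => bump_of_one_le <| bump_scaled_eq_zero hr fun hz' => hz <| by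
      rw [mem_ball] at hy hz' ⊢
      linarith [dist_triangle z y x]
  have hx : x ∈ ball x (d / 2) := mem_ball_self (by positivity)
  have key : ∀ A : ℝ, (((d / 4) ^ n)⁻¹ * A) ^ 2 = (4 ^ n) ^ 2 * A ^ 2 / (d ^ n) ^ 2 := fun A => by
    rw [div_pow]; field_simp
  constructor
  · have h := abs_integral_mul_sq_le hd hC₀.le hI0 (hz0 x hx)
      (fun z => hb ((d / 4)⁻¹ • (z - x))) hmeas hI
    rw [hmv x hx, key]
    calc _ ≤ (4 ^ n) ^ 2 * (C₀ ^ 2 * (c * d ^ n * I)) / (d ^ n) ^ 2 := by gcongr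
      _ = (C₀ ^ 2 * c * (4 ^ n) ^ 2) * I / d ^ n := by field_simp
      _ ≤ _ := by
        gcongr
        · linarith
        · norm_num
        · omega
  · intro y hy
    have hint : ∀ y ∈ ball x (d / 2),
        Integrable fun z => bump ((d / 4)⁻¹ • (z - y)) * w z := fun y hy => by
      have hs : ∀ z ∉ closedBall y (d / 4), bump ((d / 4)⁻¹ • (z - y)) = 0 := fun z hz =>
        bump_of_one_le <| bump_scaled_eq_zero hr fun h => hz (ball_subset_closedBall h)
      refine integrable_mul_of_tsupport (φ := fun z => bump ((d / 4)⁻¹ • (z - y))) isOpen_ball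
        (contDiff_bump.continuous.comp (by fun_prop))
        (HasCompactSupport.intro (isCompact_closedBall y (d / 4)) hs) ?_ hw.continuousOn
      refine (tsupport_subset_closedBall hs).trans (closedBall_subset_ball' ?_)
      rw [mem_ball] at hy; linarith
    -- The kernel is the difference of two translates, of size at most the Lipschitz constant times
    -- |x - y| / (d/4).
    have h := abs_integral_mul_sq_le (C := C₀ * ((d / 4)⁻¹ * ‖x - y‖)) hd (by positivity) hI0
      (K := fun z => bump ((d / 4)⁻¹ • (z - x)) - bump ((d / 4)⁻¹ • (z - y)))
      (fun z hz => by simp only [hz0 x hx z hz, hz0 y hy z hz, sub_zero])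
      (fun z => by
        refine (hL _ _).trans (le_of_eq ?_)
        rw [← smul_sub, norm_smul, norm_inv, Real.norm_of_nonneg hr.le, sub_sub_sub_cancel_left,
          norm_sub_rev]) hmeas hI
    simp only [sub_mul] at h
    rw [integral_sub (hint x hx) (hint y hy)] at h
    rw [hmv x hx, hmv y hy, ← mul_sub, key]
    calc _ ≤ (4 ^ n) ^ 2 * ((C₀ * ((d / 4)⁻¹ * ‖x - y‖)) ^ 2 * (c * d ^ n * I)) / (d ^ n) ^ 2 := by
          gcongr
      _ = (C₀ ^ 2 * c * (4 ^ (n + 1)) ^ 2) * ‖x - y‖ ^ 2 * I / d ^ (n + 2) := by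
          field_simp; ring
      _ ≤ _ := by gcongr; linarith

/-- Interior estimates for a subharmonic function `g ≥ 0` whose Laplacian is subharmonic. -/
theorem exists_subharmonic_estimate (n : ℕ) : ∃ C : ℝ, 0 < C ∧
    ∀ (g e : Euc n → ℝ) (x : Euc n) (d I : ℝ), 0 < d → 0 ≤ I →
      ContDiffOn ℝ 2 g (ball x d) → ContDiffOn ℝ 2 e (ball x d) →
      (∀ y ∈ ball x d, 0 ≤ g y) → (∀ y ∈ ball x d, 0 ≤ e y) →
      (∀ y ∈ ball x d, lap g y = 2 * e y) → (∀ y ∈ ball x d, 0 ≤ lap e y) →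
      ∫⁻ z in ball x d, ENNReal.ofReal (g z) ≤ ENNReal.ofReal I →
      g x ≤ C * I / d ^ n ∧ e x ≤ C * I / d ^ (n + 2) := by
  obtain ⟨C₀, hC₀, hb, hl, -⟩ := exists_bump_bounds n
  refine ⟨C₀ * 2 ^ (n + 2), by positivity, fun g e x d I hd hI0 hg he hg0 he0 hlg hle hI => ?_⟩
  have hr : 0 < d / 2 := by positivity
  have hrd : d / 2 < d := by linarith
  have hI' : ∫⁻ z in closedBall x (d / 2), ENNReal.ofReal |g z| ≤ ENNReal.ofReal I := by
    refine le_trans ?_ hI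
    refine (setLIntegral_congr_fun measurableSet_closedBall fun z hz => ?_).trans_le
      (lintegral_mono_set (closedBall_subset_ball hrd))
    rw [abs_of_nonneg (hg0 z (closedBall_subset_ball hrd hz))]
  have hs : ∀ z ∉ closedBall x (d / 2), bump ((d / 2)⁻¹ • (z - x)) = 0 := fun z hz =>
    bump_of_one_le <| bump_scaled_eq_zero hr fun h => hz (ball_subset_closedBall h)
  have hts : tsupport (fun z => bump ((d / 2)⁻¹ • (z - x))) ⊆ ball x d :=
    (tsupport_subset_closedBall hs).trans (closedBall_subset_ball hrd)
  have hcs : HasCompactSupport (fun z => bump ((d / 2)⁻¹ • (z - x))) :=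
    HasCompactSupport.intro (isCompact_closedBall x (d / 2)) hs
  constructor
  · have h1 := le_bumpMean_of_lap_nonneg hg
      (fun y hy => by rw [hlg y hy]; linarith [he0 y hy]) hr.le hrd
    rw [bumpMean_eq _ _ hr] at h1
    have h2 := abs_integral_mul_le (K := fun z => bump ((d / 2)⁻¹ • (z - x))) measurableSet_closedBall
      hC₀.le hI0 hs (fun z => hb _) hI'
    calc g x ≤ ((d / 2) ^ n)⁻¹ * (C₀ * I) := by
          refine h1.trans ?_; gcongr; exact (le_abs_self _).trans h2
      _ = C₀ * 2 ^ n * I / d ^ n := by rw [div_pow]; field_simp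
      _ ≤ _ := by
        gcongr
        · norm_num
        · omega
  · have h1 := le_bumpMean_of_lap_nonneg he hle hr.le hrd
    rw [bumpMean_eq _ _ hr] at h1
    -- Since 2e is the Laplacian of g, both derivatives move onto the kernel, and the mean of e is
    -- controlled by the integral of g at the cost of a factor of order d⁻².
    have h2 : ∫ z, bump ((d / 2)⁻¹ • (z - x)) * e z =
        (d / 2)⁻¹ ^ 2 / 2 * ∫ z, lap bump ((d / 2)⁻¹ • (z - x)) * g z := by
      have h3 := integral_lap_mul isOpen_ball (φ := fun z => bump ((d / 2)⁻¹ • (z - x)))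
        ((contDiff_bump.of_le (m := ((2 : ℕ∞) : WithTop ℕ∞)) (WithTop.coe_le_coe.2 le_top)).comp
          (by fun_prop)) hcs hts hg
      simp only [lap_comp_affine, mul_assoc] at h3
      rw [integral_const_mul] at h3
      have h4 : ∫ z, bump ((d / 2)⁻¹ • (z - x)) * lap g z =
          2 * ∫ z, bump ((d / 2)⁻¹ • (z - x)) * e z := by
        rw [← integral_const_mul]
        refine integral_congr_ae (Eventually.of_forall fun z => ?_)
        simp only
        by_cases hz : z ∈ ball x d
        · rw [hlg z hz]; ring
        · rw [hs z fun h => hz (closedBall_subset_ball hrd h)]; ring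
      rw [h4] at h3
      linarith
    have h5 : ∀ z ∉ closedBall x (d / 2), lap bump ((d / 2)⁻¹ • (z - x)) = 0 := fun z hz => by
      have h6 := lap_comp_affine bump (d / 2)⁻¹ x z
      rw [lap_congr (g := fun _ => 0) (notMem_tsupport_iff_eventuallyEq.1 fun h =>
        hz (tsupport_subset_closedBall hs h)), lap_const, eq_comm, mul_eq_zero] at h6
      exact h6.resolve_left (by positivity)
    have h6 := abs_integral_mul_le (K := fun z => lap bump ((d / 2)⁻¹ • (z - x)))
      measurableSet_closedBall hC₀.le hI0 h5 (fun z => hl _) hI'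
    rw [h2] at h1
    calc e x ≤ ((d / 2) ^ n)⁻¹ * ((d / 2)⁻¹ ^ 2 / 2 * (C₀ * I)) := by
          refine h1.trans ?_; gcongr; exact (le_abs_self _).trans h6
      _ = (C₀ * 2 ^ (n + 1)) * I / d ^ (n + 2) := by
          rw [div_pow]; field_simp; ring
      _ ≤ _ := by
        gcongr
        · norm_num
        · omega

end Estimates

end MultiValued

namespace MultiValued

/-! ### Harmonic functions are smooth -/

section Smooth

variable {n : ℕ}

theorem weaklyHarmonic_of_lap_eq_zero {f : Euc n → ℝ} {U : Set (Euc n)} (hU : IsOpen U)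
    (hf : ContDiffOn ℝ 2 f U) (hlap : ∀ y ∈ U, lap f y = 0) {φ : Euc n → ℝ}
    (hφ : ContDiff ℝ 1 φ) (hc : HasCompactSupport φ) (hs : tsupport φ ⊆ U) :
    ∫ y, gradInner φ f y = 0 := by
  rw [integral_gradInner hU hφ hc hs hf, neg_eq_zero]
  refine integral_eq_zero_of_ae (Eventually.of_forall fun y => ?_)
  by_cases hy : y ∈ tsupport φ
  · simp [hlap y (hs hy)]
  · simp [image_eq_zero_of_notMem_tsupport hy]

/-- Near `x` the function equals its mean at the fixed radius ρ/4, that is, the convolution of a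
cut-off copy with a smooth kernel. Harmonicity supplies only C^2, while third derivatives are needed
for the Laplacian of a partial derivative. -/
theorem contDiffAt_of_lap_eq_zero {f : Euc n → ℝ} {x : Euc n} {ρ : ℝ} (hρ : 0 < ρ)
    (hf : ContDiffOn ℝ 2 f (ball x ρ)) (hlap : ∀ y ∈ ball x ρ, lap f y = 0) :
    ContDiffAt ℝ ∞ f x := by
  obtain ⟨f', hf', heq⟩ := exists_contDiff_eqOn (m := 2) (r := ρ / 2) (by positivity)
    (by linarith) hf
  have hr : 0 < ρ / 4 := by positivity
  have hb : ContDiff ℝ ∞ fun t : Euc n => bump ((ρ / 4)⁻¹ • t) :=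
    contDiff_bump.comp (by fun_prop)
  have hc : HasCompactSupport fun t : Euc n => bump ((ρ / 4)⁻¹ • t) :=
    hasCompactSupport_bump.comp_smul (inv_ne_zero hr.ne')
  have hconv := hc.contDiff_convolution_right (μ := (volume : Measure (Euc n)))
    (ContinuousLinearMap.mul ℝ ℝ) (n := ⊤) hf'.continuous.locallyIntegrable hb
  refine (hconv.const_smul (((ρ / 4) ^ n)⁻¹)).contDiffAt.congr_of_eventuallyEq ?_
  filter_upwards [ball_mem_nhds x hr] with y hy
  rw [mem_ball] at hy
  have hsub : ball y (ρ / 2) ⊆ ball x ρ := ball_subset_ball' (by linarith)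
  rw [eq_bumpMean (hf.mono hsub |>.of_le (by norm_num)) (fun φ h1 h2 h3 =>
      weaklyHarmonic_of_lap_eq_zero isOpen_ball (hf.mono hsub) (fun z hz => hlap z (hsub hz))
        (h1.of_le (by exact_mod_cast le_top)) h2 h3) hr.le (by linarith : ρ / 4 < ρ / 2),
    bumpMean_congr hr.le (w' := f') fun z hz => (heq ?_).symm, bumpMean_eq _ _ hr]
  · simp only [smul_eq_mul, convolution, ContinuousLinearMap.mul_apply']
    congr 2
    ext z
    rw [← bump_neg, ← smul_neg, neg_sub, mul_comm]
  · rw [mem_closedBall] at hz ⊢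
    linarith [dist_triangle z y x]

theorem lap_eq_laplacian {f : Euc n → ℝ} {x : Euc n} (hf : ContDiffAt ℝ 2 f x) :
    lap f x = Laplacian.laplacian f x := by
  rw [InnerProductSpace.laplacian_eq_iteratedFDeriv_orthonormalBasis f
    (EuclideanSpace.basisFun (Fin n) ℝ)]
  have hd : DifferentiableAt ℝ (fderiv ℝ f) x :=
    (hf.fderiv_right (m := 1) (by norm_num)).differentiableAt one_ne_zero
  refine Finset.sum_congr rfl fun j _ => ?_
  rw [iteratedFDeriv_two_apply]
  change fderiv ℝ (fun y => fderiv ℝ f y (EuclideanSpace.single j 1)) x _ = _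
  rw [fderiv_clm_apply hd (differentiableAt_const _)]
  simp

end Smooth

/-! ### Sums of squares of harmonic functions -/

section SumSq

variable {n : ℕ}

theorem partialDeriv_sum {ι : Type*} [Fintype ι] {j : Fin n} {h : ι → Euc n → ℝ} {y : Euc n}
    (hh : ∀ a, DifferentiableAt ℝ (h a) y) :
    partialDeriv j (fun z => ∑ a, h a z) y = ∑ a, partialDeriv j (h a) y := by
  simp only [partialDeriv]
  rw [fderiv_fun_sum fun a _ => hh a]
  simp

theorem partialDeriv_mul {j : Fin n} {f g : Euc n → ℝ} {y : Euc n}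
    (hf : DifferentiableAt ℝ f y) (hg : DifferentiableAt ℝ g y) :
    partialDeriv j (fun z => f z * g z) y =
      f y * partialDeriv j g y + partialDeriv j f y * g y := by
  simp only [partialDeriv]
  rw [fderiv_fun_mul hf hg]
  simp [mul_comm]

theorem lap_sum_sq {ι : Type*} [Fintype ι] {h : ι → Euc n → ℝ} {y : Euc n}
    (hh : ∀ a, ContDiffAt ℝ 2 (h a) y) :
    lap (fun z => ∑ a, h a z ^ 2) y =
      ∑ a, (2 * (h a y * lap (h a) y) + 2 * ∑ j, partialDeriv j (h a) y ^ 2) := by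
  have h1 : ∀ j : Fin n, partialDeriv j (fun z => ∑ a, h a z ^ 2) =ᶠ[𝓝 y]
      fun z => ∑ a, 2 * (h a z * partialDeriv j (h a) z) := fun j => by
    have : ∀ᶠ z in 𝓝 y, ∀ a, ContDiffAt ℝ 2 (h a) z :=
      eventually_all.2 fun a => (hh a).eventually (by simp)
    filter_upwards [this] with z hz
    have hd : ∀ a, DifferentiableAt ℝ (h a) z := fun a => (hz a).differentiableAt two_ne_zero
    rw [partialDeriv_sum (h := fun a z => h a z ^ 2) fun a => (hd a).pow 2]
    refine Finset.sum_congr rfl fun a _ => ?_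
    simp only [sq]
    rw [partialDeriv_mul (hd a) (hd a)]
    ring
  have hd : ∀ a, DifferentiableAt ℝ (h a) y := fun a => (hh a).differentiableAt two_ne_zero
  have hd' : ∀ j a, DifferentiableAt ℝ (partialDeriv j (h a)) y := fun j a =>
    (contDiffAt_partialDeriv (m := 1) (by simpa [one_add_one_eq_two] using hh a)
      ).differentiableAt one_ne_zero
  calc lap (fun z => ∑ a, h a z ^ 2) y
      = ∑ j, ∑ a, 2 * (h a y * partialDeriv j (partialDeriv j (h a)) y
          + partialDeriv j (h a) y * partialDeriv j (h a) y) := by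
        refine Finset.sum_congr rfl fun j _ => ?_
        rw [partialDeriv_congr (h1 j),
          partialDeriv_sum (h := fun a z => 2 * (h a z * partialDeriv j (h a) z))
            fun a => ((hd a).mul (hd' j a)).const_mul 2]
        refine Finset.sum_congr rfl fun a _ => ?_
        rw [partialDeriv_const_mul, partialDeriv_mul (hd a) (hd' j a)]
    _ = _ := by
        rw [Finset.sum_comm]
        refine Finset.sum_congr rfl fun a _ => ?_
        rw [lap, Finset.mul_sum, Finset.mul_sum, Finset.mul_sum, ← Finset.sum_add_distrib]
        exact Finset.sum_congr rfl fun j _ => by ring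

theorem partialDeriv_comm {i j : Fin n} {f : Euc n → ℝ} {x : Euc n} (hf : ContDiffAt ℝ 2 f x) :
    partialDeriv i (partialDeriv j f) x = partialDeriv j (partialDeriv i f) x := by
  have hd : DifferentiableAt ℝ (fderiv ℝ f) x :=
    (hf.fderiv_right (m := 1) (by norm_num)).differentiableAt one_ne_zero
  have key : ∀ i j : Fin n, partialDeriv i (partialDeriv j f) x =
      fderiv ℝ (fderiv ℝ f) x (EuclideanSpace.single i 1) (EuclideanSpace.single j 1) := by
    intro i j
    change fderiv ℝ (fun y => fderiv ℝ f y (EuclideanSpace.single j 1)) x _ = _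
    rw [fderiv_clm_apply hd (differentiableAt_const _)]
    simp
  rw [key, key]
  exact hf.isSymmSndFDerivAt (by simp) _ _

theorem lap_partialDeriv {j : Fin n} {f : Euc n → ℝ} {x : Euc n} (hf : ContDiffAt ℝ 3 f x) :
    lap (partialDeriv j f) x = partialDeriv j (lap f) x := by
  have h1 : ∀ i, ContDiffAt ℝ 2 (partialDeriv i f) x := fun i =>
    contDiffAt_partialDeriv (m := 2) (by
      rw [show ((2 + 1 : ℕ∞) : WithTop ℕ∞) = 3 by norm_num]; exact hf)
  have h2 : ∀ i, DifferentiableAt ℝ (partialDeriv i (partialDeriv i f)) x := fun i =>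
    (contDiffAt_partialDeriv (m := 1) (by simpa [one_add_one_eq_two] using h1 i)
      ).differentiableAt one_ne_zero
  change _ = partialDeriv j (fun z => ∑ i, partialDeriv i (partialDeriv i f) z) x
  rw [partialDeriv_sum h2]
  refine Finset.sum_congr rfl fun i _ => ?_
  rw [← partialDeriv_comm (h1 i)]
  refine partialDeriv_congr ?_
  filter_upwards [hf.eventually (by simp)] with z hz
  exact partialDeriv_comm (hz.of_le (by norm_num))

/-- Near `y`, the function `g` is a finite sum of squares of harmonic functions. -/
def IsHarmonicSumSqAt (g : Euc n → ℝ) (y : Euc n) : Prop :=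
  ∃ (ι : Type) (_ : Fintype ι) (f : ι → Euc n → ℝ),
    (∀ a, ContDiffAt ℝ ∞ (f a) y ∧ lap (f a) =ᶠ[𝓝 y] 0) ∧ g =ᶠ[𝓝 y] fun z => ∑ a, f a z ^ 2

theorem lap_eq_of_harmonicSumSq {ι : Type*} [Fintype ι] {f : ι → Euc n → ℝ} {g : Euc n → ℝ}
    {y : Euc n} (hf : ∀ a, ContDiffAt ℝ ∞ (f a) y ∧ lap (f a) =ᶠ[𝓝 y] 0)
    (hg : g =ᶠ[𝓝 y] fun z => ∑ a, f a z ^ 2) :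
    lap g =ᶠ[𝓝 y] fun z => 2 * ∑ a, ∑ j, partialDeriv j (f a) z ^ 2 := by
  have h1 : ∀ᶠ z in 𝓝 y, ∀ a, ContDiffAt ℝ 2 (f a) z ∧ lap (f a) z = 0 :=
    eventually_all.2 fun a =>
      (((hf a).1.of_le (m := ((2 : ℕ∞) : WithTop ℕ∞)) (WithTop.coe_le_coe.2 le_top)).eventually
        (by simp)).and (hf a).2
  filter_upwards [h1, hg.eventually_nhds] with z hz hgz
  rw [lap_congr hgz, lap_sum_sq fun a => (hz a).1, Finset.mul_sum]
  exact Finset.sum_congr rfl fun a _ => by rw [(hz a).2]; ring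

/-- Half the Laplacian of a sum of squares of harmonic functions is the sum of the squares of their
first partial derivatives, which are again harmonic; so the same computation applies a second time.
-/
theorem IsHarmonicSumSqAt.subharmonic {g : Euc n → ℝ} {y : Euc n} (h : IsHarmonicSumSqAt g y) :
    ContDiffAt ℝ 2 g y ∧ ContDiffAt ℝ 2 (fun z => lap g z / 2) y ∧ 0 ≤ g y ∧ 0 ≤ lap g y ∧
      0 ≤ lap (fun z => lap g z / 2) y := by
  obtain ⟨ι, _, f, hf, hg⟩ := h
  have hl := lap_eq_of_harmonicSumSq hf hg
  have h2 : ∀ a, ContDiffAt ℝ 2 (f a) y := fun a =>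
    (hf a).1.of_le (m := ((2 : ℕ∞) : WithTop ℕ∞)) (WithTop.coe_le_coe.2 le_top)
  have h3 : ∀ a, ContDiffAt ℝ 3 (f a) y := fun a =>
    (hf a).1.of_le (m := ((3 : ℕ∞) : WithTop ℕ∞)) (WithTop.coe_le_coe.2 le_top)
  have hp : ∀ p : ι × Fin n, ContDiffAt ℝ 2 (partialDeriv p.2 (f p.1)) y := fun p =>
    contDiffAt_partialDeriv (m := 2) (by
      rw [show ((2 + 1 : ℕ∞) : WithTop ℕ∞) = 3 by norm_num]; exact h3 p.1)
  have he : (fun z => lap g z / 2) =ᶠ[𝓝 y]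
      fun z => ∑ p : ι × Fin n, partialDeriv p.2 (f p.1) z ^ 2 := by
    filter_upwards [hl] with z hz
    rw [hz, Fintype.sum_prod_type]; ring
  refine ⟨?_, ?_, ?_, ?_, ?_⟩
  · exact (ContDiffAt.sum fun a _ => (h2 a).pow 2).congr_of_eventuallyEq hg
  · exact (ContDiffAt.sum fun p _ => (hp p).pow 2).congr_of_eventuallyEq he
  · rw [hg.eq_of_nhds]; positivity
  · rw [hl.eq_of_nhds]; positivity
  · rw [lap_congr he, lap_sum_sq hp]
    refine Finset.sum_nonneg fun p _ => ?_
    have : lap (partialDeriv p.2 (f p.1)) y = 0 := by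
      rw [lap_partialDeriv (h3 p.1), partialDeriv_congr (g := fun _ => 0) (hf p.1).2,
        partialDeriv_const]; rfl
    rw [this]; simp only [mul_zero, zero_add]; positivity

/-- The energy density is expressed as half the Laplacian of `g`, which does not depend on the local
choice of harmonic functions; the local representations need not fit together over the ball. -/
theorem exists_harmonicSumSq_estimate (n : ℕ) : ∃ C : ℝ, 0 < C ∧
    ∀ (g : Euc n → ℝ) (x : Euc n) (d I : ℝ), 0 < d → 0 ≤ I →
      (∀ y ∈ ball x d, IsHarmonicSumSqAt g y) →
      ∫⁻ z in ball x d, ENNReal.ofReal (g z) ≤ ENNReal.ofReal I →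
      g x ≤ C * I / d ^ n ∧ lap g x / 2 ≤ C * I / d ^ (n + 2) := by
  obtain ⟨C, hC, H⟩ := exists_subharmonic_estimate n
  refine ⟨C, hC, fun g x d I hd hI0 hg hI => ?_⟩
  exact H g (fun z => lap g z / 2) x d I hd hI0
    (fun y hy => (hg y hy).subharmonic.1.contDiffWithinAt)
    (fun y hy => (hg y hy).subharmonic.2.1.contDiffWithinAt)
    (fun y hy => (hg y hy).subharmonic.2.2.1)
    (fun y hy => by linarith [(hg y hy).subharmonic.2.2.2.1])
    (fun y hy => by ring) (fun y hy => (hg y hy).subharmonic.2.2.2.2) hI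

end SumSq

end MultiValued

namespace MultiValued

/-! ### Removable sets for `C^1` functions -/

section Removable

variable {n : ℕ}

/-- Since n - 2 < n - 1, the (n-1)-dimensional Hausdorff measure of `K` is zero, so there are covers
with arbitrarily small sum of (n-1)-st powers of diameters. Compactness makes them finite once the
sets are enlarged to open balls. -/
theorem exists_ball_cover {K : Set (Euc n)} (hK : IsCompact K)
    (hd : dimH K + 2 ≤ (n : ℝ≥0∞)) {ε : ℝ} (hε : 0 < ε) :
    ∃ (s : Finset ℕ) (c : ℕ → Euc n) (r : ℕ → ℝ), (∀ i, 0 < r i ∧ r i ≤ 1) ∧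
      K ⊆ ⋃ i ∈ s, ball (c i) (r i) ∧ ∑ i ∈ s, r i ^ (n - 1) ≤ ε := by
  have h2n : 2 ≤ n := by
    have : (2 : ℝ≥0∞) ≤ n := le_trans le_add_self hd
    exact_mod_cast this
  obtain ⟨m, rfl⟩ : ∃ m, n = m + 2 := ⟨n - 2, by omega⟩
  have hdim : dimH K < ((m + 1 : ℕ) : NNReal) := by
    have h1 : dimH K ≤ m := by
      rw [← ENNReal.add_le_add_iff_right (a := 2) (by simp)]
      simpa using hd
    refine h1.trans_lt ?_
    norm_cast
    omega
  have hμ := hausdorffMeasure_of_dimH_lt hdim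
  -- The factor 2^m comes from (a + b)^(m+1) ≤ 2^m (a^(m+1) + b^(m+1)); the 3 leaves room for the
  -- enlargement of the radii.
  set ε' : ℝ := ε / (3 * 2 ^ m) with hε'
  have hε'0 : 0 < ε' := by positivity
  rw [Measure.hausdorffMeasure_apply] at hμ
  -- Mesh size 1/2 keeps the enlarged radii at most 1.
  have h0 := le_iSup₂ (f := fun (r : ℝ≥0∞) (_ : 0 < r) =>
      ⨅ (t : ℕ → Set (Euc (m + 2))) (_ : K ⊆ ⋃ n, t n) (_ : ∀ n, ediam (t n) ≤ r),
        ∑' n, ⨆ _ : (t n).Nonempty, ediam (t n) ^ (((m + 1 : ℕ) : NNReal) : ℝ))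
    (ENNReal.ofReal (1 / 2)) (by simp)
  rw [hμ] at h0
  have h1 := h0.trans_lt (ENNReal.ofReal_pos.2 hε'0)
  simp only [iInf_lt_iff] at h1
  obtain ⟨t, ht, hdiam, hsum⟩ := h1
  set D : ℕ → ℝ := fun i => (ediam (t i)).toReal with hD
  have hD0 : ∀ i, 0 ≤ D i := fun i => ENNReal.toReal_nonneg
  have hDr : ∀ i, ediam (t i) = ENNReal.ofReal (D i) := fun i =>
    (ENNReal.ofReal_toReal (ne_top_of_le_ne_top ENNReal.ofReal_ne_top (hdiam i))).symm
  have hD2 : ∀ i, D i ≤ 1 / 2 := fun i =>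
    ENNReal.toReal_le_of_le_ofReal (by norm_num) (hdiam i)
  classical
  set D' : ℕ → ℝ := fun i => if (t i).Nonempty then D i else 0 with hD'
  have hD'0 : ∀ i, 0 ≤ D' i := fun i => by simp only [hD']; split_ifs <;> simp [hD0]
  have hD'2 : ∀ i, D' i ≤ 1 / 2 := fun i => by
    simp only [hD']; split_ifs
    · exact hD2 i
    · norm_num
  have hsum' : ∀ s : Finset ℕ, ∑ i ∈ s, D' i ^ (m + 1) ≤ ε' := fun s => by
    rw [← ENNReal.ofReal_le_ofReal_iff hε'0.le,
      ENNReal.ofReal_sum_of_nonneg fun i _ => by have := hD'0 i; positivity]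
    refine le_trans (Finset.sum_le_sum fun i _ => ?_) ((ENNReal.sum_le_tsum s).trans hsum.le)
    by_cases hi : (t i).Nonempty
    · simp only [hi, iSup_pos, hD', if_true]
      rw [hDr, NNReal.coe_natCast, ENNReal.rpow_natCast, ENNReal.ofReal_pow (hD0 i)]
    · simp [hi, hD']
  -- A covering set may be a single point, so every radius is increased by a term of a geometric
  -- series; all these terms together cost at most δ.
  set δ : ℝ := min (1 / 2) ε' with hδ
  have hδ0 : 0 < δ := by positivity
  have hδi : ∀ i : ℕ, δ / 2 * (1 / 2 : ℝ) ^ i ≤ 1 / 2 := fun i => by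
    have h1 : (1 / 2 : ℝ) ^ i ≤ 1 := pow_le_one₀ (by norm_num) (by norm_num)
    have h2 : δ ≤ 1 / 2 := min_le_left _ _
    nlinarith
  set c : ℕ → Euc (m + 2) := fun i => if h : (t i).Nonempty then h.some else 0
  obtain ⟨s, hs⟩ := hK.elim_finite_subcover (fun i => ball (c i) (D' i + δ / 2 * (1 / 2) ^ i))
    (fun i => isOpen_ball) (by
      refine ht.trans (iUnion_mono fun i y hy => ?_)
      have hi : (t i).Nonempty := ⟨y, hy⟩
      simp only [c, dif_pos hi, hD', if_pos hi, mem_ball]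
      have h1 : edist y hi.some ≤ ediam (t i) := edist_le_ediam_of_mem hy hi.some_mem
      rw [hDr, edist_dist, ENNReal.ofReal_le_ofReal_iff (hD0 i)] at h1
      have : 0 < δ / 2 * (1 / 2 : ℝ) ^ i := by positivity
      linarith)
  refine ⟨s, c, fun i => D' i + δ / 2 * (1 / 2) ^ i, fun i => ⟨?_, ?_⟩, hs, ?_⟩
  · have := hD'0 i; positivity
  · linarith [hD'2 i, hδi i]
  · calc ∑ i ∈ s, (D' i + δ / 2 * (1 / 2) ^ i) ^ (m + 1)
        ≤ ∑ i ∈ s, 2 ^ m * (D' i ^ (m + 1) + δ / 2 * (1 / 2) ^ i) := by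
          refine Finset.sum_le_sum fun i _ => ?_
          refine (add_pow_le (hD'0 i) (by positivity) (m + 1)).trans ?_
          simp only [Nat.add_sub_cancel]
          gcongr
          exact pow_le_of_le_one (by positivity) ((hδi i).trans (by norm_num)) (by omega)
      _ = 2 ^ m * (∑ i ∈ s, D' i ^ (m + 1) + δ / 2 * ∑ i ∈ s, (1 / 2 : ℝ) ^ i) := by
          rw [← Finset.mul_sum, Finset.sum_add_distrib, ← Finset.mul_sum]
      _ ≤ 2 ^ m * (ε' + δ / 2 * 2) := by
          gcongr
          · exact hsum' s
          · exact (summable_geometric_two.sum_le_tsum s fun i _ => by positivity).trans_eq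
              tsum_geometric_two
      _ ≤ 2 ^ m * (3 * ε') := by
          gcongr
          have : δ ≤ ε' := min_le_right _ _
          linarith
      _ = ε := by rw [hε']; field_simp

theorem hasCompactSupport_partialDeriv {f : Euc n → ℝ} (hf : HasCompactSupport f) (j : Fin n) :
    HasCompactSupport (partialDeriv j f) :=
  hf.mono' ((subset_tsupport _).trans (tsupport_partialDeriv_subset j f))

theorem contDiff_partialDeriv_infty {f : Euc n → ℝ} (hf : ContDiff ℝ ∞ f) (j : Fin n) :
    ContDiff ℝ ∞ (partialDeriv j f) := contDiff_partialDeriv (m := ⊤) hf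

theorem partialDeriv_one_sub (j : Fin n) (f : Euc n → ℝ) (y : Euc n) :
    partialDeriv j (fun z => 1 - f z) y = -partialDeriv j f y := by
  simp only [partialDeriv]
  rw [fderiv_const_sub]; rfl

theorem integrable_partialDeriv_of_one_sub {ψ : Euc n → ℝ} (h1 : ContDiff ℝ ∞ ψ)
    (h2 : HasCompactSupport fun y => 1 - ψ y) (j : Fin n) : Integrable (partialDeriv j ψ) := by
  have h := ((contDiff_partialDeriv_infty (contDiff_const.sub h1) j
    ).continuous.integrable_of_hasCompactSupport (μ := (volume : Measure (Euc n)))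
      (hasCompactSupport_partialDeriv h2 j)).neg
  refine h.congr (Eventually.of_forall fun y => ?_)
  simp only [Pi.neg_apply]
  rw [partialDeriv_one_sub, neg_neg]

/-- Multiply one cutoff per ball. The gradient of a cutoff at scale r has L¹ norm of order r^(n-1),
and its support has volume of order r^n ≤ r^(n-1) because r ≤ 1. As all factors lie in [0, 1], these
quantities add up under products. -/
theorem exists_cutoff (hn : 1 ≤ n) : ∃ C : ℝ, 0 < C ∧
    ∀ (s : Finset ℕ) (c : ℕ → Euc n) (r : ℕ → ℝ), (∀ i, 0 < r i ∧ r i ≤ 1) →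
      ∃ ψ : Euc n → ℝ, ContDiff ℝ ∞ ψ ∧ HasCompactSupport (fun y => 1 - ψ y) ∧
        (∀ y, 0 ≤ ψ y ∧ ψ y ≤ 1) ∧ (∀ i ∈ s, ∀ y ∈ ball (c i) (r i), ψ y = 0) ∧
        ∫ y, (1 - ψ y) ≤ C * ∑ i ∈ s, r i ^ (n - 1) ∧
        ∀ j, ∫ y, |partialDeriv j ψ y| ≤ C * ∑ i ∈ s, r i ^ (n - 1) := by
  let χ : ContDiffBump (0 : Euc n) := ⟨1, 2, one_pos, one_lt_two⟩
  have hχ : ContDiff ℝ ∞ χ := χ.contDiff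
  have hint : ∀ j, 0 ≤ ∫ y, |partialDeriv j χ y| := fun j => integral_nonneg fun y => abs_nonneg _
  have hχ0 : 0 ≤ ∫ y, χ y := integral_nonneg fun y => χ.nonneg
  have hsum0 : 0 ≤ ∑ j, ∫ y, |partialDeriv j χ y| := Finset.sum_nonneg fun j _ => hint j
  refine ⟨(∫ y, χ y) + (∑ j, ∫ y, |partialDeriv j χ y|) + 1, by positivity, fun s c r hr => ?_⟩
  set C := (∫ y, χ y) + (∑ j, ∫ y, |partialDeriv j χ y|) + 1 with hC
  have hpow : ∀ i, r i ^ n = r i ^ (n - 1) * r i := fun i => by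
    rw [← pow_succ, Nat.sub_add_cancel hn]
  induction s using Finset.induction_on with
  | empty =>
    refine ⟨fun _ => 1, contDiff_const, ?_, by simp, by simp, by simp, fun j => ?_⟩
    · simp only [sub_self]; exact HasCompactSupport.zero
    · rw [partialDeriv_const]; simp
  | insert i s hi ih =>
    obtain ⟨ψ, h1, h2, h3, h4, h5, h6⟩ := ih
    have hri := (hr i).1
    set θ : Euc n → ℝ := fun z => χ ((r i)⁻¹ • (z - c i)) with hθ
    have hθs : ContDiff ℝ ∞ θ := hχ.comp (by fun_prop)
    have hθc : HasCompactSupport θ := by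
      refine HasCompactSupport.intro (isCompact_closedBall (c i) (2 * r i)) fun z hz => ?_
      refine χ.zero_of_le_dist ?_
      rw [mem_closedBall, not_le, dist_eq_norm] at hz
      rw [dist_zero_right, norm_smul, norm_inv, Real.norm_of_nonneg hri.le, ← div_eq_inv_mul,
        le_div_iff₀ hri]
      exact hz.le
    have hθ01 : ∀ y, 0 ≤ θ y ∧ θ y ≤ 1 := fun y => ⟨χ.nonneg, χ.le_one⟩
    have hresc : ∀ F : Euc n → ℝ, ∫ z, F ((r i)⁻¹ • (z - c i)) = r i ^ n * ∫ y, F y := fun F => by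
      have := integral_comp_affine (fun z => F ((r i)⁻¹ • (z - c i))) (c i) hri
      simp only [add_sub_cancel_left, smul_smul, inv_mul_cancel₀ hri.ne', one_smul] at this
      rw [this, ← mul_assoc, mul_inv_cancel₀ (by positivity), one_mul]
    have hθi : ∫ y, θ y ≤ C * r i ^ (n - 1) := by
      rw [hresc χ, hpow, hC]
      have h7 : 0 < r i ^ (n - 1) := by positivity
      have h8 : r i ^ (n - 1) * r i ≤ r i ^ (n - 1) := mul_le_of_le_one_right h7.le (hr i).2
      nlinarith
    have hθd : ∀ j, ∫ y, |partialDeriv j θ y| ≤ C * r i ^ (n - 1) := fun j => by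
      have h7 : ∀ y, |partialDeriv j θ y| =
          (r i)⁻¹ * |partialDeriv j χ ((r i)⁻¹ • (y - c i))| := fun y => by
        rw [hθ, partialDeriv_comp_affine, abs_mul, abs_of_pos (inv_pos.2 hri)]
      simp_rw [h7]
      rw [integral_const_mul, hresc fun y => |partialDeriv j χ y|, hpow]
      have h8 : (r i)⁻¹ * (r i ^ (n - 1) * r i * ∫ y, |partialDeriv j χ y|) =
          (∫ y, |partialDeriv j χ y|) * r i ^ (n - 1) := by field_simp
      rw [h8]
      gcongr
      have := Finset.single_le_sum (f := fun j => ∫ y, |partialDeriv j χ y|)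
        (fun j _ => hint j) (Finset.mem_univ j)
      linarith
    have hiψ : Integrable fun y => 1 - ψ y :=
      (continuous_const.sub h1.continuous).integrable_of_hasCompactSupport h2
    have hiθ : Integrable θ := hθs.continuous.integrable_of_hasCompactSupport hθc
    have hiθd : ∀ j, Integrable fun y => |partialDeriv j θ y| := fun j =>
      ((contDiff_partialDeriv_infty hθs j).continuous.integrable_of_hasCompactSupport
        (hasCompactSupport_partialDeriv hθc j)).abs
    have hiψd : ∀ j, Integrable fun y => |partialDeriv j ψ y| := fun j =>
      (integrable_partialDeriv_of_one_sub h1 h2 j).abs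
    refine ⟨fun y => ψ y * (1 - θ y), h1.mul (contDiff_const.sub hθs), ?_, fun y => ⟨?_, ?_⟩,
      fun a ha y hy => ?_, ?_, fun j => ?_⟩
    · have : (fun y => 1 - ψ y * (1 - θ y)) = fun y => (1 - ψ y) + ψ y * θ y := by
        ext y; ring
      rw [this]
      exact h2.add hθc.mul_left
    · exact mul_nonneg (h3 y).1 (by linarith [(hθ01 y).2])
    · nlinarith [(h3 y).1, (h3 y).2, (hθ01 y).1, (hθ01 y).2]
    · rcases Finset.mem_insert.1 ha with rfl | ha
      · have : θ y = 1 := χ.one_of_mem_closedBall (by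
          rw [mem_ball, dist_eq_norm] at hy
          rw [mem_closedBall, dist_zero_right, norm_smul, norm_inv, Real.norm_of_nonneg hri.le,
            ← div_eq_inv_mul, div_le_iff₀ hri]
          change _ ≤ 1 * _
          linarith)
        simp [this]
      · simp [h4 a ha y hy]
    · rw [Finset.sum_insert hi, mul_add]
      calc ∫ y, (1 - ψ y * (1 - θ y)) ≤ ∫ y, (θ y + (1 - ψ y)) := by
            refine integral_mono_of_nonneg (Eventually.of_forall fun y => ?_) (hiθ.add hiψ)
              (Eventually.of_forall fun y => ?_)
            · simp only [Pi.zero_apply]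
              nlinarith [(h3 y).1, (h3 y).2, (hθ01 y).1, (hθ01 y).2]
            · simp only
              nlinarith [(h3 y).1, (h3 y).2, (hθ01 y).1, (hθ01 y).2]
        _ = (∫ y, θ y) + ∫ y, (1 - ψ y) := integral_add hiθ hiψ
        _ ≤ _ := add_le_add hθi h5
    · rw [Finset.sum_insert hi, mul_add]
      calc ∫ y, |partialDeriv j (fun y => ψ y * (1 - θ y)) y|
          ≤ ∫ y, (|partialDeriv j θ y| + |partialDeriv j ψ y|) := by
            refine integral_mono_of_nonneg (Eventually.of_forall fun y => abs_nonneg _)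
              ((hiθd j).add (hiψd j)) (Eventually.of_forall fun y => ?_)
            simp only
            rw [partialDeriv_mul (h1.differentiable (by simp) y)
              ((hθs.differentiable (by simp) y).const_sub 1), partialDeriv_one_sub]
            refine (abs_add_le _ _).trans ?_
            rw [abs_mul, abs_mul, abs_neg, abs_of_nonneg (h3 y).1,
              abs_of_nonneg (by linarith [(hθ01 y).2] : (0 : ℝ) ≤ 1 - θ y)]
            have e1 := mul_le_of_le_one_left (abs_nonneg (partialDeriv j θ y)) (h3 y).2
            have e2 := mul_le_of_le_one_right (abs_nonneg (partialDeriv j ψ y))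
              (by linarith [(hθ01 y).1] : 1 - θ y ≤ 1)
            linarith
        _ = (∫ y, |partialDeriv j θ y|) + ∫ y, |partialDeriv j ψ y| := integral_add (hiθd j) (hiψd j)
        _ ≤ _ := add_le_add (hθd j) (h6 j)

theorem gradInner_mul {φ ψ w : Euc n → ℝ} {y : Euc n} (hφ : DifferentiableAt ℝ φ y)
    (hψ : DifferentiableAt ℝ ψ y) :
    gradInner (fun z => φ z * ψ z) w y = ψ y * gradInner φ w y + φ y * gradInner ψ w y := by
  simp only [gradInner, Finset.mul_sum]
  rw [← Finset.sum_add_distrib]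
  refine Finset.sum_congr rfl fun j _ => ?_
  rw [partialDeriv_mul hφ hψ]; ring

/-- A closed set of dimension at most `n - 2` is removable for harmonic functions of class
`C^1`. -/
theorem weaklyHarmonic_of_removable {U B : Set (Euc n)} (hU : IsOpen U) (hUB : IsOpen (U \ B))
    (hB : B = ∅ ∨ dimH B + 2 ≤ (n : ℝ≥0∞)) {w : Euc n → ℝ} (hw : ContDiffOn ℝ 1 w U)
    (hw2 : ContDiffOn ℝ 2 w (U \ B)) (hlap : ∀ y ∈ U \ B, lap w y = 0) {φ : Euc n → ℝ}
    (hφ : ContDiff ℝ ∞ φ) (hc : HasCompactSupport φ) (hs : tsupport φ ⊆ U) :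
    ∫ y, gradInner φ w y = 0 := by
  rcases hB with rfl | hB
  · rw [sdiff_empty] at hw2 hlap
    exact weaklyHarmonic_of_lap_eq_zero hU hw2 hlap (hφ.of_le (by exact_mod_cast le_top)) hc hs
  have hn : 1 ≤ n := by
    have : (2 : ℝ≥0∞) ≤ n := le_trans le_add_self hB
    have : 2 ≤ n := by exact_mod_cast this
    omega
  have hcont : ∀ j, ContinuousOn (partialDeriv j w) U := fun j => continuousOn_partialDeriv hU hw
  have hφ1 : ContDiff ℝ 1 φ := hφ.of_le (by exact_mod_cast le_top)
  set K := tsupport φ \ (U \ B) with hKdef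
  have hK : IsCompact K := hc.isCompact.diff hUB
  have hKB : K ⊆ B := fun y hy => by
    by_contra h; exact hy.2 ⟨hs hy.1, h⟩
  have hKd : dimH K + 2 ≤ (n : ℝ≥0∞) := le_trans (by gcongr) hB
  -- uniform bounds
  have hG : Continuous fun y => gradInner φ w y := by
    refine continuous_finsetSum _ fun j _ => continuous_mul_of_tsupport hU
      (contDiff_partialDeriv_infty hφ j).continuous
      ((tsupport_partialDeriv_subset j φ).trans hs) (hcont j)
  have hGc : HasCompactSupport fun y => gradInner φ w y := by
    refine hc.mono' fun y hy => ?_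
    by_contra h; exact hy (gradInner_eq_zero_of_notMem_tsupport h)
  have hP : ∀ j, Continuous fun y => φ y * partialDeriv j w y := fun j =>
    continuous_mul_of_tsupport hU hφ.continuous hs (hcont j)
  have hPb : ∀ j, ∃ M, ∀ y, ‖φ y * partialDeriv j w y‖ ≤ M := fun j =>
    (hP j).bounded_above_of_compact_support hc.mul_right
  choose M hM using hPb
  obtain ⟨M₀, hM₀⟩ := hG.bounded_above_of_compact_support hGc
  have hM0 : ∀ j, 0 ≤ M j := fun j => (norm_nonneg _).trans (hM j 0)
  have hM₀0 : 0 ≤ M₀ := (norm_nonneg _).trans (hM₀ 0)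
  obtain ⟨C, hC, hcut⟩ := exists_cutoff hn
  -- Replace φ by φψ, with ψ vanishing near `K`; that pairing is zero. The error involves only ∫ (1
  -- - ψ) and ∫ |∂ψ|, because the gradient of `w` is bounded on the support of φ.
  have key : ∀ ε > 0, |∫ y, gradInner φ w y| ≤ (M₀ + ∑ j, M j) * C * ε := by
    intro ε hε
    obtain ⟨s, c, r, hr, hcov, hsum⟩ := exists_ball_cover hK hKd hε
    obtain ⟨ψ, h1, h2, h3, h4, h5, h6⟩ := hcut s c r hr
    have h1' : ContDiff ℝ 1 ψ := h1.of_le (by exact_mod_cast le_top)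
    have h5' : ∫ y, (1 - ψ y) ≤ C * ε := h5.trans (by gcongr)
    have h6' : ∀ j, ∫ y, |partialDeriv j ψ y| ≤ C * ε := fun j => (h6 j).trans (by gcongr)
    have hts : tsupport (fun y => φ y * ψ y) ⊆ U \ B := by
      intro y hy
      have hy1 : y ∈ tsupport φ := tsupport_mul_subset_left (f := φ) (g := ψ) hy
      by_contra hyB
      have hyK : y ∈ K := ⟨hy1, hyB⟩
      obtain ⟨i, hi, hyi⟩ := mem_iUnion₂.1 (hcov hyK)
      have : y ∉ tsupport ψ := by
        rw [notMem_tsupport_iff_eventuallyEq]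
        filter_upwards [isOpen_ball.mem_nhds hyi] with z hz using h4 i hi z hz
      exact this (tsupport_mul_subset_right (f := φ) (g := ψ) hy)
    have h7 : ∫ y, gradInner (fun z => φ z * ψ z) w y = 0 :=
      weaklyHarmonic_of_lap_eq_zero hUB hw2 hlap (hφ1.mul h1') hc.mul_right hts
    have hiψd : ∀ j, Integrable fun y => partialDeriv j ψ y := fun j =>
      integrable_partialDeriv_of_one_sub h1 h2 j
    have hiA : Integrable fun y => (1 - ψ y) * gradInner φ w y :=
      ((continuous_const.sub h1.continuous).mul hG).integrable_of_hasCompactSupport hGc.mul_left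
    have hiBj : ∀ j, Integrable fun y => (φ y * partialDeriv j w y) * partialDeriv j ψ y :=
      fun j => ((hP j).mul (contDiff_partialDeriv_infty h1 j).continuous
        ).integrable_of_hasCompactSupport hc.mul_right.mul_right
    have h8 : ∀ y, gradInner φ w y = (1 - ψ y) * gradInner φ w y +
        gradInner (fun z => φ z * ψ z) w y -
          ∑ j, (φ y * partialDeriv j w y) * partialDeriv j ψ y := fun y => by
      rw [gradInner_mul (hφ.differentiable (by simp) y) (h1.differentiable (by simp) y)]
      have : φ y * gradInner ψ w y = ∑ j, (φ y * partialDeriv j w y) * partialDeriv j ψ y := by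
        rw [gradInner, Finset.mul_sum]
        exact Finset.sum_congr rfl fun j _ => by ring
      rw [this]; ring
    have hiC : Integrable fun y => gradInner (fun z => φ z * ψ z) w y := by
      have : (fun y => gradInner (fun z => φ z * ψ z) w y) = fun y => gradInner φ w y -
          (1 - ψ y) * gradInner φ w y +
          ∑ j, (φ y * partialDeriv j w y) * partialDeriv j ψ y := by
        ext y; linarith [h8 y]
      rw [this]
      exact ((hG.integrable_of_hasCompactSupport hGc).sub hiA).add
        (integrable_finsetSum _ fun j _ => hiBj j)
    have h9 : ∫ y, gradInner φ w y = (∫ y, (1 - ψ y) * gradInner φ w y) -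
        ∑ j, ∫ y, (φ y * partialDeriv j w y) * partialDeriv j ψ y := by
      conv_lhs => rw [funext h8]
      refine (integral_sub (hiA.add hiC) (integrable_finsetSum _ fun j _ => hiBj j)).trans ?_
      rw [integral_finsetSum _ fun j _ => hiBj j]
      congr 1
      refine (integral_add hiA hiC).trans ?_
      rw [h7, add_zero]
    have hb1 : |∫ y, (1 - ψ y) * gradInner φ w y| ≤ M₀ * (C * ε) := by
      rw [← Real.norm_eq_abs]
      refine (norm_integral_le_of_norm_le (g := fun y => M₀ * (1 - ψ y))
        (((continuous_const.sub h1.continuous).integrable_of_hasCompactSupport h2).const_mul _)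
        (Eventually.of_forall fun y => ?_)).trans ?_
      · rw [norm_mul, Real.norm_of_nonneg (by linarith [(h3 y).2] : 0 ≤ 1 - ψ y), mul_comm]
        exact mul_le_mul_of_nonneg_right (hM₀ y) (by linarith [(h3 y).2])
      · rw [integral_const_mul]; gcongr
    have hb2 : ∀ j, |∫ y, (φ y * partialDeriv j w y) * partialDeriv j ψ y| ≤ M j * (C * ε) := by
      intro j
      rw [← Real.norm_eq_abs]
      refine (norm_integral_le_of_norm_le (g := fun y => M j * |partialDeriv j ψ y|)
        ((hiψd j).abs.const_mul _) (Eventually.of_forall fun y => ?_)).trans ?_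
      · rw [norm_mul, Real.norm_eq_abs (partialDeriv j ψ y)]
        exact mul_le_mul_of_nonneg_right (hM j y) (abs_nonneg _)
      · rw [integral_const_mul]
        exact mul_le_mul_of_nonneg_left (h6' j) (hM0 j)
    rw [h9]
    refine (abs_sub _ _).trans ?_
    have hb3 := (Finset.abs_sum_le_sum_abs (fun j => ∫ y, (φ y * partialDeriv j w y) *
      partialDeriv j ψ y) Finset.univ).trans (Finset.sum_le_sum fun j _ => hb2 j)
    rw [← Finset.sum_mul] at hb3
    calc _ ≤ M₀ * (C * ε) + (∑ j, M j) * (C * ε) := add_le_add hb1 hb3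
      _ = _ := by ring
  have hA : 0 ≤ (M₀ + ∑ j, M j) * C :=
    mul_nonneg (add_nonneg hM₀0 (Finset.sum_nonneg fun j _ => hM0 j)) hC.le
  have h0 : |∫ y, gradInner φ w y| ≤ 0 := by
    refine le_of_forall_pos_le_add fun ε hε => ?_
    have h := key (ε / ((M₀ + ∑ j, M j) * C + 1)) (by positivity)
    refine h.trans ?_
    rw [zero_add, ← mul_div_assoc, div_le_iff₀ (by positivity)]
    nlinarith
  exact abs_nonpos_iff.1 h0

end Removable

end MultiValued

namespace MultiValued

/-! ### The average and the symmetric part of a good harmonic function -/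

section Jets

variable {E V : Type*} [NormedAddCommGroup E] [NormedSpace ℝ E] [NormedAddCommGroup V]
  [NormedSpace ℝ V] {Q : ℕ} {u : E → Sym V Q} {x : E}

theorem norm_mean_sub_le (hQ : 0 < Q) (S T : Sym V Q) : ‖mean S - mean T‖ ≤ qdist S T := by
  have h := mean_dist_sq_le hQ S T
  have hQ1 : (1 : ℝ) ≤ Q := by exact_mod_cast hQ
  refine le_of_sq_le_sq ?_ (qdist_nonneg _ _)
  nlinarith [sq_nonneg ‖mean S - mean T‖]

theorem HasJetAt.eventually_le {f : Fin Q → V} {A : Fin Q → E →L[ℝ] V} (h : HasJetAt u x f A)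
    {c : ℝ} (hc : 0 < c) :
    ∀ᶠ y in 𝓝 (0 : E), qdist (u (x + y)) (tuple fun i => f i + A i y) ≤ c * ‖y‖ := by
  have h1 := h.2.eventually (gt_mem_nhds hc)
  rw [eventually_nhdsWithin_iff] at h1
  filter_upwards [h1] with y hy
  rcases eq_or_ne y 0 with rfl | hy0
  · simp [h.1]
  · have := hy hy0
    rw [div_lt_iff₀ (norm_pos_iff.2 hy0)] at this
    exact this.le

/-- The average does not increase distances, and the average of the affine approximation is affine.
-/
theorem HasJetAt.hasFDerivAt_mean (hQ : 0 < Q) {f : Fin Q → V} {A : Fin Q → E →L[ℝ] V}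
    (h : HasJetAt u x f A) : HasFDerivAt (fun y => mean (u y)) (mean (tuple A)) x := by
  rw [hasFDerivAt_iff_isLittleO_nhds_zero, Asymptotics.isLittleO_iff]
  intro c hc
  filter_upwards [h.eventually_le hc] with y hy
  refine le_trans (le_of_eq ?_) ((norm_mean_sub_le hQ _ _).trans hy)
  congr 1
  rw [← h.1, mean_tuple, mean_tuple, mean_tuple, Finset.sum_add_distrib, smul_add, sub_sub]
  simp

theorem QDifferentiableAt.tendsto_qdist (h : QDifferentiableAt u x) :
    Tendsto (fun y => qdist (u y) (u x)) (𝓝 x) (𝓝 0) := by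
  obtain ⟨f, A, hj⟩ := h
  have h1 : Tendsto (fun y => qdist (u (x + y)) (u x)) (𝓝 0) (𝓝 0) := by
    have h2 : Tendsto (fun y : E => 1 * ‖y‖ + enumDist (fun i => f i + A i y) f) (𝓝 0)
        (𝓝 (1 * ‖(0 : E)‖ + enumDist (fun i => f i + A i 0) f)) := by
      unfold enumDist
      exact Continuous.tendsto (by fun_prop) 0
    have h3 : 1 * ‖(0 : E)‖ + enumDist (fun i => f i + A i 0) f = 0 := by simp [enumDist]
    rw [h3] at h2
    refine squeeze_zero' (Eventually.of_forall fun y => qdist_nonneg _ _) ?_ h2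
    filter_upwards [hj.eventually_le one_pos] with y hy
    refine (qdist_triangle _ (tuple fun i => f i + A i y) _).trans (add_le_add hy ?_)
    rw [← hj.1]
    exact qdist_tuple_le _ _
  have h4 : Tendsto (fun y => y - x) (𝓝 x) (𝓝 0) := by
    simpa using (continuous_sub_right x).tendsto x
  simpa [Function.comp_def] using h1.comp h4

/-- Whichever jet the choice in `qderiv` selects, its average is the derivative of the average. -/
theorem QDifferentiableAt.hasFDerivAt_mean (hQ : 0 < Q) (h : QDifferentiableAt u x) :
    HasFDerivAt (fun y => mean (u y)) (mean (qderiv u x)) x := by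
  have h' : ∃ f A, HasJetAt u x f A := h
  rw [qderiv, dif_pos h']
  exact h'.choose_spec.choose_spec.hasFDerivAt_mean hQ

theorem MemC1.contDiffOn_mean (hQ : 0 < Q) {U : Set E} (hU : IsOpen U) (h : MemC1 u U) :
    ContDiffOn ℝ 1 (fun y => mean (u y)) U := by
  have hd : ∀ y ∈ U, HasFDerivAt (fun y => mean (u y)) (mean (qderiv u y)) y := fun y hy =>
    (h.1 y hy).hasFDerivAt_mean hQ
  rw [show (1 : WithTop ℕ∞) = 0 + 1 by norm_num, contDiffOn_succ_iff_fderiv_of_isOpen hU]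
  refine ⟨fun y hy => (hd y hy).differentiableAt.differentiableWithinAt, by simp, ?_⟩
  rw [contDiffOn_zero]
  refine ContinuousOn.congr (f := fun y => mean (qderiv u y)) (fun y hy => ?_)
    fun y hy => (hd y hy).fderiv
  refine ContinuousAt.continuousWithinAt ?_
  rw [ContinuousAt, tendsto_iff_norm_sub_tendsto_zero]
  exact squeeze_zero (fun _ => norm_nonneg _) (fun z => norm_mean_sub_le hQ _ _) (h.2 y hy)

end Jets

/-! ### Harmonic sheets away from the branch set -/

section Good

variable {n k Q : ℕ} {u : Euc n → Sym (Euc k) Q} {U : Set (Euc n)}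

/-- The square of the symmetric part. -/
noncomputable def symSq (u : Euc n → Sym (Euc k) Q) (x : Euc n) : ℝ := qnorm (symPart (u x)) ^ 2

theorem continuousAt_qnorm {x : Euc n} (h : QDifferentiableAt u x) :
    ContinuousAt (fun y => qnorm (u y)) x := by
  rw [ContinuousAt, tendsto_iff_norm_sub_tendsto_zero]
  exact squeeze_zero (fun _ => norm_nonneg _) (fun y => abs_qnorm_sub_le _ _) h.tendsto_qdist

/-- By Pythagoras with c = 0 this is |u|² - Q |u_a|², a difference of continuous functions. -/
theorem continuousOn_symSq (hQ : 0 < Q) (hU : IsOpen U) (h : MemC1 u U) :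
    ContinuousOn (symSq u) U := by
  have h1 : ∀ y, symSq u y = qnorm (u y) ^ 2 - Q * ‖mean (u y)‖ ^ 2 := fun y => by
    have := qnorm_shift_sq hQ (u y) 0
    rw [shift_zero, sub_zero] at this
    rw [symSq]; linarith
  refine ContinuousOn.congr ?_ fun y _ => h1 y
  have h2 : ContinuousOn (fun y => qnorm (u y)) U := fun y hy =>
    (continuousAt_qnorm (h.1 y hy)).continuousWithinAt
  exact (h2.pow 2).sub (continuousOn_const.mul ((h.contDiffOn_mean hQ hU).continuousOn.norm.pow 2))

theorem isOpen_diff_branchSet (u : Euc n → Sym (Euc k) Q) (U : Set (Euc n)) :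
    IsOpen (U \ branchSet u U) := by
  rw [Metric.isOpen_iff]
  rintro x ⟨hx, hxB⟩
  have : ∃ ρ > 0, ball x ρ ⊆ U ∧ ∃ f : Fin Q → Euc n → Euc k,
      (∀ i, ContDiffOn ℝ 1 (f i) (ball x ρ)) ∧ ∀ y ∈ ball x ρ, u y = tuple fun i => f i y := by
    by_contra h; exact hxB ⟨hx, h⟩
  obtain ⟨ρ, hρ, hsub, f, hf, huf⟩ := this
  refine ⟨ρ, hρ, fun y hy => ⟨hsub hy, fun hyB => hyB.2 ?_⟩⟩
  obtain ⟨δ, hδ, hδs⟩ := Metric.isOpen_iff.1 isOpen_ball y hy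
  exact ⟨δ, hδ, hδs.trans hsub, f, fun i => (hf i).mono hδs, fun z hz => huf z (hδs hz)⟩

theorem harmonicAt_sum {ι : Type*} (s : Finset ι) {f : ι → Euc n → Euc k} {x : Euc n}
    (h : ∀ i, InnerProductSpace.HarmonicAt (f i) x) :
    InnerProductSpace.HarmonicAt (∑ i ∈ s, f i) x := by
  classical
  induction s using Finset.induction_on with
  | empty => simpa using! InnerProductSpace.harmonicAt_const (0 : Euc k)
  | insert i s hi ih => rw [Finset.sum_insert hi]; exact (h i).add ih

theorem harmonicAt_component {f : Euc n → Euc k} {x : Euc n}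
    (h : InnerProductSpace.HarmonicAt f x) (l : Fin k) :
    ContDiffAt ℝ 2 (fun y => f y l) x ∧ lap (fun y => f y l) x = 0 := by
  have h1 := h.comp_CLM (EuclideanSpace.proj l : Euc k →L[ℝ] ℝ)
  have h2 : ContDiffAt ℝ 2 (fun y => f y l) x := h1.1
  exact ⟨h2, (lap_eq_laplacian h2).trans h1.2.eq_of_nhds⟩

/-- Away from the branch set, the average and the symmetric part are given by harmonic
functions. -/
theorem IsHarmonic.exists_decomposition (h : IsHarmonic u U) {x : Euc n}
    (hx : x ∈ U \ branchSet u U) : ∃ ρ > 0, ball x ρ ⊆ U ∧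
      (∀ y ∈ ball x ρ, InnerProductSpace.HarmonicAt (fun y => mean (u y)) y) ∧
      ∃ F : Fin Q → Euc n → Euc k, (∀ i, InnerProductSpace.HarmonicOnNhd (F i) (ball x ρ)) ∧
        ∀ y ∈ ball x ρ, symPart (u y) = tuple fun i => F i y := by
  obtain ⟨ρ, hρ, hsub, f, hf, huf⟩ := h.2 x hx
  have hm : ∀ y ∈ ball x ρ,
      InnerProductSpace.HarmonicAt ((Q : ℝ)⁻¹ • ∑ i, f i) y := fun y hy =>
    (harmonicAt_sum _ fun i => hf i y hy).const_smul
  have hmu : ∀ y ∈ ball x ρ, mean (u y) = ((Q : ℝ)⁻¹ • ∑ i, f i) y := fun y hy => by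
    rw [huf y hy, mean_tuple]; simp
  refine ⟨ρ, hρ, hsub, fun y hy => ?_, fun i => f i - (Q : ℝ)⁻¹ • ∑ i, f i,
    fun i y hy => (hf i y hy).sub (hm y hy), fun y hy => ?_⟩
  · refine (InnerProductSpace.harmonicAt_congr_nhds ?_).2 (hm y hy)
    filter_upwards [isOpen_ball.mem_nhds hy] with z hz using hmu z hz
  · rw [symPart, hmu y hy, huf y hy, shift_tuple]; rfl

theorem tuple_qnorm_sq_eq (f : Fin Q → Euc k) :
    qnorm (tuple f) ^ 2 = ∑ p : Fin Q × Fin k, f p.1 p.2 ^ 2 := by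
  rw [qnorm_tuple_sq, Fintype.sum_prod_type]
  exact Finset.sum_congr rfl fun i _ => EuclideanSpace.real_norm_sq_eq _

theorem HarmonicOnNhd_component_smooth {F : Euc n → Euc k} {x : Euc n} {ρ : ℝ} (hρ : 0 < ρ)
    (hF : InnerProductSpace.HarmonicOnNhd F (ball x ρ)) (l : Fin k) :
    ContDiffAt ℝ ∞ (fun y => F y l) x ∧ lap (fun y => F y l) =ᶠ[𝓝 x] 0 := by
  have h1 : ∀ y ∈ ball x ρ, ContDiffAt ℝ 2 (fun y => F y l) y ∧ lap (fun y => F y l) y = 0 :=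
    fun y hy => harmonicAt_component (hF y hy) l
  refine ⟨contDiffAt_of_lap_eq_zero hρ (fun y hy => (h1 y hy).1.contDiffWithinAt)
    fun y hy => (h1 y hy).2, ?_⟩
  filter_upwards [ball_mem_nhds x hρ] with y hy using (h1 y hy).2

theorem IsHarmonic.isHarmonicSumSqAt (h : IsHarmonic u U) {x : Euc n}
    (hx : x ∈ U \ branchSet u U) : IsHarmonicSumSqAt (symSq u) x := by
  obtain ⟨ρ, hρ, -, -, F, hF, huF⟩ := h.exists_decomposition hx
  refine ⟨Fin Q × Fin k, inferInstance, fun p y => F p.1 y p.2,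
    fun p => HarmonicOnNhd_component_smooth hρ (hF p.1) p.2, ?_⟩
  filter_upwards [ball_mem_nhds x hρ] with y hy
  rw [symSq, huF y hy, tuple_qnorm_sq_eq]

/-- The slope of the symmetric part along a segment, away from the branch set. -/
theorem IsHarmonic.slope_symPart (h : IsHarmonic u U) {x v : Euc n} {t : ℝ}
    (hx : x + t • v ∈ U \ branchSet u U) {L : ℝ} (hL : 0 ≤ L)
    (hlap : lap (symSq u) (x + t • v) / 2 ≤ L ^ 2) :
    Tendsto (fun s : ℝ => qdist (symPart (u (x + s • v))) (symPart (u (x + t • v)))) (𝓝 t) (𝓝 0) ∧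
    ∀ r, L * ‖v‖ < r → ∀ᶠ s in 𝓝[>] t,
      qdist (symPart (u (x + t • v))) (symPart (u (x + s • v))) < r * (s - t) := by
  obtain ⟨ρ, hρ, -, -, F, hF, huF⟩ := h.exists_decomposition hx
  set y := x + t • v with hy
  have hcomp : ∀ p : Fin Q × Fin k, ContDiffAt ℝ ∞ (fun y => F p.1 y p.2) y ∧
      lap (fun y => F p.1 y p.2) =ᶠ[𝓝 y] 0 :=
    fun p => HarmonicOnNhd_component_smooth hρ (hF p.1) p.2
  have hsq : symSq u =ᶠ[𝓝 y] fun z => ∑ p : Fin Q × Fin k, F p.1 z p.2 ^ 2 := by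
    filter_upwards [ball_mem_nhds y hρ] with z hz
    rw [symSq, huF z hz, tuple_qnorm_sq_eq]
  have hlap' := (lap_eq_of_harmonicSumSq hcomp hsq).eq_of_nhds
  have hγ : HasDerivAt (fun s : ℝ => x + s • v) v t := by
    simpa using ((hasDerivAt_id t).smul_const v).const_add x
  have hnear : ∀ᶠ s in 𝓝 t, x + s • v ∈ ball y ρ :=
    hγ.continuousAt.tendsto.eventually (isOpen_ball.mem_nhds (mem_ball_self hρ))
  have hdist : ∀ a b : Euc n, enumDist (fun i => F i a) (fun i => F i b) =
      Real.sqrt (∑ p : Fin Q × Fin k, (F p.1 a p.2 - F p.1 b p.2) ^ 2) := fun a b => by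
    rw [enumDist, Fintype.sum_prod_type]
    congr 1
    refine Finset.sum_congr rfl fun i _ => ?_
    rw [EuclideanSpace.real_norm_sq_eq]; rfl
  have hF' : ∀ p : Fin Q × Fin k, HasDerivAt (fun s : ℝ => F p.1 (x + s • v) p.2)
      (fderiv ℝ (fun y => F p.1 y p.2) y v) t := fun p =>
    HasFDerivAt.comp_hasDerivAt (l := fun y => F p.1 y p.2) t
      (((hcomp p).1.differentiableAt (by simp)).hasFDerivAt) hγ
  constructor
  · have h1 : Tendsto (fun s : ℝ => Real.sqrt (∑ p : Fin Q × Fin k,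
        (F p.1 (x + s • v) p.2 - F p.1 y p.2) ^ 2)) (𝓝 t)
        (𝓝 (Real.sqrt (∑ p : Fin Q × Fin k, (F p.1 y p.2 - F p.1 y p.2) ^ 2))) :=
      (tendsto_finsetSum _ fun p _ =>
        (((hF' p).continuousAt.tendsto).sub tendsto_const_nhds).pow 2).sqrt
    simp only [sub_self, ne_eq, OfNat.ofNat_ne_zero, not_false_eq_true, zero_pow,
      Finset.sum_const_zero, Real.sqrt_zero] at h1
    refine squeeze_zero' (Eventually.of_forall fun s => qdist_nonneg _ _) ?_ h1
    filter_upwards [hnear] with s hs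
    rw [huF _ hs, huF y (mem_ball_self hρ), ← hdist]
    exact qdist_tuple_le _ _
  · intro r hr
    -- Half the Laplacian of |u_s|² is the sum of the squared gradients of the components, so
    -- Cauchy–Schwarz bounds the directional derivatives by L |v|.
    have hbound : Real.sqrt (∑ p : Fin Q × Fin k, (fderiv ℝ (fun y => F p.1 y p.2) y v) ^ 2) ≤
        L * ‖v‖ := by
      refine Real.sqrt_le_iff.2 ⟨by positivity, ?_⟩
      have h1 : ∀ p : Fin Q × Fin k, (fderiv ℝ (fun y => F p.1 y p.2) y v) ^ 2 ≤
          ‖v‖ ^ 2 * ∑ j, partialDeriv j (fun y => F p.1 y p.2) y ^ 2 := fun p => by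
        rw [fderiv_apply_eq_sum, EuclideanSpace.real_norm_sq_eq]
        exact Finset.sum_mul_sq_le_sq_mul_sq _ _ _
      refine (Finset.sum_le_sum fun p _ => h1 p).trans ?_
      rw [← Finset.mul_sum, mul_pow, mul_comm]
      gcongr
      linarith
    have h2 : Tendsto (fun s : ℝ => Real.sqrt (∑ p : Fin Q × Fin k,
        (slope (fun s : ℝ => F p.1 (x + s • v) p.2) t s) ^ 2)) (𝓝[>] t)
        (𝓝 (Real.sqrt (∑ p : Fin Q × Fin k, (fderiv ℝ (fun y => F p.1 y p.2) y v) ^ 2))) :=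
      (tendsto_finsetSum _ fun p _ => ((hasDerivAt_iff_tendsto_slope.1 (hF' p)).mono_left
        (nhdsWithin_mono _ fun s hs => ne_of_gt hs)).pow 2).sqrt
    filter_upwards [h2.eventually (gt_mem_nhds (hbound.trans_lt hr)), self_mem_nhdsWithin,
      nhdsWithin_le_nhds hnear] with s hs hst hsn
    have hst' : 0 < s - t := sub_pos.2 hst
    rw [qdist_comm, huF _ hsn, huF y (mem_ball_self hρ)]
    refine (qdist_tuple_le _ _).trans_lt ?_
    rw [hdist, ← div_lt_iff₀ hst']
    convert hs using 1
    rw [← Real.sqrt_sq hst'.le, ← Real.sqrt_div (by positivity), Finset.sum_div]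
    congr 1
    refine Finset.sum_congr rfl fun p _ => ?_
    rw [slope_def_field, div_pow]

end Good

/-- The mean value inequality applied to the real function t ↦ 𝒢(S 0, S t), whose right slopes are
bounded through the triangle inequality. No consistent choice of sheets along the curve is needed.
-/
theorem qdist_le_of_slope {V : Type*} [NormedAddCommGroup V] {Q : ℕ} {S : ℝ → Sym V Q} {L : ℝ}
    (hc : ∀ t ∈ Icc (0 : ℝ) 1, Tendsto (fun s => qdist (S s) (S t)) (𝓝 t) (𝓝 0))
    (hs : ∀ t ∈ Icc (0 : ℝ) 1, ∀ r, L < r → ∀ᶠ s in 𝓝[>] t, qdist (S t) (S s) < r * (s - t)) :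
    qdist (S 0) (S 1) ≤ L := by
  have h := image_le_of_liminf_slope_right_le_deriv_boundary (f := fun t => qdist (S 0) (S t))
    (B := fun t => L * t) (B' := fun _ => L) (a := 0) (b := 1)
    (fun t ht => ContinuousAt.continuousWithinAt ?_) (by simp) (by fun_prop)
    (fun t _ => by simpa using ((hasDerivAt_id t).const_mul L).hasDerivWithinAt)
    (fun t ht r hr => ?_) (right_mem_Icc.2 zero_le_one)
  · simpa using h
  · rw [ContinuousAt, tendsto_iff_norm_sub_tendsto_zero]
    refine squeeze_zero (fun _ => norm_nonneg _) (fun s => ?_) (hc t ht)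
    rw [Real.norm_eq_abs, abs_le]
    have h1 := qdist_triangle (S 0) (S s) (S t)
    have h2 := qdist_triangle (S 0) (S t) (S s)
    rw [qdist_comm (S t)] at h2
    constructor <;> linarith
  · refine Eventually.frequently ?_
    filter_upwards [hs t (Ico_subset_Icc_self ht) r hr, self_mem_nhdsWithin] with s h1 hst
    have hst' : 0 < s - t := sub_pos.2 hst
    rw [slope_def_field, div_lt_iff₀ hst']
    linarith [qdist_triangle (S 0) (S t) (S s)]

end MultiValued

namespace MultiValued

/-! ### Interior estimates for good harmonic functions -/

section Interior

variable {n k Q : ℕ} {u : Euc n → Sym (Euc k) Q} {U : Set (Euc n)}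

theorem symSq_nonneg (u : Euc n → Sym (Euc k) Q) (x : Euc n) : 0 ≤ symSq u x := sq_nonneg _

/-- As σ ≤ ρ, the exponent 2(1 + 1/Q) may be lowered to 2, which removes `Q` from the estimate; the
normalising powers of the radii supply the remaining n. -/
theorem IsGoodHarmonic.decay_sq (h : IsGoodHarmonic u U) {b : Euc n} (hb : b ∈ branchSet u U)
    {σ ρ I : ℝ} (hσ : 0 < σ) (hσρ : σ ≤ ρ) (hball : closedBall b ρ ⊆ U)
    (hI : ∫⁻ z in ball b ρ, ENNReal.ofReal (symSq u z) ≤ ENNReal.ofReal I) :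
    ∫⁻ z in ball b σ, ENNReal.ofReal (symSq u z) ≤ ENNReal.ofReal ((σ / ρ) ^ (n + 2) * I) := by
  have hρ : 0 < ρ := hσ.trans_le hσρ
  have h1 := h.decay b hb σ ρ hσ hσρ hball
  have h2 : (σ / ρ) ^ (2 * (1 + 1 / (Q : ℝ))) ≤ (σ / ρ) ^ 2 := by
    rw [← Real.rpow_natCast]
    refine Real.rpow_le_rpow_of_exponent_ge (by positivity) (by rwa [div_le_one hρ]) ?_
    have : 0 ≤ 1 / (Q : ℝ) := by positivity
    push_cast; linarith
  calc ∫⁻ z in ball b σ, ENNReal.ofReal (symSq u z)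
      = ENNReal.ofReal (σ ^ n) * (ENNReal.ofReal (σ⁻¹ ^ n) *
          ∫⁻ z in ball b σ, ENNReal.ofReal (symSq u z)) := by
        rw [← mul_assoc, ← ENNReal.ofReal_mul (by positivity), inv_pow,
          mul_inv_cancel₀ (by positivity), ENNReal.ofReal_one, one_mul]
    _ ≤ ENNReal.ofReal (σ ^ n) * (ENNReal.ofReal ((σ / ρ) ^ 2) *
          (ENNReal.ofReal (ρ⁻¹ ^ n) * ENNReal.ofReal I)) :=
        mul_le_mul' le_rfl (h1.trans (mul_le_mul' (ENNReal.ofReal_le_ofReal h2)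
          (mul_le_mul' le_rfl hI)))
    _ = ENNReal.ofReal ((σ / ρ) ^ (n + 2) * I) := by
        rw [← ENNReal.ofReal_mul (by positivity), ← ENNReal.ofReal_mul (by positivity),
          ← ENNReal.ofReal_mul (by positivity)]
        congr 1
        rw [pow_add, div_pow σ ρ n, inv_pow]
        field_simp

/-- The harmonic estimates are applied on a branch-free ball about `y`, at worst of radius r equal
to the distance to the branch set. Decay bounds the integral there by a multiple of (r/d)^(n+2) I.
So dividing by r^(n+2) costs nothing, and dividing by r^n leaves a factor r², at most |y - b|² for
every branch point b. -/
theorem exists_symSq_estimate (n : ℕ) : ∃ C : ℝ, 0 < C ∧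
    ∀ {k Q : ℕ} {u : Euc n → Sym (Euc k) Q} {U : Set (Euc n)}, IsGoodHarmonic u U →
      ∀ (x : Euc n) (d I : ℝ), 0 < d → 0 ≤ I → ball x d ⊆ U →
      ∫⁻ z in ball x d, ENNReal.ofReal (symSq u z) ≤ ENNReal.ofReal I →
      ∀ y ∈ ball x (d / 4), y ∉ branchSet u U →
        symSq u y ≤ C * I / d ^ n ∧
        lap (symSq u) y / 2 ≤ C * I / d ^ (n + 2) ∧
        ∀ b ∈ branchSet u U, symSq u y ≤ C * ‖y - b‖ ^ 2 * I / d ^ (n + 2) := by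
  obtain ⟨C, hC, H⟩ := exists_harmonicSumSq_estimate n
  refine ⟨C * 12 ^ (n + 2), by positivity, fun {k Q u U} h x d I hd hI0 hsub hI y hy hyB => ?_⟩
  set B := branchSet u U with hB
  have hyd : dist y x < d / 4 := hy
  have hyU : y ∈ U := hsub (mem_ball.2 (by linarith))
  have hopen : IsOpen (U \ B) := isOpen_diff_branchSet u U
  obtain ⟨r, hr, hrd, hrB, hrI⟩ : ∃ r : ℝ, 0 < r ∧ r ≤ d / 4 ∧ (∀ z ∈ ball y r, z ∉ B) ∧
      ∫⁻ z in ball y r, ENNReal.ofReal (symSq u z) ≤ ENNReal.ofReal ((12 * r / d) ^ (n + 2) * I) := by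
    -- If r is comparable to d, the factor (12 r/d)^(n+2) is at least 1 and monotonicity of the
    -- integral suffices.
    have hbig : ∀ r : ℝ, 0 < r → r ≤ d / 4 → d ≤ 12 * r →
        ∫⁻ z in ball y r, ENNReal.ofReal (symSq u z) ≤
          ENNReal.ofReal ((12 * r / d) ^ (n + 2) * I) := fun r hr hrd hdr => by
      refine (lintegral_mono_set (ball_subset_ball' (by linarith))).trans (hI.trans ?_)
      refine ENNReal.ofReal_le_ofReal (le_mul_of_one_le_left hI0 (one_le_pow₀ ?_))
      rwa [one_le_div hd]
    by_cases hcase : ∀ z ∈ ball y (d / 4), z ∉ B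
    · exact ⟨d / 4, by positivity, le_rfl, hcase, hbig _ (by positivity) le_rfl (by linarith)⟩
    · push Not at hcase
      obtain ⟨b₀, hb₀, hb₀B⟩ := hcase
      have hne : B.Nonempty := ⟨b₀, hb₀B⟩
      obtain ⟨δ, hδ, hδs⟩ := Metric.isOpen_iff.1 hopen y ⟨hyU, hyB⟩
      have hr0 : 0 < infDist y B := by
        refine hδ.trans_le ((le_infDist hne).2 fun b hb => ?_)
        by_contra hlt
        exact (hδs (mem_ball'.2 (not_le.1 hlt))).2 hb
      have hr4 : infDist y B < d / 4 := (infDist_le_dist_of_mem hb₀B).trans_lt (mem_ball'.1 hb₀)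
      refine ⟨infDist y B, hr0, hr4.le, fun z hz hzB => ?_, ?_⟩
      · exact absurd (infDist_le_dist_of_mem hzB) (not_le.2 (mem_ball'.1 hz))
      · set r := infDist y B with hr
        rcases le_total d (12 * r) with hdr | hdr
        · exact hbig r hr0 hr4.le hdr
        -- The distance need not be attained, so take a branch point within 2r. The ball of radius r
        -- about `y` lies in that of radius 3r about b, and decay from radius d/4 to 3r gives the
        -- ratio 12 r/d.
        · obtain ⟨b, hbB, hyb⟩ := (infDist_lt_iff hne (r := min (2 * r) (d / 4))).1
            (lt_min (by linarith) hr4)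
          have hyb1 : dist y b < 2 * r := hyb.trans_le (min_le_left _ _)
          have hyb2 : dist y b < d / 4 := hyb.trans_le (min_le_right _ _)
          have hbx : dist b x < d / 2 := by
            linarith [dist_triangle b y x, dist_comm b y]
          have hsub' : closedBall b (d / 4) ⊆ ball x d := fun z hz => by
            rw [mem_closedBall] at hz
            rw [mem_ball]; linarith [dist_triangle z b x]
          have h1 := h.decay_sq hbB (σ := 3 * r) (ρ := d / 4) (I := I) (by positivity)
            (by linarith) (hsub'.trans hsub)
            ((lintegral_mono_set (ball_subset_closedBall.trans hsub')).trans hI)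
          refine (lintegral_mono_set (ball_subset_ball' (by linarith))).trans (h1.trans_eq ?_)
          congr 3
          field_simp; norm_num
  have hsubr : ball y r ⊆ U := fun z hz => hsub (by
    rw [mem_ball] at hz ⊢; linarith [dist_triangle z y x])
  obtain ⟨h1, h2⟩ := H (symSq u) y r ((12 * r / d) ^ (n + 2) * I) hr (by positivity)
    (fun z hz => h.harmonic.isHarmonicSumSqAt ⟨hsubr hz, hrB z hz⟩) hrI
  have h1' : symSq u y ≤ C * 12 ^ (n + 2) * r ^ 2 * I / d ^ (n + 2) := by
    refine h1.trans_eq ?_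
    rw [div_pow, mul_pow, pow_add r]
    field_simp
  refine ⟨h1'.trans ?_, h2.trans_eq ?_, fun b hb => h1'.trans ?_⟩
  · rw [pow_add d, div_le_div_iff₀ (by positivity) (by positivity)]
    have : r ^ 2 ≤ d ^ 2 := by gcongr; linarith
    calc C * 12 ^ (n + 2) * r ^ 2 * I * d ^ n ≤ C * 12 ^ (n + 2) * d ^ 2 * I * d ^ n := by gcongr
      _ = _ := by ring
  · rw [div_pow, mul_pow]
    field_simp
  · have : r ≤ ‖y - b‖ := by
      rw [← dist_eq_norm]
      by_contra hlt
      exact hrB b (mem_ball'.2 (not_le.1 hlt)) hb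
    gcongr

theorem measureReal_ball_pos (n : ℕ) : 0 < volume.real (ball (0 : Euc n) 1) :=
  ENNReal.toReal_pos (measure_ball_pos _ _ one_pos).ne' measure_ball_lt_top.ne

theorem volume_ball_eq (x : Euc n) {r : ℝ} (hr : 0 < r) :
    volume (ball x r) = ENNReal.ofReal (volume.real (ball (0 : Euc n) 1) * r ^ n) := by
  rw [Measure.addHaar_ball_of_pos _ _ hr, ENNReal.ofReal_mul measureReal_nonneg, mul_comm,
    ofReal_measureReal (measure_ball_lt_top.ne)]
  simp

/-- The symmetric part vanishes on the branch set. -/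
theorem IsGoodHarmonic.symSq_eq_zero (h : IsGoodHarmonic u U) (hQ : 0 < Q) (hU : IsOpen U)
    {y : Euc n} (hy : y ∈ branchSet u U) {ρ I : ℝ} (hρ : 0 < ρ) (hball : closedBall y ρ ⊆ U)
    (hI : ∫⁻ z in ball y ρ, ENNReal.ofReal (symSq u z) ≤ ENNReal.ofReal I) (hI0 : 0 ≤ I) :
    symSq u y = 0 := by
  by_contra hne
  have hpos : 0 < symSq u y := lt_of_le_of_ne (symSq_nonneg u y) (Ne.symm hne)
  set c := volume.real (ball (0 : Euc n) 1)
  have hc : 0 < c := measureReal_ball_pos n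
  have hcont : ContinuousAt (symSq u) y :=
    (continuousOn_symSq hQ hU h.harmonic.1).continuousAt (hU.mem_nhds (hball
      (mem_closedBall_self hρ.le)))
  obtain ⟨δ, hδ, hδs⟩ := Metric.eventually_nhds_iff_ball.1
    (hcont.eventually (lt_mem_nhds (half_lt_self hpos)))
  -- A positive value at `y` would make the integral over a small ball at least of order σ^n, while
  -- decay makes it at most of order σ^(n+2).
  have key : ∀ᶠ σ : ℝ in 𝓝[>] 0, symSq u y / 2 * c ≤ σ ^ 2 * (I / ρ ^ (n + 2)) := by
    filter_upwards [self_mem_nhdsWithin, nhdsWithin_le_nhds (gt_mem_nhds hδ),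
      nhdsWithin_le_nhds (gt_mem_nhds hρ)] with σ hσ0 hσδ hσρ
    have hσ : 0 < σ := hσ0
    have h1 := h.decay_sq hy hσ hσρ.le hball hI
    have h2 : ENNReal.ofReal (symSq u y / 2 * (c * σ ^ n)) ≤
        ∫⁻ z in ball y σ, ENNReal.ofReal (symSq u z) := by
      rw [ENNReal.ofReal_mul (by positivity), ← volume_ball_eq y hσ, ← setLIntegral_const]
      refine setLIntegral_mono' measurableSet_ball fun z hz => ENNReal.ofReal_le_ofReal ?_
      exact (hδs z (ball_subset_ball hσδ.le hz)).le
    have h3 := (ENNReal.ofReal_le_ofReal_iff (by positivity)).1 (h2.trans h1)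
    rw [div_pow, pow_add σ, ← mul_assoc] at h3
    have h4 : 0 < σ ^ n := by positivity
    refine le_of_mul_le_mul_right (h3.trans_eq ?_) h4
    ring
  have hlim : Tendsto (fun σ : ℝ => σ ^ 2 * (I / ρ ^ (n + 2))) (𝓝[>] 0)
      (𝓝 ((0 : ℝ) ^ 2 * (I / ρ ^ (n + 2)))) :=
    (Continuous.tendsto (by fun_prop) 0).mono_left nhdsWithin_le_nhds
  have := ge_of_tendsto hlim key
  rw [zero_pow two_ne_zero, zero_mul] at this
  exact absurd this (not_le.2 (by positivity))

/-- On a segment avoiding the branch set the slope of u_s is bounded. On a segment through a branch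
point b, both endpoints are within |x - y| of b, so |u_s| is at most a multiple of |x - y| at each
of them. -/
theorem exists_symPart_lipschitz (n : ℕ) : ∃ C : ℝ, 0 < C ∧
    ∀ {k Q : ℕ} {u : Euc n → Sym (Euc k) Q} {U : Set (Euc n)}, 0 < Q → IsOpen U →
      IsGoodHarmonic u U →
      ∀ (x : Euc n) (d I : ℝ), 0 < d → 0 ≤ I → ball x d ⊆ U →
      ∫⁻ z in ball x d, ENNReal.ofReal (symSq u z) ≤ ENNReal.ofReal I →
      symSq u x ≤ C * I / d ^ n ∧ ∀ y ∈ ball x (d / 4),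
        qdist (symPart (u x)) (symPart (u y)) ^ 2 ≤ C * ‖x - y‖ ^ 2 * I / d ^ (n + 2) := by
  obtain ⟨C, hC, H⟩ := exists_symSq_estimate n
  refine ⟨4 * C, by positivity, fun {k Q u U} hQ hU h x d I hd hI0 hsub hI => ?_⟩
  have H' := H h x d I hd hI0 hsub hI
  have hzero : ∀ y ∈ ball x (d / 4), y ∈ branchSet u U → symSq u y = 0 := fun y hy hyB => by
    rw [mem_ball] at hy
    have hs : closedBall y (d / 4) ⊆ ball x d := closedBall_subset_ball' (by linarith)
    exact h.symSq_eq_zero hQ hU hyB (by positivity) (hs.trans hsub)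
      ((lintegral_mono_set (ball_subset_closedBall.trans hs)).trans hI) hI0
  have hx : x ∈ ball x (d / 4) := mem_ball_self (by positivity)
  refine ⟨?_, fun y hy => ?_⟩
  · by_cases hxB : x ∈ branchSet u U
    · rw [hzero x hx hxB]; positivity
    · refine (H' x hx hxB).1.trans ?_
      gcongr; linarith
  have hseg : ∀ t ∈ Icc (0 : ℝ) 1, x + t • (y - x) ∈ ball x (d / 4) := fun t ht => by
    rw [mem_ball, dist_eq_norm, add_sub_cancel_left, norm_smul, Real.norm_of_nonneg ht.1]
    rw [mem_ball, dist_eq_norm] at hy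
    nlinarith [norm_nonneg (y - x), ht.2]
  by_cases hB : ∃ t ∈ Icc (0 : ℝ) 1, x + t • (y - x) ∈ branchSet u U
  · obtain ⟨t, ht, hb⟩ := hB
    set b := x + t • (y - x) with hbdef
    have hxb : ‖x - b‖ ≤ ‖x - y‖ := by
      rw [hbdef, sub_add_cancel_left, norm_neg, norm_smul, Real.norm_of_nonneg ht.1,
        norm_sub_rev y x]
      exact mul_le_of_le_one_left (norm_nonneg _) ht.2
    have hyb : ‖y - b‖ ≤ ‖x - y‖ := by
      have : y - b = (1 - t) • (y - x) := by rw [hbdef, sub_smul, one_smul]; abel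
      rw [this, norm_smul, Real.norm_of_nonneg (by linarith [ht.2]), norm_sub_rev y x]
      exact mul_le_of_le_one_left (norm_nonneg _) (by linarith [ht.1])
    have hg : ∀ z ∈ ball x (d / 4), ‖z - b‖ ≤ ‖x - y‖ →
        symSq u z ≤ C * ‖x - y‖ ^ 2 * I / d ^ (n + 2) := fun z hz hzb => by
      by_cases hzB : z ∈ branchSet u U
      · rw [hzero z hz hzB]; positivity
      · refine ((H' z hz hzB).2.2 b hb).trans ?_
        gcongr
    have h1 := hg x hx hxb
    have h2 := hg y hy hyb
    have h3 := qdist_le_shift_add_shift (symPart (u x)) (symPart (u y)) 0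
    rw [shift_zero, shift_zero] at h3
    simp only [symSq] at h1 h2
    have h4 : qdist (symPart (u x)) (symPart (u y)) ^ 2 ≤
        2 * qnorm (symPart (u x)) ^ 2 + 2 * qnorm (symPart (u y)) ^ 2 := by
      nlinarith [qdist_nonneg (symPart (u x)) (symPart (u y)),
        sq_nonneg (qnorm (symPart (u x)) - qnorm (symPart (u y)))]
    calc _ ≤ 4 * (C * ‖x - y‖ ^ 2 * I / d ^ (n + 2)) := by linarith
      _ = _ := by ring
  · push Not at hB
    set L := Real.sqrt (C * I / d ^ (n + 2)) with hL
    have hL2 : L ^ 2 = C * I / d ^ (n + 2) := Real.sq_sqrt (by positivity)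
    have hslope : ∀ t ∈ Icc (0 : ℝ) 1, _ := fun t ht =>
      h.harmonic.slope_symPart (x := x) (v := y - x) (t := t)
        ⟨hsub (ball_subset_ball (by linarith) (hseg t ht)), hB t ht⟩ (Real.sqrt_nonneg _)
        ((H' _ (hseg t ht) (hB t ht)).2.1.trans_eq hL2.symm)
    have h1 := qdist_le_of_slope (S := fun t => symPart (u (x + t • (y - x))))
      (L := L * ‖y - x‖) (fun t ht => (hslope t ht).1) fun t ht => (hslope t ht).2
    simp only [zero_smul, add_zero, one_smul, add_sub_cancel] at h1
    calc _ ≤ (L * ‖y - x‖) ^ 2 := pow_le_pow_left₀ (qdist_nonneg _ _) h1 2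
      _ = C * ‖x - y‖ ^ 2 * I / d ^ (n + 2) := by
        rw [mul_pow, hL2, norm_sub_rev]; ring
      _ ≤ _ := by gcongr; linarith

/-- Interior estimates for good harmonic functions, uniform in the number of values. -/
theorem exists_goodHarmonic_estimate (n k : ℕ) : ∃ C : ℝ, 0 < C ∧
    ∀ {Q : ℕ} {u : Euc n → Sym (Euc k) Q} {U : Set (Euc n)}, 0 < Q → IsOpen U →
      IsGoodHarmonic u U →
      ∀ (c : Euc k) (x : Euc n) (d I : ℝ), 0 < d → 0 ≤ I → ball x d ⊆ U →
      ∫⁻ z in ball x d, ENNReal.ofReal (qnorm (shift (u z) c) ^ 2) ≤ ENNReal.ofReal I →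
      qnorm (shift (u x) c) ^ 2 ≤ C * I / d ^ n ∧ ∀ y ∈ ball x (d / 4),
        qdist (u x) (u y) ^ 2 ≤ C * ‖x - y‖ ^ 2 * I / d ^ (n + 2) := by
  obtain ⟨C₁, hC₁, H₁⟩ := exists_symPart_lipschitz n
  obtain ⟨C₂, hC₂, H₂⟩ := exists_weaklyHarmonic_estimate n
  refine ⟨2 * C₁ + 2 * (k * C₂), by positivity, fun {Q u U} hQ hU h c x d I hd hI0 hsub hI => ?_⟩
  have hsplit : ∀ z, qnorm (shift (u z) c) ^ 2 = symSq u z + Q * ‖mean (u z) - c‖ ^ 2 := fun z =>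
    qnorm_shift_sq hQ (u z) c
  obtain ⟨h1, h2⟩ := H₁ hQ hU h x d I hd hI0 hsub ((lintegral_mono fun z =>
    ENNReal.ofReal_le_ofReal (by rw [hsplit]; exact le_add_of_nonneg_right (by positivity))).trans hI)
  have hcd : ContDiffOn ℝ 1 (fun y => mean (u y)) U := h.harmonic.1.contDiffOn_mean hQ hU
  -- The factor √Q makes ∑ w_l² equal to Q |u_a - c|², so the scalar estimate yields a constant
  -- depending on `k` but not on `Q`.
  set w : Fin k → Euc n → ℝ := fun l y => Real.sqrt Q * (mean (u y) l - c l) with hw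
  have hsum : ∀ y, Q * ‖mean (u y) - c‖ ^ 2 = ∑ l, w l y ^ 2 := fun y => by
    simp only [hw, mul_pow, Real.sq_sqrt (Nat.cast_nonneg Q)]
    rw [← Finset.mul_sum, EuclideanSpace.real_norm_sq_eq]; rfl
  have hsum' : ∀ y z, Q * ‖mean (u y) - mean (u z)‖ ^ 2 = ∑ l, (w l y - w l z) ^ 2 :=
    fun y z => by
    simp only [hw, ← mul_sub, mul_pow, Real.sq_sqrt (Nat.cast_nonneg Q), sub_sub_sub_cancel_right]
    rw [← Finset.mul_sum, EuclideanSpace.real_norm_sq_eq]; rfl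
  have hwI : ∀ l, ∫⁻ z in ball x d, ENNReal.ofReal (w l z ^ 2) ≤ ENNReal.ofReal I := fun l => by
    refine (lintegral_mono fun z => ENNReal.ofReal_le_ofReal ?_).trans hI
    rw [hsplit, hsum]
    have := Finset.single_le_sum (f := fun l => w l z ^ 2) (fun l _ => sq_nonneg _)
      (Finset.mem_univ l)
    linarith [symSq_nonneg u z]
  have hwcd : ∀ l, ContDiffOn ℝ 1 (w l) U := fun l => by
    have h3 : ContDiffOn ℝ 1 (fun y => mean (u y) l) U :=
      (EuclideanSpace.proj l : Euc k →L[ℝ] ℝ).contDiff.comp_contDiffOn hcd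
    exact contDiffOn_const.mul (h3.sub contDiffOn_const)
  have hwharm : ∀ l, ∀ y ∈ U \ branchSet u U, ContDiffAt ℝ 2 (w l) y ∧ lap (w l) y = 0 := by
    intro l y hy
    obtain ⟨ρ, hρ, -, hm, -⟩ := h.harmonic.exists_decomposition hy
    have h3 := ((hm y (mem_ball_self hρ)).sub (InnerProductSpace.harmonicAt_const c)).const_smul
      (c := Real.sqrt Q)
    exact harmonicAt_component h3 l
  have hest := fun l => H₂ (w l) x d I hd hI0 ((hwcd l).mono hsub)
    (fun φ hφ hc hs => weaklyHarmonic_of_removable hU (isOpen_diff_branchSet u U) h.dim_branch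
      (hwcd l) (fun y hy => (hwharm l y hy).1.contDiffWithinAt) (fun y hy => (hwharm l y hy).2)
      hφ hc (hs.trans hsub)) (hwI l)
  constructor
  · rw [hsplit, hsum]
    have h3 := Finset.sum_le_sum fun l (_ : l ∈ Finset.univ) => (hest l).1
    rw [Finset.sum_const, Finset.card_univ, Fintype.card_fin, nsmul_eq_mul] at h3
    have e1 : 0 ≤ C₁ * I / d ^ n := by positivity
    have e2 : 0 ≤ k * (C₂ * I / d ^ n) := by positivity
    calc _ ≤ 2 * (C₁ * I / d ^ n) + 2 * (k * (C₂ * I / d ^ n)) := by linarith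
      _ = _ := by ring
  · intro y hy
    have h3 := Finset.sum_le_sum fun l (_ : l ∈ Finset.univ) =>
      (hest l).2 y (ball_subset_ball (by linarith) hy)
    rw [Finset.sum_const, Finset.card_univ, Fintype.card_fin, nsmul_eq_mul, ← hsum'] at h3
    calc _ ≤ _ := qdist_sq_le_symPart_add_mean (u x) (u y)
      _ ≤ 2 * (C₁ * ‖x - y‖ ^ 2 * I / d ^ (n + 2)) +
          2 * (k * (C₂ * ‖x - y‖ ^ 2 * I / d ^ (n + 2))) := by
        gcongr
        exact h2 y hy
      _ = _ := by ring

end Interior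

end MultiValued

namespace MultiValued

/-! ### Decay at the boundary -/

section Boundary

variable {n k N : ℕ} {q : Fin N → ℕ}

/-- `|v - c|²` at the point `x`. -/
noncomputable def shiftSq (v : MultiMap n k q) (c : Fin N → Euc k) (x : Euc n) : ℝ :=
  ∑ i, qnorm (shift (v i x) (c i)) ^ 2

/-- `∑ i, q_i |c_i|²`. -/
noncomputable def weightSq (q : Fin N → ℕ) (c : Fin N → Euc k) : ℝ := ∑ i, q i * ‖c i‖ ^ 2

theorem shiftSq_nonneg (v : MultiMap n k q) (c : Fin N → Euc k) (x : Euc n) :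
    0 ≤ shiftSq v c x := Finset.sum_nonneg fun _ _ => sq_nonneg _

theorem weightSq_nonneg (c : Fin N → Euc k) : 0 ≤ weightSq q c :=
  Finset.sum_nonneg fun _ _ => by positivity

theorem shiftSq_zero (v : MultiMap n k q) (x : Euc n) :
    shiftSq v 0 x = ∑ i, qnorm (v i x) ^ 2 := by
  simp only [shiftSq, Pi.zero_apply, shift_zero]

/-- With the weight q_i, the term q_i |c_i - c'_i|² is the squared distance of two constant tuples,
so the triangle inequality applies with constants independent of `q`. -/
theorem weightSq_sub_le (v : MultiMap n k q) (c c' : Fin N → Euc k) (x : Euc n) :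
    weightSq q (c - c') ≤ 2 * shiftSq v c x + 2 * shiftSq v c' x := by
  simp only [weightSq, shiftSq, Finset.mul_sum]
  rw [← Finset.sum_add_distrib]
  refine Finset.sum_le_sum fun i _ => ?_
  rw [Pi.sub_apply, ← qdist_const_sq, qnorm_shift_eq, qnorm_shift_eq]
  have h := qdist_triangle (tuple fun _ => c i) (v i x) (tuple fun _ => c' i)
  rw [qdist_comm _ (v i x)] at h
  nlinarith [qdist_nonneg (tuple fun _ : Fin (q i) => c i) (tuple fun _ => c' i),
    sq_nonneg (qdist (v i x) (tuple fun _ => c i) - qdist (v i x) (tuple fun _ => c' i))]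

theorem shiftSq_le (v : MultiMap n k q) (c c' : Fin N → Euc k) (x : Euc n) :
    shiftSq v c x ≤ 2 * shiftSq v c' x + 2 * weightSq q (c - c') := by
  simp only [weightSq, shiftSq, Finset.mul_sum]
  rw [← Finset.sum_add_distrib]
  refine Finset.sum_le_sum fun i _ => ?_
  rw [Pi.sub_apply, ← qdist_const_sq, qnorm_shift_eq, qnorm_shift_eq]
  have h := qdist_triangle (v i x) (tuple fun _ => c' i) (tuple fun _ => c i)
  rw [qdist_comm (tuple fun _ => c' i)] at h
  nlinarith [qdist_nonneg (v i x) (tuple fun _ => c i), sq_nonneg (qdist (v i x)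
    (tuple fun _ => c' i) - qdist (tuple fun _ : Fin (q i) => c i) (tuple fun _ => c' i))]

theorem weightSq_le (c c' : Fin N → Euc k) :
    weightSq q (c - c') ≤ 2 * weightSq q c + 2 * weightSq q c' := by
  simp only [weightSq, Finset.mul_sum]
  rw [← Finset.sum_add_distrib]
  refine Finset.sum_le_sum fun i _ => ?_
  rw [Pi.sub_apply]
  have h := norm_sub_le (c i) (c' i)
  have h2 : ‖c i - c' i‖ ^ 2 ≤ 2 * ‖c i‖ ^ 2 + 2 * ‖c' i‖ ^ 2 := by
    nlinarith [norm_nonneg (c i - c' i), sq_nonneg (‖c i‖ - ‖c' i‖)]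
  calc (q i : ℝ) * ‖c i - c' i‖ ^ 2 ≤ q i * (2 * ‖c i‖ ^ 2 + 2 * ‖c' i‖ ^ 2) := by gcongr
    _ = _ := by ring

theorem weightSq_neg (c c' : Fin N → Euc k) :
    weightSq q (c - c') = weightSq q (c' - c) := by
  simp only [weightSq, Pi.sub_apply, norm_sub_rev]

theorem abs_coord_le (x : Euc n) (i : Fin n) : |x i| ≤ ‖x‖ := by
  have := PiLp.norm_apply_le x i
  rwa [Real.norm_eq_abs] at this

variable [NeZero n]

theorem aemeasurable_qnorm_shift {v : MultiMap n k q} (h : ∀ i, MemL2 (v i) (halfBall n))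
    {S : Set (Euc n)} (hS : S ⊆ halfBall n) (c : Fin N → Euc k) (i : Fin N) :
    AEMeasurable (fun x => ENNReal.ofReal (qnorm (shift (v i x) (c i)) ^ 2))
      (volume.restrict S) := by
  simp only [qnorm_shift_eq]
  exact (((h i).1 _).mono_set hS).pow_const 2 |>.ennreal_ofReal

theorem lintegral_shiftSq {v : MultiMap n k q} (h : ∀ i, MemL2 (v i) (halfBall n))
    {S : Set (Euc n)} (hS : S ⊆ halfBall n) (c : Fin N → Euc k) :
    ∫⁻ x in S, ENNReal.ofReal (shiftSq v c x) =
      ∑ i, ∫⁻ x in S, ENNReal.ofReal (qnorm (shift (v i x) (c i)) ^ 2) := by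
  rw [← lintegral_finsetSum' _ fun i _ => aemeasurable_qnorm_shift h hS c i]
  refine lintegral_congr fun x => ?_
  rw [shiftSq, ENNReal.ofReal_sum_of_nonneg fun _ _ => sq_nonneg _]

theorem aemeasurable_shiftSq {v : MultiMap n k q} (h : ∀ i, MemL2 (v i) (halfBall n))
    {S : Set (Euc n)} (hS : S ⊆ halfBall n) (c : Fin N → Euc k) :
    AEMeasurable (fun x => ENNReal.ofReal (shiftSq v c x)) (volume.restrict S) := by
  have : (fun x => ENNReal.ofReal (shiftSq v c x)) =
      fun x => ∑ i, ENNReal.ofReal (qnorm (shift (v i x) (c i)) ^ 2) := by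
    ext x
    rw [shiftSq, ENNReal.ofReal_sum_of_nonneg fun _ _ => sq_nonneg _]
  rw [this]
  exact Finset.aemeasurable_fun_sum _ fun i _ => aemeasurable_qnorm_shift h hS c i

/-- Comparison of two constants by means of the integrals over a ball. -/
theorem weightSq_mul_volume_le {v : MultiMap n k q} (h : ∀ i, MemL2 (v i) (halfBall n))
    {p : Euc n} {s : ℝ} (hs : 0 < s) (hS : ball p s ⊆ halfBall n) (c c' : Fin N → Euc k)
    {I I' : ℝ} (hI0 : 0 ≤ I) (hI0' : 0 ≤ I')
    (hI : ∫⁻ x in ball p s, ENNReal.ofReal (shiftSq v c x) ≤ ENNReal.ofReal I)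
    (hI' : ∫⁻ x in ball p s, ENNReal.ofReal (shiftSq v c' x) ≤ ENNReal.ofReal I') :
    weightSq q (c - c') * (volume.real (ball (0 : Euc n) 1) * s ^ n) ≤ 2 * I + 2 * I' := by
  have h0 := weightSq_nonneg (q := q) (c - c')
  rw [← ENNReal.ofReal_le_ofReal_iff (by positivity), ENNReal.ofReal_mul h0, ← volume_ball_eq p hs,
    ← setLIntegral_const]
  calc ∫⁻ x in ball p s, ENNReal.ofReal (weightSq q (c - c'))
      ≤ ∫⁻ x in ball p s, (2 * ENNReal.ofReal (shiftSq v c x) +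
          2 * ENNReal.ofReal (shiftSq v c' x)) := by
        refine lintegral_mono fun x => ?_
        refine (ENNReal.ofReal_le_ofReal (weightSq_sub_le v c c' x)).trans_eq ?_
        rw [ENNReal.ofReal_add (by linarith [shiftSq_nonneg v c x])
          (by linarith [shiftSq_nonneg v c' x]), ENNReal.ofReal_mul zero_le_two,
          ENNReal.ofReal_mul zero_le_two, ENNReal.ofReal_ofNat]
    _ = 2 * (∫⁻ x in ball p s, ENNReal.ofReal (shiftSq v c x)) +
          2 * ∫⁻ x in ball p s, ENNReal.ofReal (shiftSq v c' x) := by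
        rw [lintegral_add_left' ((aemeasurable_shiftSq h hS c).const_mul 2),
          lintegral_const_mul' _ _ ENNReal.ofNat_ne_top,
          lintegral_const_mul' _ _ ENNReal.ofNat_ne_top]
    _ ≤ 2 * ENNReal.ofReal I + 2 * ENNReal.ofReal I' := by gcongr
    _ = ENNReal.ofReal (2 * I + 2 * I') := by
        rw [ENNReal.ofReal_add (by linarith) (by linarith), ENNReal.ofReal_mul zero_le_two,
          ENNReal.ofReal_mul zero_le_two, ENNReal.ofReal_ofNat]

/-- The unit normal of `∂H` pointing into `H`. -/
noncomputable def normalVec (n : ℕ) [NeZero n] : Euc n := EuclideanSpace.single 0 1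

theorem normalVec_zero : normalVec n 0 = 1 := by simp [normalVec]

theorem norm_normalVec : ‖normalVec n‖ = 1 := by simp [normalVec]

/-- A half-ball contains a full ball of half its radius, on which constants are compared by their
integrals. -/
theorem ball_subset_half {z : Euc n} (hz : z ∈ bdry n) {s : ℝ} (hs : 0 < s) :
    ball (z + (s / 2) • normalVec n) (s / 2) ⊆ ball z s ∩ halfSpace n := by
  intro y hy
  rw [mem_ball, dist_eq_norm] at hy
  constructor
  · rw [mem_ball, dist_eq_norm]
    calc ‖y - z‖ = ‖(y - (z + (s / 2) • normalVec n)) + (s / 2) • normalVec n‖ := by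
          congr 1; abel
      _ ≤ ‖y - (z + (s / 2) • normalVec n)‖ + ‖(s / 2) • normalVec n‖ := norm_add_le _ _
      _ < s / 2 + s / 2 := by
          rw [norm_smul, norm_normalVec, Real.norm_of_nonneg (by positivity)]; linarith
      _ = s := by ring
  · have h1 := (abs_coord_le (y - (z + (s / 2) • normalVec n)) 0).trans_lt hy
    have hz0 : z 0 = 0 := hz
    simp only [PiLp.sub_apply, PiLp.add_apply, PiLp.smul_apply, smul_eq_mul, hz0, normalVec_zero,
      abs_lt] at h1
    change 0 < y 0
    linarith [h1.1]

theorem ball_inter_half_subset {z : Euc n} {s R : ℝ} (hR : ‖z‖ + s ≤ R) :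
    ball z s ∩ halfSpace n ⊆ ball 0 R ∩ halfSpace n := fun y hy => by
  refine ⟨?_, hy.2⟩
  have h1 := hy.1
  rw [mem_ball, dist_eq_norm] at h1
  rw [mem_ball, dist_zero_right]
  have h2 := norm_le_norm_add_norm_sub' y z
  linarith

theorem ball_inter_halfBall {z : Euc n} {s : ℝ} (hs : ‖z‖ + s ≤ 1) :
    ball z s ∩ halfBall n = ball z s ∩ halfSpace n := by
  refine Subset.antisymm (fun y hy => ⟨hy.1, hy.2.2⟩) fun y hy => ⟨hy.1, ?_⟩
  exact ball_inter_half_subset hs hy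

/-- Decay of `v` towards its boundary values. -/
theorem exists_boundary_decay (n : ℕ) [NeZero n] {C₁ : ℝ} (hC₁ : 0 < C₁) : ∃ K : ℝ, 0 < K ∧
    ∀ {k N : ℕ} {q : Fin N → ℕ} {𝔅 : Set (MultiMap n k q)}, IsBlowUpClass C₁ 𝔅 → ∀ v ∈ 𝔅,
      ∀ M : ℝ, 0 ≤ M → sqInt v (ball 0 (1 / 2) ∩ halfSpace n) = ENNReal.ofReal M →
      ∃ κ : Euc n → Fin N → Euc k, ∀ z ∈ bdry n, ‖z‖ ≤ 1 / 4 →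
        weightSq q (κ z) ≤ K * M ∧ ∀ σ : ℝ, 0 < σ → σ ≤ 1 / 4 →
          ∫⁻ x in ball z σ ∩ halfSpace n, ENNReal.ofReal (shiftSq v (κ z) x) ≤
            ENNReal.ofReal (K * σ ^ (n + 1) * M) := by
  set c := volume.real (ball (0 : Euc n) 1) with hcdef
  have hc : 0 < c := measureReal_ball_pos n
  -- Small enough that 32 · 2^n · C₁ · s ≤ 1, as the absorption below requires.
  set s : ℝ := min (1 / 8) (1 / (32 * 2 ^ n * C₁)) with hs
  have hs0 : 0 < s := by positivity
  have hs8 : s ≤ 1 / 8 := min_le_left _ _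
  have hsC : 32 * 2 ^ n * C₁ * s ≤ 1 := by
    have : s ≤ 1 / (32 * 2 ^ n * C₁) := min_le_right _ _
    rw [le_div_iff₀ (by positivity)] at this
    linarith
  set K₁ : ℝ := 2 * (4 * C₁ + 2) / (c * (s / 2) ^ n) with hK₁
  have hK₁0 : 0 < K₁ := by positivity
  set K₂ : ℝ := 2 + 2 * K₁ * c with hK₂
  have hK₂0 : 0 < K₂ := by positivity
  refine ⟨K₁ + K₂ * 8 ^ (n + 1) + C₁ * 4 ^ (n + 1) * K₂, by positivity,
    fun {k N q 𝔅} h𝔅 v hv M hM0 hM => ?_⟩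
  obtain ⟨κ, -, hκ, -⟩ := h𝔅.boundary v hv
  have hL2 : ∀ i, MemL2 (v i) (halfBall n) := fun i => (h𝔅.integrability v hv i).1
  refine ⟨κ, fun z hz hz4 => ?_⟩
  set a := weightSq q (κ z) with ha
  have ha0 : 0 ≤ a := weightSq_nonneg _
  have hzball : z ∈ ball 0 1 ∩ bdry n := ⟨by rw [mem_ball, dist_zero_right]; linarith, hz⟩
  have hsub : ∀ σ ≤ 1 / 4, ball z σ ∩ halfSpace n ⊆ ball 0 (1 / 2) ∩ halfSpace n := fun σ hσ =>
    ball_inter_half_subset (by linarith)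
  have hhalf : ball (0 : Euc n) (1 / 2) ∩ halfSpace n ⊆ halfBall n :=
    inter_subset_inter_left _ (ball_subset_ball (by norm_num))
  -- the integral over the largest ball
  have hmax : ∫⁻ x in ball z (1 / 4) ∩ halfSpace n, ENNReal.ofReal (shiftSq v (κ z) x) ≤
      ENNReal.ofReal (2 * M + 2 * a * (c * (1 / 4) ^ n)) := by
    calc ∫⁻ x in ball z (1 / 4) ∩ halfSpace n, ENNReal.ofReal (shiftSq v (κ z) x)
        ≤ ∫⁻ x in ball z (1 / 4) ∩ halfSpace n,
            (2 * ENNReal.ofReal (∑ i, qnorm (v i x) ^ 2) + ENNReal.ofReal (2 * a)) := by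
          refine lintegral_mono fun x => ?_
          have h1 := shiftSq_le v (κ z) 0 x
          rw [sub_zero, shiftSq_zero] at h1
          refine (ENNReal.ofReal_le_ofReal h1).trans_eq ?_
          rw [ENNReal.ofReal_add (by positivity) (by linarith), ENNReal.ofReal_mul zero_le_two,
            ENNReal.ofReal_ofNat]
      _ = 2 * (∫⁻ x in ball z (1 / 4) ∩ halfSpace n, ENNReal.ofReal (∑ i, qnorm (v i x) ^ 2)) +
            ENNReal.ofReal (2 * a) * volume (ball z (1 / 4) ∩ halfSpace n) := by
          rw [lintegral_add_right _ measurable_const,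
            lintegral_const_mul' _ _ ENNReal.ofNat_ne_top, setLIntegral_const]
      _ ≤ 2 * ENNReal.ofReal M + ENNReal.ofReal (2 * a) * volume (ball z (1 / 4)) := by
          gcongr
          · exact (lintegral_mono_set (hsub _ le_rfl)).trans hM.le
          · exact inter_subset_left
      _ = ENNReal.ofReal (2 * M + 2 * a * (c * (1 / 4) ^ n)) := by
          rw [volume_ball_eq z (by norm_num), ← ENNReal.ofReal_mul (by positivity),
            ENNReal.ofReal_add (by positivity) (by positivity), ENNReal.ofReal_mul zero_le_two,
            ENNReal.ofReal_ofNat]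
  -- decay from the weighted estimate
  have hdecay : ∀ (J : ℝ), ∫⁻ x in ball z (1 / 4) ∩ halfSpace n,
      ENNReal.ofReal (shiftSq v (κ z) x) ≤ ENNReal.ofReal J → ∀ σ : ℝ, 0 < σ → σ ≤ 1 / 8 →
      ∫⁻ x in ball z σ ∩ halfSpace n, ENNReal.ofReal (shiftSq v (κ z) x) ≤
        ENNReal.ofReal (C₁ * (4 * σ) ^ (n + 1) * J) := by
    intro J hJ σ hσ hσ8
    -- For |z| ≤ 1/4 the radius 1/4 is admissible, since 3/8 (1 - |z|) ≥ 9/32.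
    have h1 := hκ z hzball (1 / 4) (by norm_num) (by linarith)
    rw [ball_inter_halfBall (by linarith), ball_inter_halfBall (by linarith)] at h1
    have hp : (0 : ℝ) ≤ (n : ℝ) + 3 / 2 := by positivity
    have h2 : ∀ x ∈ ball z σ ∩ halfSpace n, ENNReal.ofReal (shiftSq v (κ z) x) ≤
        ENNReal.ofReal (σ ^ ((n : ℝ) + 3 / 2)) * ENNReal.ofReal (∑ i,
          qnorm (shift (v i x) (κ z i)) ^ 2 / ‖x - z‖ ^ ((n : ℝ) + 3 / 2)) := fun x hx => by
      rw [← ENNReal.ofReal_mul (by positivity), ← Finset.sum_div]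
      refine ENNReal.ofReal_le_ofReal ?_
      have hxz : 0 < ‖x - z‖ := by
        rw [norm_pos_iff, sub_ne_zero]
        rintro rfl
        have h3 : 0 < x 0 := hx.2
        have h4 : x 0 = 0 := hz
        linarith
      have hxσ : ‖x - z‖ ≤ σ := by
        have := hx.1
        rw [mem_ball, dist_eq_norm] at this
        exact this.le
      have h5 : ‖x - z‖ ^ ((n : ℝ) + 3 / 2) ≤ σ ^ ((n : ℝ) + 3 / 2) := by gcongr
      have h6 : 0 < ‖x - z‖ ^ ((n : ℝ) + 3 / 2) := by positivity
      rw [← mul_div_assoc, le_div_iff₀ h6, mul_comm]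
      exact mul_le_mul_of_nonneg_right h5 (shiftSq_nonneg v (κ z) x)
    -- Since 4σ ≤ 1, the exponent n + 3/2 may be lowered to the integer n + 1; the one power beyond
    -- n becomes the Hölder exponent 1/2.
    have hpow : σ ^ ((n : ℝ) + 3 / 2) * (C₁ * (1 / 4) ^ (-(n : ℝ) - 3 / 2)) ≤
        C₁ * (4 * σ) ^ (n + 1) := by
      have e1 : ((1 / 4 : ℝ)) ^ (-(n : ℝ) - 3 / 2) = 4 ^ ((n : ℝ) + 3 / 2) := by
        rw [one_div, Real.inv_rpow (by norm_num), ← Real.rpow_neg (by norm_num)]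
        congr 1; ring
      rw [e1]
      have e2 : σ ^ ((n : ℝ) + 3 / 2) * (C₁ * 4 ^ ((n : ℝ) + 3 / 2)) =
          C₁ * (4 * σ) ^ ((n : ℝ) + 3 / 2) := by
        rw [Real.mul_rpow (by norm_num) hσ.le]; ring
      rw [e2, ← Real.rpow_natCast]
      gcongr ?_ * ?_
      refine Real.rpow_le_rpow_of_exponent_ge (by positivity) (by linarith) ?_
      push_cast; linarith
    calc ∫⁻ x in ball z σ ∩ halfSpace n, ENNReal.ofReal (shiftSq v (κ z) x)
        ≤ ∫⁻ x in ball z σ ∩ halfSpace n, ENNReal.ofReal (σ ^ ((n : ℝ) + 3 / 2)) *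
            ENNReal.ofReal (∑ i, qnorm (shift (v i x) (κ z i)) ^ 2 /
              ‖x - z‖ ^ ((n : ℝ) + 3 / 2)) := by
          refine setLIntegral_mono' (measurableSet_ball.inter ?_) h2
          exact (isOpen_lt continuous_const (by fun_prop)).measurableSet
      _ = ENNReal.ofReal (σ ^ ((n : ℝ) + 3 / 2)) * ∫⁻ x in ball z σ ∩ halfSpace n,
            ENNReal.ofReal (∑ i, qnorm (shift (v i x) (κ z i)) ^ 2 /
              ‖x - z‖ ^ ((n : ℝ) + 3 / 2)) := lintegral_const_mul' _ _ ENNReal.ofReal_ne_top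
      _ ≤ ENNReal.ofReal (σ ^ ((n : ℝ) + 3 / 2)) *
            (ENNReal.ofReal (C₁ * (1 / 4) ^ (-(n : ℝ) - 3 / 2)) * ENNReal.ofReal J) := by
          refine mul_le_mul' le_rfl (le_trans ?_ (h1.trans (mul_le_mul' le_rfl hJ)))
          exact lintegral_mono_set (inter_subset_inter_left _ (ball_subset_ball (by linarith)))
      _ ≤ ENNReal.ofReal (C₁ * (4 * σ) ^ (n + 1)) * ENNReal.ofReal J := by
          rw [← mul_assoc, ← ENNReal.ofReal_mul (by positivity)]
          exact mul_le_mul' (ENNReal.ofReal_le_ofReal hpow) le_rfl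
      _ = _ := by rw [← ENNReal.ofReal_mul (by positivity)]
  -- the bound for the boundary value
  have haK : a ≤ K₁ * M := by
    have h1 := hdecay _ hmax s hs0 hs8
    have hb := ball_subset_half hz hs0
    -- Comparing κ(z) with 0 on a ball of radius s/2 gives `a` times s^n on the left, while the
    -- decay estimate contributes `a` times s^(n+1) on the right.
    have h2 := weightSq_mul_volume_le hL2 (p := z + (s / 2) • normalVec n) (s := s / 2)
      (by positivity) (hb.trans ((hsub s (by linarith)).trans hhalf)) (κ z) 0
      (I := C₁ * (4 * s) ^ (n + 1) * (2 * M + 2 * a * (c * (1 / 4) ^ n))) (I' := M)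
      (by positivity) hM0 ((lintegral_mono_set hb).trans h1) (by
        simp only [shiftSq_zero]
        exact (lintegral_mono_set (hb.trans (hsub s (by linarith)))).trans hM.le)
    rw [sub_zero, ← ha, ← hcdef] at h2
    have e1 : (4 * s) ^ (n + 1) ≤ 1 := pow_le_one₀ (by positivity) (by linarith)
    have e2 : C₁ * (4 * s) ^ (n + 1) * (2 * M + 2 * a * (c * (1 / 4) ^ n)) =
        2 * C₁ * M * (4 * s) ^ (n + 1) + 8 * C₁ * a * c * s ^ (n + 1) := by
      rw [mul_pow, pow_succ 4, div_pow, one_pow]; field_simp; ring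
    rw [e2] at h2
    have e3 : 2 * C₁ * M * (4 * s) ^ (n + 1) ≤ 2 * C₁ * M :=
      mul_le_of_le_one_right (by positivity) e1
    -- By the choice of s, the term containing `a` on the right is at most half the left-hand side
    -- and can be absorbed.
    have e4 : 16 * C₁ * a * c * s ^ (n + 1) ≤ a * (c * (s / 2) ^ n) / 2 := by
      have e5 : a * (c * (s / 2) ^ n) / 2 =
          (32 * 2 ^ n * C₁ * s) * (a * (c * (s / 2) ^ n) / 2) +
          (1 - 32 * 2 ^ n * C₁ * s) * (a * (c * (s / 2) ^ n) / 2) := by ring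
      have e6 : (32 * 2 ^ n * C₁ * s) * (a * (c * (s / 2) ^ n) / 2) =
          16 * C₁ * a * c * s ^ (n + 1) := by
        rw [div_pow]; field_simp; ring
      have e7 : 0 ≤ (1 - 32 * 2 ^ n * C₁ * s) * (a * (c * (s / 2) ^ n) / 2) :=
        mul_nonneg (by linarith) (by positivity)
      linarith
    have e8 : a * (c * (s / 2) ^ n) ≤ 2 * (4 * C₁ + 2) * M := by linarith
    rw [hK₁, div_mul_eq_mul_div, le_div_iff₀ (by positivity)]
    exact e8
  have hJ : 2 * M + 2 * a * (c * (1 / 4) ^ n) ≤ K₂ * M := by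
    have e1 : ((1 : ℝ) / 4) ^ n ≤ 1 := pow_le_one₀ (by norm_num) (by norm_num)
    have e2 : 2 * a * (c * (1 / 4) ^ n) ≤ 2 * (K₁ * M) * (c * 1) := by gcongr
    rw [hK₂]; linarith
  have hmax' := hmax.trans (ENNReal.ofReal_le_ofReal hJ)
  refine ⟨haK.trans ?_, fun σ hσ hσ4 => ?_⟩
  · gcongr
    have : 0 < K₂ * 8 ^ (n + 1) + C₁ * 4 ^ (n + 1) * K₂ := by positivity
    linarith
  · rcases le_total σ (1 / 8) with hσ8 | hσ8
    · refine (hdecay _ hmax' σ hσ hσ8).trans (ENNReal.ofReal_le_ofReal ?_)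
      calc C₁ * (4 * σ) ^ (n + 1) * (K₂ * M) = (C₁ * 4 ^ (n + 1) * K₂) * σ ^ (n + 1) * M := by
            rw [mul_pow]; ring
        _ ≤ _ := by
          gcongr
          have : 0 < K₁ + K₂ * 8 ^ (n + 1) := by positivity
          linarith
    · refine ((lintegral_mono_set (inter_subset_inter_left _ (ball_subset_ball hσ4))).trans
        hmax').trans (ENNReal.ofReal_le_ofReal ?_)
      have e1 : 1 ≤ (8 * σ) ^ (n + 1) := one_le_pow₀ (by linarith)
      calc K₂ * M ≤ K₂ * M * (8 * σ) ^ (n + 1) := le_mul_of_one_le_right (by positivity) e1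
        _ = (K₂ * 8 ^ (n + 1)) * σ ^ (n + 1) * M := by rw [mul_pow]; ring
        _ ≤ _ := by
          gcongr
          have : 0 < C₁ * 4 ^ (n + 1) * K₂ := by positivity
          linarith

end Boundary

end MultiValued

namespace MultiValued

/-! ### Hölder continuity up to the boundary -/

section Extension

variable {n k N : ℕ} {q : Fin N → ℕ}

/-- `𝒢(v(x), v(y))²` bounded through the constants `c` and `c'`. -/
theorem sum_qdist_sq_le (v : MultiMap n k q) (c c' : Fin N → Euc k) (x y : Euc n) :
    ∑ i, qdist (v i x) (v i y) ^ 2 ≤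
      3 * (shiftSq v c x + weightSq q (c - c') + shiftSq v c' y) := by
  simp only [weightSq, shiftSq]
  rw [← Finset.sum_add_distrib, ← Finset.sum_add_distrib, Finset.mul_sum]
  refine Finset.sum_le_sum fun i _ => ?_
  rw [Pi.sub_apply, ← qdist_const_sq, qnorm_shift_eq, qnorm_shift_eq]
  have h1 := qdist_triangle (v i x) (tuple fun _ => c i) (v i y)
  have h2 := qdist_triangle (tuple fun _ => c i) (tuple fun _ => c' i) (v i y)
  rw [qdist_comm (tuple fun _ => c' i) (v i y)] at h2
  have h0 := qdist_nonneg (v i x) (v i y)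
  set a := qdist (v i x) (tuple fun _ => c i)
  set b := qdist (tuple fun _ : Fin (q i) => c i) (tuple fun _ => c' i)
  set e := qdist (v i y) (tuple fun _ => c' i)
  have h3 : qdist (v i x) (v i y) ≤ a + b + e := by linarith
  have h4 : qdist (v i x) (v i y) ^ 2 ≤ (a + b + e) ^ 2 := by gcongr
  nlinarith [sq_nonneg (a - b), sq_nonneg (b - e), sq_nonneg (a - e)]

variable [NeZero n]

theorem isOpen_halfSpace : IsOpen (halfSpace n) :=
  isOpen_lt continuous_const (by fun_prop)

theorem isOpen_halfBall : IsOpen (halfBall n) := isOpen_ball.inter isOpen_halfSpace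

/-- The orthogonal projection to `∂H`. -/
noncomputable def proj (x : Euc n) : Euc n := x - x 0 • normalVec n

theorem proj_mem_bdry (x : Euc n) : proj x ∈ bdry n := by
  simp [bdry, proj, normalVec]

theorem norm_proj_le (x : Euc n) : ‖proj x‖ ≤ ‖x‖ := by
  rw [EuclideanSpace.norm_eq, EuclideanSpace.norm_eq]
  refine Real.sqrt_le_sqrt (Finset.sum_le_sum fun i _ => ?_)
  by_cases hi : i = 0
  · subst hi
    simp [proj, normalVec, sq_nonneg]
  · simp [proj, normalVec, hi]

theorem proj_of_mem_bdry {x : Euc n} (hx : x ∈ bdry n) : proj x = x := by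
  have : x 0 = 0 := hx
  simp [proj, this]

theorem norm_sub_proj {x : Euc n} (hx : 0 ≤ x 0) : ‖x - proj x‖ = x 0 := by
  rw [proj, sub_sub_cancel, norm_smul, norm_normalVec, mul_one, Real.norm_of_nonneg hx]

theorem norm_proj_sub_proj_le (x y : Euc n) : ‖proj x - proj y‖ ≤ ‖x - y‖ := by
  have : proj x - proj y = proj (x - y) := by
    simp only [proj, PiLp.sub_apply, sub_smul]; abel
  rw [this]
  exact norm_proj_le _

theorem ball_subset_ball_proj {x : Euc n} (hx : 0 < x 0) :
    ball x (x 0) ⊆ ball (proj x) (2 * x 0) ∩ halfSpace n := by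
  intro y hy
  rw [mem_ball, dist_eq_norm] at hy
  refine ⟨?_, ?_⟩
  · rw [mem_ball, dist_eq_norm]
    have h1 := norm_sub_le_norm_sub_add_norm_sub y x (proj x)
    rw [norm_sub_proj hx.le] at h1
    linarith
  · have h1 := (abs_coord_le (y - x) 0).trans_lt hy
    rw [PiLp.sub_apply, abs_lt] at h1
    change 0 < y 0
    linarith [h1.1]

/-- Boundary values, their modulus of continuity, and the interior estimates measured by the
distance to the boundary. -/
theorem exists_boundary_modulus (n k : ℕ) [NeZero n] {C₁ : ℝ} (hC₁ : 0 < C₁) :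
    ∃ K : ℝ, 0 < K ∧ ∀ {N : ℕ} {q : Fin N → ℕ} {𝔅 : Set (MultiMap n k q)}, (∀ i, 0 < q i) →
      IsBlowUpClass C₁ 𝔅 → ∀ v ∈ 𝔅,
      ∀ M : ℝ, 0 ≤ M → sqInt v (ball 0 (1 / 2) ∩ halfSpace n) = ENNReal.ofReal M →
      ∃ κ : Euc n → Fin N → Euc k,
        (∀ z ∈ bdry n, ‖z‖ ≤ 1 / 8 → weightSq q (κ z) ≤ K * M) ∧
        (∀ z ∈ bdry n, ∀ z' ∈ bdry n, ‖z‖ ≤ 1 / 8 → ‖z'‖ ≤ 1 / 8 →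
          weightSq q (κ z - κ z') ≤ K * ‖z - z'‖ * M) ∧
        ∀ x ∈ halfSpace n, ‖x‖ ≤ 1 / 8 → shiftSq v (κ (proj x)) x ≤ K * x 0 * M ∧
          ∀ y ∈ ball x (x 0 / 4),
            ∑ i, qdist (v i x) (v i y) ^ 2 ≤ K * ‖x - y‖ ^ 2 / x 0 * M := by
  obtain ⟨K, hK, hdecay⟩ := exists_boundary_decay n hC₁
  obtain ⟨C, hC, hint⟩ := exists_goodHarmonic_estimate n k
  set c := volume.real (ball (0 : Euc n) 1) with hcdef
  have hc : 0 < c := measureReal_ball_pos n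
  set K₃ : ℝ := 2 * K * 2 ^ n * (1 + 2 ^ (n + 1)) / c with hK₃
  set K₄ : ℝ := C * K * 2 ^ (n + 1) with hK₄
  have hK₃0 : 0 < K₃ := by positivity
  have hK₄0 : 0 < K₄ := by positivity
  refine ⟨32 * K + K₃ + K₄, by positivity, fun {N q 𝔅} hq h𝔅 v hv M hM0 hM => ?_⟩
  obtain ⟨κ, hκ⟩ := hdecay h𝔅 v hv M hM0 hM
  have hL2 : ∀ i, MemL2 (v i) (halfBall n) := fun i => (h𝔅.integrability v hv i).1
  have hhalf : ∀ z : Euc n, ‖z‖ ≤ 1 / 8 → ∀ σ ≤ 1 / 4, ball z σ ∩ halfSpace n ⊆ halfBall n :=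
    fun z hz σ hσ => ball_inter_half_subset (by linarith)
  refine ⟨κ, fun z hz hz8 => ?_, fun z hz z' hz' hz8 hz8' => ?_, fun x hx hx8 => ?_⟩
  · refine (hκ z hz (by linarith)).1.trans ?_
    gcongr
    linarith
  · rcases le_total ‖z - z'‖ (1 / 8) with hs8 | hs8
    · rcases (norm_nonneg (z - z')).eq_or_lt with h0 | hs
      · have : z = z' := sub_eq_zero.1 (norm_eq_zero.1 h0.symm)
        subst this
        simp [weightSq]
      · set s := ‖z - z'‖ with hsdef
        -- This ball lies in the half-balls of radius s about z and 2s about z', so both decay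
        -- estimates hold on it; dividing s^(n+1) by its volume leaves s.
        have hb := ball_subset_half hz hs
        have hb' : ball z s ∩ halfSpace n ⊆ ball z' (2 * s) ∩ halfSpace n := by
          refine inter_subset_inter_left _ (ball_subset_ball' ?_)
          rw [dist_eq_norm]; linarith
        have h1 := weightSq_mul_volume_le hL2 (p := z + (s / 2) • normalVec n) (s := s / 2)
          (by positivity) (hb.trans (hhalf z hz8 s (by linarith))) (κ z) (κ z')
          (I := K * s ^ (n + 1) * M) (I' := K * (2 * s) ^ (n + 1) * M)
          (by positivity) (by positivity)
          ((lintegral_mono_set hb).trans ((hκ z hz (by linarith)).2 s hs (by linarith)))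
          ((lintegral_mono_set (hb.trans hb')).trans
            ((hκ z' hz' (by linarith)).2 (2 * s) (by linarith) (by linarith)))
        rw [← hcdef, ← le_div_iff₀ (by positivity)] at h1
        refine h1.trans ?_
        have e1 : (2 * (K * s ^ (n + 1) * M) + 2 * (K * (2 * s) ^ (n + 1) * M)) /
            (c * (s / 2) ^ n) = K₃ * s * M := by
          rw [hK₃, mul_pow, div_pow]; field_simp; ring
        rw [e1]
        gcongr
        linarith
    -- For points at least 1/8 apart the size of κ suffices: 4K = 32K · (1/8).
    · refine (weightSq_le _ _).trans ?_
      have h1 := (hκ z hz (by linarith)).1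
      have h2 := (hκ z' hz' (by linarith)).1
      have h3 : 32 * K * (1 / 8) * M ≤ (32 * K + K₃ + K₄) * ‖z - z'‖ * M := by
        gcongr
        linarith
      linarith
  · have hx0 : 0 < x 0 := hx
    set d := x 0 with hd
    have hd8 : d ≤ 1 / 8 := (le_abs_self _).trans ((abs_coord_le x 0).trans hx8)
    have hz8 := (norm_proj_le x).trans hx8
    have hsub := ball_subset_ball_proj hx0
    have hsub' := hsub.trans (hhalf _ hz8 (2 * d) (by linarith))
    -- Boundary decay on the ball of radius 2d about the projection makes the integral of order
    -- d^(n+1). The interior estimates divide by d^n and d^(n+2), leaving d and |x - y|²/d.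
    have h1 := (lintegral_mono_set hsub).trans
      ((hκ _ (proj_mem_bdry x) (by linarith)).2 (2 * d) (by linarith) (by linarith))
    rw [lintegral_shiftSq hL2 hsub'] at h1
    -- Each component is estimated by its own integral and the results are summed, so the constant
    -- does not depend on `N`.
    set J : Fin N → ℝ≥0∞ := fun i =>
      ∫⁻ y in ball x d, ENNReal.ofReal (qnorm (shift (v i y) (κ (proj x) i)) ^ 2) with hJ
    have hJtop : ∀ i, J i ≠ ⊤ := fun i =>
      ne_top_of_le_ne_top ENNReal.ofReal_ne_top
        ((Finset.single_le_sum (fun _ _ => zero_le) (Finset.mem_univ i)).trans h1)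
    have hJsum : ∑ i, (J i).toReal ≤ K * (2 * d) ^ (n + 1) * M := by
      rw [← ENNReal.toReal_sum fun i _ => hJtop i]
      exact ENNReal.toReal_le_of_le_ofReal (by positivity) h1
    have hest := fun i => hint (hq i) isOpen_halfBall (h𝔅.interior v hv i) (κ (proj x) i) x d
      (J i).toReal hx0 ENNReal.toReal_nonneg hsub' (ENNReal.ofReal_toReal (hJtop i)).ge
    have hKK : K₄ ≤ 32 * K + K₃ + K₄ := by linarith
    constructor
    · calc shiftSq v (κ (proj x)) x ≤ ∑ i, C * (J i).toReal / d ^ n :=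
            Finset.sum_le_sum fun i _ => (hest i).1
        _ = C / d ^ n * ∑ i, (J i).toReal := by
            rw [Finset.mul_sum]; exact Finset.sum_congr rfl fun i _ => by ring
        _ ≤ C / d ^ n * (K * (2 * d) ^ (n + 1) * M) := by gcongr
        _ = K₄ * d * M := by rw [hK₄, mul_pow]; field_simp; ring
        _ ≤ _ := by gcongr
    · intro y hy
      calc ∑ i, qdist (v i x) (v i y) ^ 2
          ≤ ∑ i, C * ‖x - y‖ ^ 2 * (J i).toReal / d ^ (n + 2) :=
            Finset.sum_le_sum fun i _ => (hest i).2 y hy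
        _ = C * ‖x - y‖ ^ 2 / d ^ (n + 2) * ∑ i, (J i).toReal := by
            rw [Finset.mul_sum]; exact Finset.sum_congr rfl fun i _ => by ring
        _ ≤ C * ‖x - y‖ ^ 2 / d ^ (n + 2) * (K * (2 * d) ^ (n + 1) * M) := by gcongr
        _ = K₄ * ‖x - y‖ ^ 2 / d * M := by rw [hK₄, mul_pow]; field_simp; ring
        _ ≤ _ := by gcongr

open Classical in
/-- The extension of `v` by the values `κ` outside the half-space. -/
noncomputable def extend (v : MultiMap n k q) (κ : Euc n → Fin N → Euc k) : MultiMap n k q :=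
  fun i x => if 0 < x 0 then v i x else tuple fun _ => κ x i

theorem extend_of_pos (v : MultiMap n k q) (κ : Euc n → Fin N → Euc k) (i : Fin N) {x : Euc n}
    (hx : 0 < x 0) : extend v κ i x = v i x := if_pos hx

theorem extend_of_mem_bdry (v : MultiMap n k q) (κ : Euc n → Fin N → Euc k) (i : Fin N)
    {x : Euc n} (hx : x ∈ bdry n) : extend v κ i x = tuple fun _ => κ x i :=
  if_neg (not_lt.2 (le_of_eq hx))

theorem closure_half_subset (R : ℝ) :
    closure (ball 0 R ∩ halfSpace n) ⊆ {x : Euc n | ‖x‖ ≤ R ∧ 0 ≤ x 0} := by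
  refine closure_minimal (fun x hx => ⟨?_, ?_⟩) ?_
  · exact (mem_ball_zero_iff.1 hx.1).le
  · exact le_of_lt hx.2
  · exact (isClosed_le continuous_norm continuous_const).inter
      (isClosed_le continuous_const (by fun_prop : Continuous fun x : Euc n => x 0))

/-- A blow-up extends to the closed half-ball with square-root modulus of continuity. -/
theorem exists_extension (n k : ℕ) [NeZero n] {C₁ : ℝ} (hC₁ : 0 < C₁) :
    ∃ K : ℝ, 0 < K ∧ ∀ {N : ℕ} {q : Fin N → ℕ} {𝔅 : Set (MultiMap n k q)}, (∀ i, 0 < q i) →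
      IsBlowUpClass C₁ 𝔅 → ∀ v ∈ 𝔅,
      ∀ M : ℝ, 0 ≤ M → sqInt v (ball 0 (1 / 2) ∩ halfSpace n) = ENNReal.ofReal M →
      ∃ w : MultiMap n k q, (∀ i, EqOn (w i) (v i) (halfSpace n)) ∧
        (∀ x : Euc n, ‖x‖ ≤ 1 / 8 → 0 ≤ x 0 → ∑ i, qnorm (w i x) ^ 2 ≤ K * M) ∧
        ∀ x y : Euc n, ‖x‖ ≤ 1 / 8 → 0 ≤ x 0 → ‖y‖ ≤ 1 / 8 → 0 ≤ y 0 →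
          ∑ i, qdist (w i x) (w i y) ^ 2 ≤ K * dist x y * M := by
  obtain ⟨K, hK, hmod⟩ := exists_boundary_modulus n k hC₁
  refine ⟨30 * K, by positivity, fun {N q 𝔅} hq h𝔅 v hv M hM0 hM => ?_⟩
  obtain ⟨κ, hκ, hκκ, hv'⟩ := hmod hq h𝔅 v hv M hM0 hM
  set w := extend v κ with hw
  have hwκ : ∀ x : Euc n, ‖x‖ ≤ 1 / 8 → 0 ≤ x 0 →
      shiftSq w (κ (proj x)) x ≤ K * x 0 * M := fun x hx hx0 => by
    rcases hx0.eq_or_lt with h0 | h0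
    · have hxb : x ∈ bdry n := h0.symm
      rw [← h0, proj_of_mem_bdry hxb]
      refine le_of_eq ?_
      simp [shiftSq, hw, extend_of_mem_bdry v κ _ hxb, qnorm_shift_eq]
    · have : shiftSq w (κ (proj x)) x = shiftSq v (κ (proj x)) x := by
        simp only [shiftSq, hw, extend_of_pos v κ _ h0]
      rw [this]
      exact (hv' x h0 hx).1
  refine ⟨w, fun i x hx => extend_of_pos v κ i hx, fun x hx hx0 => ?_, ?_⟩
  · have h1 := shiftSq_le w 0 (κ (proj x)) x
    rw [shiftSq_zero, weightSq_neg, sub_zero] at h1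
    have h2 := hwκ x hx hx0
    have h3 := hκ _ (proj_mem_bdry x) ((norm_proj_le x).trans hx)
    have h4 : x 0 ≤ 1 / 8 := (le_abs_self _).trans ((abs_coord_le x 0).trans hx)
    have h5 : K * x 0 * M ≤ K * (1 / 8) * M := by gcongr
    have h6 : 0 ≤ K * M := by positivity
    linarith
  -- By symmetry x may be taken to be the point farther from ∂H.
  · have key : ∀ x y : Euc n, ‖x‖ ≤ 1 / 8 → 0 ≤ x 0 → ‖y‖ ≤ 1 / 8 → 0 ≤ y 0 → y 0 ≤ x 0 →
        ∑ i, qdist (w i x) (w i y) ^ 2 ≤ 30 * K * dist x y * M := by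
      intro x y hx hx0 hy hy0 hyx
      rw [dist_eq_norm]
      -- For nearby points |x - y|²/x⁰ ≤ |x - y|, where x⁰ is the distance to ∂H. Otherwise both
      -- distances to ∂H are at most 4|x - y|, and passing through the boundary values costs 3(4 + 1
      -- + 4) = 27 ≤ 30.
      rcases lt_or_ge ‖x - y‖ (x 0 / 4) with hxy | hxy
      · have hx0' : 0 < x 0 := by linarith [norm_nonneg (x - y)]
        have hy0' : 0 < y 0 := by
          have := (abs_coord_le (x - y) 0).trans_lt hxy
          rw [PiLp.sub_apply, abs_lt] at this
          linarith [this.2]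
        simp only [hw, extend_of_pos v κ _ hx0', extend_of_pos v κ _ hy0']
        refine ((hv' x hx0' hx).2 y (by rwa [mem_ball', dist_eq_norm])).trans ?_
        gcongr ?_ * M
        rw [div_le_iff₀ hx0']
        have h1 : K * ‖x - y‖ * ‖x - y‖ ≤ K * ‖x - y‖ * (30 * x 0) := by
          gcongr; linarith
        linarith
      · refine (sum_qdist_sq_le w (κ (proj x)) (κ (proj y)) x y).trans ?_
        have h1 := hwκ x hx hx0
        have h2 := hwκ y hy hy0
        have h3 := hκκ _ (proj_mem_bdry x) _ (proj_mem_bdry y) ((norm_proj_le x).trans hx)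
          ((norm_proj_le y).trans hy)
        have h4 : K * x 0 * M ≤ K * (4 * ‖x - y‖) * M := by gcongr; linarith
        have h5 : K * y 0 * M ≤ K * (4 * ‖x - y‖) * M := by gcongr; linarith
        have h6 : K * ‖proj x - proj y‖ * M ≤ K * ‖x - y‖ * M := by
          gcongr
          exact norm_proj_sub_proj_le x y
        have h7 : 0 ≤ K * ‖x - y‖ * M := by positivity
        linarith
    intro x y hx hx0 hy hy0
    rcases le_total (y 0) (x 0) with h | h
    · exact key x y hx hx0 hy hy0 h
    · simp only [qdist_comm (w _ x), dist_comm x]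
      exact key y x hy hy0 hx hx0 h

end Extension

end MultiValued

namespace MultiValued

/-! ### From squared moduli of continuity to Hölder norms -/

section Norm

variable {n k N : ℕ} {q : Fin N → ℕ}

theorem holderNorm_le {w : MultiMap n k q} {S : Set (Euc n)} {K M : ℝ} (hK : 0 ≤ K) (hM : 0 ≤ M)
    (hsup : ∀ x ∈ S, ∑ i, qnorm (w i x) ^ 2 ≤ K * M)
    (hdist : ∀ x ∈ S, ∀ y ∈ S, ∑ i, qdist (w i x) (w i y) ^ 2 ≤ K * dist x y * M) :
    holderNorm (1 / 2) w S ≤ ENNReal.ofReal (2 * √K) * ENNReal.ofReal M ^ (1 / 2 : ℝ) := by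
  have hE : ENNReal.ofReal (2 * √K) * ENNReal.ofReal M ^ (1 / 2 : ℝ) =
      ENNReal.ofReal (√K * √M) + ENNReal.ofReal (√K * √M) := by
    rw [ENNReal.ofReal_rpow_of_nonneg hM (by norm_num), ← Real.sqrt_eq_rpow,
      ← ENNReal.ofReal_mul (by positivity), ← ENNReal.ofReal_add (by positivity) (by positivity)]
    congr 1; ring
  rw [hE, holderNorm]
  refine add_le_add (iSup₂_le fun x hx => ?_) (iSup₂_le fun x hx => iSup₂_le fun y hy => ?_)
  · rw [← Real.sqrt_mul hK]
    exact ENNReal.ofReal_le_ofReal (Real.sqrt_le_sqrt (hsup x hx))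
  -- The multiplied form also covers x = y, where the quotient is 0/0 = 0.
  · refine ENNReal.div_le_of_le_mul ?_
    rw [← Real.sqrt_eq_rpow, ← ENNReal.ofReal_mul (by positivity), ← Real.sqrt_mul hK,
      ← Real.sqrt_mul (by positivity)]
    refine ENNReal.ofReal_le_ofReal (Real.sqrt_le_sqrt ((hdist x hx y hy).trans_eq ?_))
    ring

theorem holderOn_of_sum_sq_le {w : MultiMap n k q} {S : Set (Euc n)} {L : ℝ} (hL : 0 ≤ L)
    (hdist : ∀ x ∈ S, ∀ y ∈ S, ∑ i, qdist (w i x) (w i y) ^ 2 ≤ L * dist x y) (i : Fin N) :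
    HolderOn (1 / 2) (w i) S := by
  refine ⟨√L, fun x hx y hy => ?_⟩
  rw [← Real.sqrt_eq_rpow, ← Real.sqrt_mul hL]
  refine Real.le_sqrt_of_sq_le (le_trans ?_ (hdist x hx y hy))
  exact Finset.single_le_sum (f := fun j => qdist (w j x) (w j y) ^ 2)
    (fun _ _ => sq_nonneg _) (Finset.mem_univ i)

theorem sqInt_lt_top [NeZero n] {v : MultiMap n k q} (h : ∀ i, MemL2 (v i) (halfBall n)) {S : Set (Euc n)}
    (hS : S ⊆ halfBall n) : sqInt v S < ⊤ := by
  have h1 := lintegral_shiftSq h hS 0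
  simp only [shiftSq_zero, Pi.zero_apply, shift_zero] at h1
  rw [sqInt, h1, ENNReal.sum_lt_top]
  exact fun i _ => (lintegral_mono_set hS).trans_lt (h i).2

end Norm

end MultiValued

/-! ### Boundary regularity with exponent one half -/

open MultiValued

theorem mainTheorem6 (n k : ℕ) [NeZero n] (C₁ : ℝ) (hC₁ : 0 < C₁) :
    ∃ α : ℝ, 0 < α ∧ α < 1 ∧ ∃ C : ℝ, 0 < C ∧
      ∀ (N : ℕ) (q : Fin N → ℕ), (∀ i, 0 < q i) →
      ∀ 𝔅 : Set (MultiMap n k q), IsBlowUpClass C₁ 𝔅 → ∀ v ∈ 𝔅,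
        ∃ w : MultiMap n k q,
          (∀ i, EqOn (w i) (v i) (ball 0 (1 / 8) ∩ halfSpace n)) ∧
          (∀ i, HolderOn α (w i) (closure (ball 0 (1 / 8) ∩ halfSpace n))) ∧
          holderNorm α w (closure (ball 0 (1 / 8) ∩ halfSpace n)) ≤
            ENNReal.ofReal C * (sqInt v (ball 0 (1 / 2) ∩ halfSpace n)) ^ (1 / 2 : ℝ) := by
  obtain ⟨K, hK, hext⟩ := exists_extension n k hC₁
  -- The squared modulus is linear in the distance, hence the exponent 1/2; the constant counts √K
  -- once for the supremum and once for the seminorm.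
  refine ⟨1 / 2, by norm_num, by norm_num, 2 * √K, by positivity, fun N q hq 𝔅 h𝔅 v hv => ?_⟩
  have hfin : sqInt v (ball 0 (1 / 2) ∩ halfSpace n) < ⊤ :=
    sqInt_lt_top (fun i => (h𝔅.integrability v hv i).1)
      (inter_subset_inter_left _ (ball_subset_ball (by norm_num)))
  have hM := (ENNReal.ofReal_toReal hfin.ne).symm
  set M := (sqInt v (ball 0 (1 / 2) ∩ halfSpace n)).toReal
  have hM0 : 0 ≤ M := ENNReal.toReal_nonneg
  obtain ⟨w, hwv, hsup, hdist⟩ := hext hq h𝔅 v hv M hM0 hM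
  have hcl := fun x => @closure_half_subset n _ (1 / 8) x
  refine ⟨w, fun i => (hwv i).mono inter_subset_right,
    holderOn_of_sum_sq_le (L := K * M) (by positivity) fun x hx y hy => ?_, ?_⟩
  · exact (hdist x y (hcl x hx).1 (hcl x hx).2 (hcl y hy).1 (hcl y hy).2).trans_eq (by ring)
  · rw [hM]
    exact holderNorm_le hK.le hM0 (fun x hx => hsup x (hcl x hx).1 (hcl x hx).2)
      fun x hx y hy => hdist x y (hcl x hx).1 (hcl x hx).2 (hcl y hy).1 (hcl y hy).2
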